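/- Let $N,d\ge 1$ be integers, $\tfrac12\le H<1$ and $0<\beta<N$ with $$N-2H-1<\beta<N-2H+1,\qquad\text{and put}\qquad \alpha=\frac{2H+1-N+\beta}{2}\in(0,1).$$ Let $f:\mathbb R^N\to\mathbb R$ be the Fourier transform of a measure $h(\xi)\,d\xi$, i.e. $\int f\phi\,dx=\int\widehat\phi(\xi)\,h(\xi)\,d\xi$ for all Schwartz functions $\phi$ (in particular $f\phi$ is integrable), where $\widehat\phi(\xi)=\int e^{-ix\cdot\xi}\phi(x)\,dx$ and $C_1|\xi|^{-\beta}\le h(\xi)\le C_2|\xi|^{-\beta}$ for a.e. $\xi$ with constants $0<C_1\le C_2<\infty$. Let $W=(W_1,\dots,W_d)$ be i.i.d. centred generalized Gaussian processes indexed by smooth compactly supported real functions on $\mathbb R_+\times\mathbb R^N$, with $$\mathbb E[W_j(\varphi)W_j(\psi)]=\int_{\mathbb R_+}\!\!dt\int_{\mathbb R_+}\!\!ds\int_{\mathbb R^N}\!\!dx\int_{\mathbb R^N}\!\!dy\;\varphi(t,x)\,\rho_H(t-s)\,f(x-y)\,\psi(s,y),$$ where $\rho_{1/2}=\delta$ and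 $\rho_H(r)=|r|^{2H-2}$ for $\tfrac12<H<1$. Extend each $W_j$ by isometry to the completion of the test functions; the elements of the completion are distribution-valued functions $S$ of time with squared norm $\int h(\xi)\int_{\mathbb R_+}\int_{\mathbb R_+}\widehat{S(t)}(\xi)\overline{\widehat{S(s)}(\xi)}\rho_H(t-s)\,ds\,dt\,d\xi$. Let $u=\{u(t,x):t\ge0,\ x\in\mathbb R^N\}$ be a jointly measurable version of the $\mathbb R^d$-valued random field solution of $\partial_t^2u_j=\Delta u_j+\dot W_j$, $u_j(0,x)=\partial_tu_j(0,x)=0$, that is $u_j(t,x)=W_j(g_{t,x})$ with $g_{t,x}(s,y)=G(t-s,x-y)\mathbf 1_{[0,t]}(s)$, where $G$ is the fundamental solution of the wave equation, $\widehat{G(t,\cdot)}(\xi)=\sin(t|\xi|)/|\xi|$. An $\mathbb R^d$-valued random field $X$ on $\mathbb R^k$ has a square-integrable local time on a Borel set $T$ if there is a function $L\ge 0$ in $L^2(\lambda_d\times\mathbb P)$ such that, almost surely, $\lambda_k\{z\in T:X(z)\in B\}=\int_BL(v,\omega)\,dv$ for all Borel $B\subset\mathbb R^d$ ($\lambda_k$,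 $\lambda_d$ denote Lebesgue measure). Let $T_1\subset(0,\infty)$ and $T_2\subset\mathbb R^N$ be compact intervals with nonempty interior, and $T=T_1\times T_2$. Then: (i) for every $x_0\in\mathbb R^N$, $\{u(t,x_0):t\in T_1\}$ has a square-integrable local time on $T_1$ if and only if $\alpha d<1$; (ii) for every $t_0>0$, $\{u(t_0,x):x\in T_2\}$ has a square-integrable local time on $T_2$ if and only if $\alpha d<N$; (iii) $\{u(t,x):(t,x)\in T\}$ has a square-integrable local time on $T$ if and only if $\alpha d<1+N$. -/

import Mathlib

open MeasureTheory ProbabilityTheory Filter Topology Set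
open scoped ENNReal SchwartzMap Distributions

noncomputable section

namespace FractionalWave

/-- The physical space `ℝ^N` with its Euclidean structure. -/
abbrev Space (N : ℕ) : Type := EuclideanSpace ℝ (Fin N)

/-- The open time half-space `(0, ∞) × ℝ^N`. -/
def halfSpace (N : ℕ) : TopologicalSpace.Opens (ℝ × Space N) :=
  ⟨{p | 0 < p.1}, isOpen_lt continuous_const continuous_fst⟩

/-- Real-valued smooth compactly supported test functions in space-time. -/
abbrev Test (N : ℕ) : Type := 𝓓(halfSpace N, ℝ)

/-- The Fourier transform `ξ ↦ ∫ e^{-i x·ξ} φ(x) dx` on `ℝ^N` (no `2π` in the exponent). -/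
def fourierN {N : ℕ} (φ : Space N → ℂ) (ξ : Space N) : ℂ :=
  ∫ x, Complex.exp (-Complex.I * ((inner ℝ x ξ : ℝ) : ℂ)) * φ x

/-- `f` is the spatial covariance function with spectral density `h`, where `h` is comparable to
`|ξ|^{-β}`: `f` is the Fourier transform of the measure `h(ξ) dξ`, tested on Schwartz functions. -/
structure IsSpatialCovariance {N : ℕ} (β : ℝ) (f h : Space N → ℝ) : Prop where
  measurable_density : Measurable h
  comparable : ∃ C₁ C₂ : ℝ, 0 < C₁ ∧ 0 < C₂ ∧
    ∀ᵐ ξ : Space N, C₁ * ‖ξ‖ ^ (-β) ≤ h ξ ∧ h ξ ≤ C₂ * ‖ξ‖ ^ (-β)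
  integrable : ∀ φ : 𝓢(Space N, ℂ), Integrable (fun x => (f x : ℂ) * φ x)
  fourier : ∀ φ : 𝓢(Space N, ℂ),
    ∫ x, (f x : ℂ) * φ x = ∫ ξ, fourierN φ ξ * (h ξ : ℂ)

/-- The covariance of the noise,
`∫∫∫∫ φ(t,x) ρ_H(t-s) f(x-y) ψ(s,y) dx dy ds dt` over positive times, where `ρ_H = δ` (white noise
in time) if `H = 1/2` and `ρ_H(r) = |r|^{2H-2}` otherwise. -/
def noiseCov {N : ℕ} (H : ℝ) (f : Space N → ℝ) (φ ψ : Test N) : ℝ :=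
  if H = 1 / 2 then
    ∫ t in Ioi (0 : ℝ), ∫ x : Space N, ∫ y : Space N, φ (t, x) * f (x - y) * ψ (t, y)
  else
    ∫ t in Ioi (0 : ℝ), ∫ s in Ioi (0 : ℝ), ∫ x : Space N, ∫ y : Space N,
      φ (t, x) * |t - s| ^ (2 * H - 2) * f (x - y) * ψ (s, y)

/-- `W = (W_1, …, W_d)` is a `d`-dimensional Gaussian noise with i.i.d. components: each `W_j` is a
centred generalized Gaussian process, indexed by test functions, with covariance `noiseCov H f`,
and the `d` processes are independent. -/
structure IsNoise {N d : ℕ} {Ω : Type*} [MeasurableSpace Ω] (P : Measure Ω)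
    (H : ℝ) (f : Space N → ℝ) (W : Fin d → Test N → Ω → ℝ) : Prop where
  measurable : ∀ j φ, Measurable (W j φ)
  gaussian : ∀ j, IsGaussianProcess (W j) P
  mean_zero : ∀ j φ, ∫ ω, W j φ ω ∂P = 0
  covariance : ∀ j φ ψ, ∫ ω, W j φ ω * W j ψ ω ∂P = noiseCov H f φ ψ
  indep : iIndepFun (fun j ω φ => W j φ ω) P

/-- The Fourier transform in the space variable of a test function. -/
def spatialFourier {N : ℕ} (φ : Test N) (s : ℝ) (ξ : Space N) : ℂ :=
  fourierN (fun x => (φ (s, x) : ℂ)) ξ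

/-- The quadratic form `∫∫ a(t) conj(a(s)) ρ_H(t-s) ds dt` over positive times (it is real and
nonnegative). -/
def timeForm (H : ℝ) (a : ℝ → ℂ) : ℝ :=
  if H = 1 / 2 then
    ∫ t in Ioi (0 : ℝ), ‖a t‖ ^ 2
  else
    (∫ t in Ioi (0 : ℝ), ∫ s in Ioi (0 : ℝ),
      a t * (starRingEnd ℂ) (a s) * ((|t - s| ^ (2 * H - 2) : ℝ) : ℂ)).re

/-- The squared norm of the Hilbert space of the noise, for a distribution-valued function `S` of
time given by its spatial Fourier transform `m s ξ = 𝓕(S(s))(ξ)`: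
`∫ (∫∫ m(t,ξ) conj(m(s,ξ)) ρ_H(t-s) ds dt) h(ξ) dξ`. -/
def hpNormSq {N : ℕ} (H : ℝ) (h : Space N → ℝ) (m : ℝ → Space N → ℂ) : ℝ≥0∞ :=
  ∫⁻ ξ, ENNReal.ofReal (timeForm H (fun s => m s ξ) * h ξ)

/-- `X = ∫∫ S(s,y) w(ds,dy)`, the value at `S` of the extension of the isometry `φ ↦ w(φ)` from test
functions to the Hilbert space of the noise; `S` is given by its spatial Fourier transform `m`.
That is, `S` is a limit of test functions `φ_n` in the norm of that space and `X` is the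
corresponding `L²(P)`-limit of `w(φ_n)`. -/
def IsWienerIntegral {N : ℕ} {Ω : Type*} [MeasurableSpace Ω] (P : Measure Ω)
    (H : ℝ) (h : Space N → ℝ) (w : Test N → Ω → ℝ) (m : ℝ → Space N → ℂ) (X : Ω → ℝ) : Prop :=
  ∃ φ : ℕ → Test N,
    Tendsto (fun n => hpNormSq H h (fun s ξ => spatialFourier (φ n) s ξ - m s ξ)) atTop (𝓝 0) ∧
    Tendsto (fun n => eLpNorm (fun ω => w (φ n) ω - X ω) 2 P) atTop (𝓝 0)

/-- The spatial Fourier transform `sin(t|ξ|)/|ξ|` of the fundamental solution `G(t,·)` of the wave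
equation on `ℝ^N` (the value at the single point `ξ = 0` is irrelevant). -/
def waveFourier {N : ℕ} (t : ℝ) (ξ : Space N) : ℝ :=
  Real.sin (t * ‖ξ‖) / ‖ξ‖

/-- `waveFourier` solves the wave equation on the Fourier side,
`Ĝ'' = -|ξ|² Ĝ`, `Ĝ(0) = 0`, `Ĝ'(0) = 1`. -/
theorem waveFourier_spec {N : ℕ} {ξ : Space N} (hξ : ξ ≠ 0) :
    waveFourier 0 ξ = 0 ∧ deriv (fun t => waveFourier t ξ) 0 = 1 ∧
      ∀ t, HasDerivAt (fun r => waveFourier r ξ) (Real.cos (t * ‖ξ‖)) t ∧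
        HasDerivAt (fun r => Real.cos (r * ‖ξ‖)) (-‖ξ‖ ^ 2 * waveFourier t ξ) t := by
  have hn : ‖ξ‖ ≠ 0 := norm_ne_zero_iff.mpr hξ
  have hlin : ∀ t : ℝ, HasDerivAt (fun r : ℝ => r * ‖ξ‖) ‖ξ‖ t := fun t => by
    simpa using (hasDerivAt_id t).mul_const ‖ξ‖
  have h1 : ∀ t, HasDerivAt (fun r => waveFourier r ξ) (Real.cos (t * ‖ξ‖)) t := fun t => by
    have := ((hlin t).sin).div_const ‖ξ‖
    rwa [mul_div_cancel_right₀ _ hn] at this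
  refine ⟨by simp [waveFourier], by simpa using (h1 0).deriv, fun t => ⟨h1 t, ?_⟩⟩
  have := (hlin t).cos
  convert this using 1
  unfold waveFourier
  field_simp

/-- The spatial Fourier transform of `g_{t,x}(s,y) = G(t-s, x-y) 1_{[0,t]}(s)`. -/
def gFourier {N : ℕ} (t : ℝ) (x : Space N) (s : ℝ) (ξ : Space N) : ℂ :=
  (Icc (0 : ℝ) t).indicator
    (fun r => Complex.exp (-Complex.I * ((inner ℝ x ξ : ℝ) : ℂ)) * (waveFourier (t - r) ξ : ℂ)) s

/-- `u` is (a jointly measurable version of) the random field solution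
`u_j(t,x) = W_j(g_{t,x}) = ∫₀ᵗ∫ G(t-s,x-y) W_j(ds,dy)`, `t ≥ 0`, of the linear stochastic wave
equation driven by `W` with zero initial data. -/
structure IsSolution {N d : ℕ} {Ω : Type*} [MeasurableSpace Ω] (P : Measure Ω)
    (H : ℝ) (h : Space N → ℝ) (W : Fin d → Test N → Ω → ℝ)
    (u : ℝ → Space N → Ω → EuclideanSpace ℝ (Fin d)) : Prop where
  measurable : Measurable (fun p : ℝ × Space N × Ω => u p.1 p.2.1 p.2.2)
  wiener : ∀ t : ℝ, 0 ≤ t → ∀ (x : Space N) (j : Fin d),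
    IsWienerIntegral P H h (W j) (gFourier t x) (fun ω => u t x ω j)

/-- `L` is a version of the local time on `T` of the random field `X`: almost surely, the
occupation measure `B ↦ λ{z ∈ T : X(z) ∈ B}` has density `L(·, ω)` with respect to Lebesgue
measure. -/
def IsLocalTime {Z F Ω : Type*} [MeasureSpace Z] [MeasureSpace F] [MeasurableSpace Ω]
    (P : Measure Ω) (X : Z → Ω → F) (T : Set Z) (L : F → Ω → ℝ) : Prop :=
  (∀ v ω, 0 ≤ L v ω) ∧
  ∀ᵐ ω ∂P, ∀ B : Set F, MeasurableSet B →
    volume {z | z ∈ T ∧ X z ω ∈ B} = ∫⁻ v in B, ENNReal.ofReal (L v ω)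

/-- `X` has a square-integrable local time on `T`: a version `L` belongs to `L²(λ × P)`. -/
def HasSquareIntegrableLocalTime {Z F Ω : Type*} [MeasureSpace Z] [MeasureSpace F]
    [MeasurableSpace Ω] (P : Measure Ω) (X : Z → Ω → F) (T : Set Z) : Prop :=
  ∃ L : F → Ω → ℝ, IsLocalTime P X T L ∧
    MemLp (fun p : F × Ω => L p.1 p.2) 2 ((volume : Measure F).prod P)

/-- The compact interval `∏ᵢ [cᵢ, eᵢ]` of `ℝ^N`. -/
def box {N : ℕ} (c e : Space N) : Set (Space N) :=
  {x | ∀ i, c i ≤ x i ∧ x i ≤ e i}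

end FractionalWave

end

/-! Increments of the solution have i.i.d. centred Gaussian components of variance `V(z,w)`, the
squared norm of the difference of the two wave kernels (`solution_sub_map_eq`). Everything rests on
the two-sided bound `V(z,w) ≍ ‖z-w‖^(2α)`, uniform on `T`, where `‖·‖` is the maximum of the time
and space increments: the wave operator scales time and space alike. Hence one criterion,
`solution_hasSquareIntegrableLocalTime_iff`, covers time, space and space-time, with threshold `αd <
k` where `k` is the dimension of the parameter set.

Criterion (`hasSquareIntegrableLocalTime_iff`). Mollify the occupation measure by the heat kernel
`p_ε` on `ℝ^d`. By the semigroup law, the `L²(dv ⊗ P)` inner product of the mollifications at `ε`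
and `δ` is the energy `J(ε+δ)`, with `J(η) = E ∬ p_η(X_z - X_w) = ∬ (2π(η+V))^(-d/2)`. If a local
time `L` exists then `J(η) ≤ ‖L‖²` for all `η`, and Fatou as `η → 0` bounds the integral of
`‖z-w‖^(-αd)` over `T × T`, which diverges when `αd ≥ k`. If `αd < k`, then `J` is bounded and
decreasing in `η`, which makes the mollifications Cauchy in `L²`; the limit is a local time.

Variance bounds. For `H > 1/2` the kernel `|t-s|^(-γ)`, `γ = 2-2H`, is a superposition of products
of indicators of windows `(r, r+w]`. So the time form is a weighted `L²` norm of window integrals: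
it is positive, it satisfies Minkowski's inequality, and both bounds can be read off in the time
variable, without a Fourier transform in time. At frequency `ρ = |ξ|` the wave profile has size
`1/ρ` and its primitives have size `1/ρ²`, so an increment of size `δ` costs at most a constant
times `ρ^(-1-2H) min(1, δρ)²` (`exists_timeForm_wave_le`). For the lower bound, windows of length
about `1/ρ` and averaging over a quarter period give `ρ^(-1-2H)(1 - cos((x-y)·ξ) cos((t-s)ρ))` up to
a constant (`exists_le_timeForm_wave`). Integration against `h(ξ) ≍ |ξ|^(-β)` then gives `δ^(2α)`:
from above by scaling, convergence at the origin and at infinity being the two inequalities between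
`β` and `N-2H∓1`; from below by keeping one shell `|ξ| ≍ 1/δ`, on which the average of `1 - cos cos`
is bounded below.

Law of increments. For test functions, the spatial covariance in Fourier variables turns `noiseCov`
into the Hilbert norm (`hpNormSq_sub_eq_noiseCov`); Wiener integrals follow by convergence of
characteristic functions. -/

noncomputable section

namespace FractionalWave

/-! ### The window representation of the Riesz kernel on the line -/

/-- The weight of windows of length `w` in the representation of `|τ| ^ (-γ)`. -/
def windowWeight (γ w : ℝ) : ℝ :=
  (Ioi (0 : ℝ)).indicator (fun w => γ * (γ + 1) * w ^ (-γ - 2)) w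

/-- The indicator of the event that `t` lies in the window `(r, r + w]`, `q = (w, r)`. -/
def inWindow (t : ℝ) (q : ℝ × ℝ) : ℝ :=
  (Ioc q.2 (q.2 + q.1)).indicator (fun _ => (1 : ℝ)) t

theorem windowWeight_nonneg {γ : ℝ} (hγ : 0 < γ) (w : ℝ) : 0 ≤ windowWeight γ w := by
  unfold windowWeight
  refine indicator_nonneg (fun x hx => ?_) _
  have : (0 : ℝ) < x := hx
  positivity

theorem measurable_windowWeight (γ : ℝ) : Measurable (windowWeight γ) := by
  unfold windowWeight
  exact Measurable.indicator (by fun_prop) measurableSet_Ioi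

theorem inWindow_nonneg (t : ℝ) (q : ℝ × ℝ) : 0 ≤ inWindow t q :=
  indicator_nonneg (fun _ _ => zero_le_one) _

theorem inWindow_eq_ite (t : ℝ) (q : ℝ × ℝ) :
    inWindow t q = if q.2 < t ∧ t ≤ q.2 + q.1 then 1 else 0 := by
  unfold inWindow
  rw [indicator_apply]
  rfl

theorem measurable_inWindow : Measurable (fun p : ℝ × (ℝ × ℝ) => inWindow p.1 p.2) := by
  simp_rw [inWindow_eq_ite]
  refine Measurable.ite ?_ measurable_const measurable_const
  have h1 : MeasurableSet {p : ℝ × (ℝ × ℝ) | p.2.2 < p.1} :=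
    measurableSet_lt (by fun_prop) (by fun_prop)
  have h2 : MeasurableSet {p : ℝ × (ℝ × ℝ) | p.1 ≤ p.2.2 + p.2.1} :=
    measurableSet_le (by fun_prop) (by fun_prop)
  exact h1.inter h2

/-- Both points lie in `(r, r+w]` exactly when `r` is in `[max t s - w, min t s)`. When `w < |t-s|`
the set is empty, matching the truncation in `ENNReal.ofReal`. -/
theorem lintegral_inWindow_mul (t s w : ℝ) :
    ∫⁻ r, ENNReal.ofReal (inWindow t (w, r) * inWindow s (w, r)) =
      ENNReal.ofReal (w - |t - s|) := by
  have h : (fun r => ENNReal.ofReal (inWindow t (w, r) * inWindow s (w, r))) =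
      (Ico (max t s - w) (min t s)).indicator 1 := by
    funext r
    simp only [inWindow_eq_ite, indicator_apply, mem_Ico, Pi.one_apply]
    by_cases h1 : r < t ∧ t ≤ r + w <;> by_cases h2 : r < s ∧ s ≤ r + w
    · have : max t s - w ≤ r ∧ r < min t s :=
        ⟨by rw [sub_le_iff_le_add]; exact max_le h1.2 h2.2, lt_min h1.1 h2.1⟩
      simp [h1, h2, this]
    all_goals
      have : ¬ (max t s - w ≤ r ∧ r < min t s) := by
        rintro ⟨h3, h4⟩
        have := le_max_left t s
        have := le_max_right t s
        have := lt_min_iff.1 h4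
        first
        | exact h1 ⟨by linarith, by linarith⟩
        | exact h2 ⟨by linarith, by linarith⟩
      rw [if_neg this]
      first
      | rw [if_neg h1]; simp
      | rw [if_neg h2]; simp
  rw [h, lintegral_indicator_one measurableSet_Ico, Real.volume_Ico]
  congr 1
  rw [← max_sub_min_eq_abs']
  ring

/-- With `τ = |t-s|`, integrating out the position leaves `γ(γ+1) ∫_τ^∞ w^(-γ-2)(w-τ) dw =
γ(γ+1)(1/γ - 1/(γ+1)) τ^(-γ)`; the factor `γ(γ+1)` in the weight is the normalisation. -/
theorem lintegral_window_kernel {γ : ℝ} (hγ : 0 < γ) {t s : ℝ} (hts : t ≠ s) :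
    ∫⁻ q : ℝ × ℝ, ENNReal.ofReal (windowWeight γ q.1 * (inWindow t q * inWindow s q)) =
      ENNReal.ofReal (|t - s| ^ (-γ)) := by
  set τ := |t - s| with hτ
  have hτ0 : 0 < τ := abs_pos.2 (sub_ne_zero.2 hts)
  have hm : ∀ t, Measurable (fun q : ℝ × ℝ => inWindow t q) := fun t =>
    measurable_inWindow.comp (measurable_const.prodMk measurable_id)
  rw [Measure.volume_eq_prod, lintegral_prod _ (by
    have := measurable_windowWeight γ
    have := hm t
    have := hm s
    fun_prop)]
  have h1 : ∀ w, ∫⁻ r, ENNReal.ofReal (windowWeight γ w * (inWindow t (w, r) * inWindow s (w, r)))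
      = (Ioi τ).indicator (fun w => ENNReal.ofReal
        (γ * (γ + 1) * (w ^ (-γ - 1) - τ * w ^ (-γ - 2)))) w := by
    intro w
    simp_rw [ENNReal.ofReal_mul (windowWeight_nonneg hγ w)]
    rw [lintegral_const_mul' _ _ ENNReal.ofReal_ne_top, lintegral_inWindow_mul,
      ← ENNReal.ofReal_mul (windowWeight_nonneg hγ w)]
    by_cases hw : τ < w
    · have hw0 : 0 < w := hτ0.trans hw
      rw [indicator_of_mem (show w ∈ Ioi τ from hw), windowWeight,
        indicator_of_mem (show w ∈ Ioi (0 : ℝ) from hw0)]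
      congr 1
      have : w ^ (-γ - 1) = w ^ (-γ - 2) * w := by
        rw [← Real.rpow_add_one hw0.ne']; congr 1; ring
      rw [this]; ring
    · rw [indicator_of_notMem (show w ∉ Ioi τ from hw)]
      exact ENNReal.ofReal_of_nonpos
        (mul_nonpos_of_nonneg_of_nonpos (windowWeight_nonneg hγ w) (by push Not at hw; linarith))
  simp_rw [h1]
  rw [lintegral_indicator measurableSet_Ioi]
  have i1 : IntegrableOn (fun w : ℝ => w ^ (-γ - 1)) (Ioi τ) :=
    integrableOn_Ioi_rpow_of_lt (by linarith) hτ0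
  have i2 : IntegrableOn (fun w : ℝ => w ^ (-γ - 2)) (Ioi τ) :=
    integrableOn_Ioi_rpow_of_lt (by linarith) hτ0
  rw [← ofReal_integral_eq_lintegral_ofReal (f := fun w : ℝ =>
    γ * (γ + 1) * (w ^ (-γ - 1) - τ * w ^ (-γ - 2))) ((i1.sub (i2.const_mul τ)).const_mul _)]
  · congr 1
    rw [integral_const_mul]
    rw [integral_sub i1 (i2.const_mul τ), integral_const_mul,
      integral_Ioi_rpow_of_lt (by linarith) hτ0, integral_Ioi_rpow_of_lt (by linarith) hτ0]
    have e1 : -γ - 1 + 1 = -γ := by ring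
    have e2 : -γ - 2 + 1 = -γ - 1 := by ring
    have e3 : τ ^ (-γ) = τ ^ (-γ - 1) * τ := by
      rw [← Real.rpow_add_one hτ0.ne']; congr 1; ring
    rw [e1, e2, e3]
    have : γ + 1 ≠ 0 := by positivity
    have : -γ - 1 ≠ 0 := by linarith
    field_simp
    ring
  · filter_upwards [ae_restrict_mem measurableSet_Ioi] with w hw
    have hw' : τ < w := hw
    have hw0 : 0 < w := hτ0.trans hw'
    have : w ^ (-γ - 1) = w ^ (-γ - 2) * w := by
      rw [← Real.rpow_add_one hw0.ne']; congr 1; ring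
    have h2 : 0 ≤ w ^ (-γ - 1) - τ * w ^ (-γ - 2) := by
      rw [this]
      have := Real.rpow_nonneg hw0.le (-γ - 2)
      nlinarith
    simp only [Pi.zero_apply]
    positivity

/-! ### Bounded time profiles with bounded support, and their pairing. -/

/-- Functions of time which are measurable, bounded by `M` and vanish outside `[0, T]`. -/
structure TimeAdmissible (T M : ℝ) (a : ℝ → ℂ) : Prop where
  measurable : Measurable a
  bound : ∀ t, ‖a t‖ ≤ M
  support : ∀ t, t ∉ Icc 0 T → a t = 0

theorem TimeAdmissible.nonneg {T M : ℝ} {a : ℝ → ℂ} (h : TimeAdmissible T M a) : 0 ≤ M :=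
  (norm_nonneg _).trans (h.bound 0)

theorem TimeAdmissible.mono {T M T' M' : ℝ} {a : ℝ → ℂ} (h : TimeAdmissible T M a)
    (hT : T ≤ T') (hM : M ≤ M') : TimeAdmissible T' M' a :=
  ⟨h.measurable, fun t => (h.bound t).trans hM,
    fun t ht => h.support t fun h' => ht ⟨h'.1, h'.2.trans hT⟩⟩

theorem TimeAdmissible.sub {T M M' : ℝ} {a b : ℝ → ℂ} (h : TimeAdmissible T M a)
    (h' : TimeAdmissible T M' b) : TimeAdmissible T (M + M') (fun t => a t - b t) :=
  ⟨h.measurable.sub h'.measurable,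
    fun t => (norm_sub_le _ _).trans (add_le_add (h.bound t) (h'.bound t)),
    fun t ht => by rw [h.support t ht, h'.support t ht, sub_zero]⟩

theorem TimeAdmissible.add {T M M' : ℝ} {a b : ℝ → ℂ} (h : TimeAdmissible T M a)
    (h' : TimeAdmissible T M' b) : TimeAdmissible T (M + M') (fun t => a t + b t) :=
  ⟨h.measurable.add h'.measurable,
    fun t => (norm_add_le _ _).trans (add_le_add (h.bound t) (h'.bound t)),
    fun t ht => by rw [h.support t ht, h'.support t ht, add_zero]⟩

theorem TimeAdmissible.const_mul {T M : ℝ} {a : ℝ → ℂ} (h : TimeAdmissible T M a) (c : ℂ) :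
    TimeAdmissible T (‖c‖ * M) (fun t => c * a t) :=
  ⟨h.measurable.const_mul c,
    fun t => by rw [norm_mul]; exact mul_le_mul_of_nonneg_left (h.bound t) (norm_nonneg _),
    fun t ht => by rw [h.support t ht, mul_zero]⟩

theorem TimeAdmissible.norm_le_indicator {T M : ℝ} {a : ℝ → ℂ} (h : TimeAdmissible T M a)
    (t : ℝ) : ‖a t‖ ≤ (Icc 0 T).indicator (fun _ => M) t := by
  by_cases ht : t ∈ Icc 0 T
  · rw [indicator_of_mem ht]; exact h.bound t
  · rw [indicator_of_notMem ht, h.support t ht, norm_zero]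

theorem TimeAdmissible.integrable {T M : ℝ} {a : ℝ → ℂ} (h : TimeAdmissible T M a) :
    Integrable a := by
  refine Integrable.mono' (g := (Icc 0 T).indicator (fun _ => M)) ?_
    h.measurable.aestronglyMeasurable (ae_of_all _ h.norm_le_indicator)
  exact (integrable_indicator_iff measurableSet_Icc).2
    (integrableOn_const (by simp))

/-- The profile may be nonzero at `0`, which `Ioi 0` omits, so the argument passes through `Ici 0`.
The general `F` allows use on the outer integral of an iterated one. -/
theorem TimeAdmissible.setIntegral_Ioi {T M : ℝ} {a : ℝ → ℂ} (h : TimeAdmissible T M a)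
    {E : Type*} [NormedAddCommGroup E] [NormedSpace ℝ E] (F : ℝ → ℂ → E) (hF : ∀ t, F t 0 = 0) :
    ∫ t in Ioi (0 : ℝ), F t (a t) = ∫ t, F t (a t) := by
  rw [← integral_Ici_eq_integral_Ioi]
  refine setIntegral_eq_integral_of_forall_compl_eq_zero fun t ht => ?_
  rw [h.support t fun h' => ht h'.1, hF]

/-- The integral of `a` over the window `q = (w, r)`. -/
def windowIntegral (a : ℝ → ℂ) (q : ℝ × ℝ) : ℂ := ∫ t, (inWindow t q : ℂ) * a t

/-- The measure-preserving shear `(t, s) ↦ (t, s - t)` turns the integrand into something dominated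
by a product, since differences of points of `[0,T]` lie in `[-T,T]`; there `|x|^(-γ)` is integrable
as `γ < 1`. -/
theorem integrable_abs_sub_rpow {γ : ℝ} (hγ1 : γ < 1) (T : ℝ) :
    Integrable (fun p : ℝ × ℝ => (Icc 0 T).indicator (fun _ => (1 : ℝ)) p.1 *
      (Icc 0 T).indicator (fun _ => (1 : ℝ)) p.2 * |p.1 - p.2| ^ (-γ)) := by
  have hloc : Integrable ((Icc (-T) T).indicator (fun x : ℝ => |x| ^ (-γ))) := by
    rw [integrable_indicator_iff measurableSet_Icc]
    have h1 : IntervalIntegrable (fun x : ℝ => |x| ^ (-γ)) volume 0 |T| := by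
      refine (intervalIntegral.intervalIntegrable_rpow' (r := -γ) (by linarith)).congr ?_
      intro x hx
      rw [uIoc_of_le (abs_nonneg T)] at hx
      simp only
      rw [abs_of_pos hx.1]
    have h2 : IntervalIntegrable (fun x : ℝ => |x| ^ (-γ)) volume (-|T|) 0 := by
      have := h1.comp_sub_left 0
      simp only [zero_sub, sub_zero, abs_neg] at this
      exact this.symm
    have h3 := h2.trans h1
    rw [intervalIntegrable_iff_integrableOn_Icc_of_le
      (by linarith [abs_nonneg T])] at h3
    exact h3.mono_set (Icc_subset_Icc (by linarith [le_abs_self T]) (le_abs_self T))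
  have hind : Integrable ((Icc 0 T).indicator (fun _ => (1 : ℝ))) :=
    (integrable_indicator_iff measurableSet_Icc).2 (integrableOn_const (by simp))
  have hprod := (hind.mul_prod hloc)
  have hmp := measurePreserving_prod_sub (volume : Measure ℝ) (volume : Measure ℝ)
  have hcomp := (hmp.integrable_comp hprod.aestronglyMeasurable).2 hprod
  rw [← Measure.volume_eq_prod] at hcomp
  have hm1 : Measurable ((Icc 0 T).indicator (fun _ => (1 : ℝ))) :=
    measurable_const.indicator measurableSet_Icc
  refine hcomp.mono' ?_ (ae_of_all _ fun p => ?_)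
  · refine Measurable.aestronglyMeasurable ?_
    exact ((hm1.comp measurable_fst).mul (hm1.comp measurable_snd)).mul (by fun_prop)
  · simp only [Function.comp_apply]
    by_cases h1 : p.1 ∈ Icc 0 T
    · by_cases h2 : p.2 ∈ Icc 0 T
      · have h3 : p.2 - p.1 ∈ Icc (-T) T :=
          ⟨by linarith [h1.1, h1.2, h2.1, h2.2], by linarith [h1.1, h1.2, h2.1, h2.2]⟩
        rw [indicator_of_mem h1, indicator_of_mem h2, indicator_of_mem h3, abs_sub_comm]
        simp only [one_mul, Real.norm_eq_abs]
        rw [abs_of_nonneg (Real.rpow_nonneg (abs_nonneg _) _)]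
      · rw [indicator_of_notMem h2]
        simp only [mul_zero, zero_mul, norm_zero]
        exact mul_nonneg (indicator_nonneg (fun _ _ => zero_le_one) _)
          (indicator_nonneg (fun _ _ => Real.rpow_nonneg (abs_nonneg _) _) _)
    · rw [indicator_of_notMem h1]
      simp

/-- The sesquilinear form associated with `timeForm`. -/
def timePairing (H : ℝ) (a b : ℝ → ℂ) : ℂ :=
  if H = 1 / 2 then
    ∫ t in Ioi (0 : ℝ), a t * (starRingEnd ℂ) (b t)
  else
    ∫ t in Ioi (0 : ℝ), ∫ s in Ioi (0 : ℝ),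
      a t * (starRingEnd ℂ) (b s) * ((|t - s| ^ (2 * H - 2) : ℝ) : ℂ)

theorem timeForm_eq_re_timePairing (H : ℝ) (a : ℝ → ℂ) :
    timeForm H a = (timePairing H a a).re := by
  unfold timeForm timePairing
  split_ifs
  · have : ∀ t, a t * (starRingEnd ℂ) (a t) = ((‖a t‖ ^ 2 : ℝ) : ℂ) := fun t => by
      rw [Complex.mul_conj, Complex.normSq_eq_norm_sq]
    simp_rw [this]
    rw [integral_complex_ofReal, Complex.ofReal_re]
  · rfl

theorem integrable_pairing {γ T M M' : ℝ} (hγ1 : γ < 1) {a b : ℝ → ℂ}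
    (ha : TimeAdmissible T M a) (hb : TimeAdmissible T M' b) :
    Integrable (fun p : ℝ × ℝ =>
      a p.1 * (starRingEnd ℂ) (b p.2) * ((|p.1 - p.2| ^ (-γ) : ℝ) : ℂ)) := by
  refine ((integrable_abs_sub_rpow hγ1 T).const_mul (M * M')).mono' ?_
    (ae_of_all _ fun p => ?_)
  · have := ha.measurable
    have := hb.measurable
    exact Measurable.aestronglyMeasurable (by fun_prop)
  · rw [norm_mul, norm_mul, RCLike.norm_conj, Complex.norm_real, Real.norm_eq_abs,
      abs_of_nonneg (Real.rpow_nonneg (abs_nonneg _) _)]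
    have h1 := ha.norm_le_indicator p.1
    have h2 := hb.norm_le_indicator p.2
    have e : ∀ (M t : ℝ), (Icc 0 T).indicator (fun _ => M) t =
        M * (Icc 0 T).indicator (fun _ => (1 : ℝ)) t := fun M t => by
      by_cases ht : t ∈ Icc 0 T <;> simp [ht]
    rw [e] at h1 h2
    calc ‖a p.1‖ * ‖b p.2‖ * |p.1 - p.2| ^ (-γ)
        ≤ (M * (Icc 0 T).indicator (fun _ => (1 : ℝ)) p.1) *
          (M' * (Icc 0 T).indicator (fun _ => (1 : ℝ)) p.2) * |p.1 - p.2| ^ (-γ) := by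
          gcongr
          exact (norm_nonneg _).trans h1
      _ = _ := by ring

theorem setIntegral_pairing {γ T M M' : ℝ} (hγ1 : γ < 1) {a b : ℝ → ℂ}
    (ha : TimeAdmissible T M a) (hb : TimeAdmissible T M' b) :
    ∫ t in Ioi (0 : ℝ), ∫ s in Ioi (0 : ℝ),
      a t * (starRingEnd ℂ) (b s) * ((|t - s| ^ (-γ) : ℝ) : ℂ) =
    ∫ p : ℝ × ℝ, a p.1 * (starRingEnd ℂ) (b p.2) * ((|p.1 - p.2| ^ (-γ) : ℝ) : ℂ) := by
  have h1 : ∀ t, ∫ s in Ioi (0 : ℝ), a t * (starRingEnd ℂ) (b s) * ((|t - s| ^ (-γ) : ℝ) : ℂ) =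
      ∫ s, a t * (starRingEnd ℂ) (b s) * ((|t - s| ^ (-γ) : ℝ) : ℂ) := fun t =>
    hb.setIntegral_Ioi
      (fun s z => a t * (starRingEnd ℂ) z * ((|t - s| ^ (-γ) : ℝ) : ℂ)) (by simp)
  simp_rw [h1]
  rw [ha.setIntegral_Ioi
    (fun t z => ∫ s, z * (starRingEnd ℂ) (b s) * ((|t - s| ^ (-γ) : ℝ) : ℂ)) (by simp)]
  rw [Measure.volume_eq_prod, integral_prod]
  exact integrable_pairing hγ1 ha hb

theorem measurable_window_kernel (γ : ℝ) :
    Measurable (fun z : (ℝ × ℝ) × (ℝ × ℝ) =>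
      windowWeight γ z.2.1 * (inWindow z.1.1 z.2 * inWindow z.1.2 z.2)) := by
  refine ((measurable_windowWeight γ).comp (by fun_prop)).mul (Measurable.mul ?_ ?_)
  · exact measurable_inWindow.comp (by fun_prop : Measurable fun z : (ℝ × ℝ) × (ℝ × ℝ) =>
      (z.1.1, z.2))
  · exact measurable_inWindow.comp (by fun_prop : Measurable fun z : (ℝ × ℝ) × (ℝ × ℝ) =>
      (z.1.2, z.2))

theorem ae_fst_ne_snd : ∀ᵐ p : ℝ × ℝ, p.1 ≠ p.2 := by
  rw [Measure.volume_eq_prod]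
  refine (Measure.ae_prod_iff_ae_ae ?_).2 (ae_of_all _ fun x => ?_)
  · exact (measurableSet_eq_fun measurable_fst measurable_snd).compl
  · have : ∀ᵐ y : ℝ, y ≠ x := Measure.ae_ne volume x
    filter_upwards [this] with y hy using hy.symm

theorem window_kernel_nonneg {γ : ℝ} (hγ : 0 < γ) (t s : ℝ) (q : ℝ × ℝ) :
    0 ≤ windowWeight γ q.1 * (inWindow t q * inWindow s q) :=
  mul_nonneg (windowWeight_nonneg hγ _) (mul_nonneg (inWindow_nonneg _ _) (inWindow_nonneg _ _))

theorem integrable_window_kernel {γ : ℝ} (hγ : 0 < γ) {t s : ℝ} (hts : t ≠ s) :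
    Integrable (fun q : ℝ × ℝ => windowWeight γ q.1 * (inWindow t q * inWindow s q)) := by
  refine ⟨((measurable_window_kernel γ).comp
    (measurable_const.prodMk measurable_id : Measurable fun q : ℝ × ℝ =>
      ((t, s), q))).aestronglyMeasurable, ?_⟩
  rw [hasFiniteIntegral_iff_ofReal (ae_of_all _ fun q => window_kernel_nonneg hγ t s q),
    lintegral_window_kernel hγ hts]
  exact ENNReal.ofReal_lt_top

theorem integral_window_kernel {γ : ℝ} (hγ : 0 < γ) {t s : ℝ} (hts : t ≠ s) :
    ∫ q : ℝ × ℝ, windowWeight γ q.1 * (inWindow t q * inWindow s q) = |t - s| ^ (-γ) := by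
  rw [integral_eq_lintegral_of_nonneg_ae (ae_of_all _ fun q => window_kernel_nonneg hγ t s q)
    (integrable_window_kernel hγ hts).aestronglyMeasurable, lintegral_window_kernel hγ hts,
    ENNReal.toReal_ofReal (Real.rpow_nonneg (abs_nonneg _) _)]

/-- This licenses Fubini between time pairs and windows. The kernel is nonnegative, so integrating
norms over windows first restores `|t-s|^(-γ)` and reduces the claim to `integrable_pairing`. -/
theorem integrable_pairing_window {γ T M M' : ℝ} (hγ : 0 < γ) (hγ1 : γ < 1) {a b : ℝ → ℂ}
    (ha : TimeAdmissible T M a) (hb : TimeAdmissible T M' b) :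
    Integrable (fun z : (ℝ × ℝ) × (ℝ × ℝ) => a z.1.1 * (starRingEnd ℂ) (b z.1.2) *
      ((windowWeight γ z.2.1 * (inWindow z.1.1 z.2 * inWindow z.1.2 z.2) : ℝ) : ℂ))
      ((volume : Measure (ℝ × ℝ)).prod (volume : Measure (ℝ × ℝ))) := by
  have hma := ha.measurable
  have hmb := hb.measurable
  have hmk := measurable_window_kernel γ
  rw [integrable_prod_iff (Measurable.aestronglyMeasurable (by fun_prop))]
  constructor
  · filter_upwards [ae_fst_ne_snd] with p hp
    exact (integrable_window_kernel hγ hp).ofReal.const_mul _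
  · refine (integrable_pairing hγ1 ha hb).norm.congr ?_
    filter_upwards [ae_fst_ne_snd] with p hp
    simp_rw [norm_mul _ (Complex.ofReal _), Complex.norm_real, Real.norm_eq_abs]
    rw [integral_const_mul, abs_of_nonneg (Real.rpow_nonneg (abs_nonneg _) _),
      ← integral_window_kernel hγ hp]
    congr 1
    refine integral_congr_ae (ae_of_all _ fun q => ?_)
    exact (abs_of_nonneg (window_kernel_nonneg hγ _ _ q)).symm

/-- For a fixed window the kernel separates into a factor in `t` and a factor in `s`; this is what
makes the pairing an `L²` inner product. -/
theorem integral_pairing_window_inner {γ : ℝ} (a b : ℝ → ℂ) (q : ℝ × ℝ) :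
    ∫ p : ℝ × ℝ, a p.1 * (starRingEnd ℂ) (b p.2) *
      ((windowWeight γ q.1 * (inWindow p.1 q * inWindow p.2 q) : ℝ) : ℂ) =
    (windowWeight γ q.1 : ℂ) * (windowIntegral a q * (starRingEnd ℂ) (windowIntegral b q)) := by
  unfold windowIntegral
  rw [← integral_conj, ← integral_prod_mul, ← Measure.volume_eq_prod, ← integral_const_mul]
  congr 1
  funext p
  push_cast
  rw [map_mul, Complex.conj_ofReal]
  ring

/-- For `1/2 < H < 1` the time pairing is the `L²` pairing of window integrals. -/
theorem timePairing_eq_integral_window {H T M M' : ℝ} (hH : 1 / 2 < H) (hH1 : H < 1)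
    {a b : ℝ → ℂ} (ha : TimeAdmissible T M a) (hb : TimeAdmissible T M' b) :
    timePairing H a b = ∫ q : ℝ × ℝ, (windowWeight (2 - 2 * H) q.1 : ℂ) *
      (windowIntegral a q * (starRingEnd ℂ) (windowIntegral b q)) := by
  have hγ : 0 < 2 - 2 * H := by linarith
  have hγ1 : 2 - 2 * H < 1 := by linarith
  unfold timePairing
  rw [if_neg hH.ne', show 2 * H - 2 = -(2 - 2 * H) by ring, setIntegral_pairing hγ1 ha hb]
  have hI := integrable_pairing_window hγ hγ1 ha hb
  calc ∫ p : ℝ × ℝ, a p.1 * (starRingEnd ℂ) (b p.2) * ((|p.1 - p.2| ^ (-(2 - 2 * H)) : ℝ) : ℂ)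
      = ∫ p : ℝ × ℝ, ∫ q : ℝ × ℝ, a p.1 * (starRingEnd ℂ) (b p.2) *
      ((windowWeight (2 - 2 * H) q.1 * (inWindow p.1 q * inWindow p.2 q) : ℝ) : ℂ) := by
        refine integral_congr_ae ?_
        filter_upwards [ae_fst_ne_snd] with p hp
        rw [integral_const_mul, integral_complex_ofReal, integral_window_kernel hγ hp]
    _ = _ := by
        rw [integral_integral_swap hI]
        simp_rw [integral_pairing_window_inner]

theorem integrable_timePairing_window {H T M M' : ℝ} (hH : 1 / 2 < H) (hH1 : H < 1)
    {a b : ℝ → ℂ} (ha : TimeAdmissible T M a) (hb : TimeAdmissible T M' b) :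
    Integrable (fun q : ℝ × ℝ => (windowWeight (2 - 2 * H) q.1 : ℂ) *
      (windowIntegral a q * (starRingEnd ℂ) (windowIntegral b q))) := by
  have hI := integrable_pairing_window (by linarith : 0 < 2 - 2 * H) (by linarith) ha hb
  have := hI.integral_prod_right
  simp_rw [integral_pairing_window_inner] at this
  exact this

theorem integrable_timeForm_window {H T M : ℝ} (hH : 1 / 2 < H) (hH1 : H < 1)
    {a : ℝ → ℂ} (ha : TimeAdmissible T M a) :
    Integrable (fun q : ℝ × ℝ => windowWeight (2 - 2 * H) q.1 * ‖windowIntegral a q‖ ^ 2) := by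
  have := (integrable_timePairing_window hH hH1 ha ha).re
  refine this.congr (ae_of_all _ fun q => ?_)
  simp only
  rw [Complex.mul_conj, Complex.normSq_eq_norm_sq, ← Complex.ofReal_mul]
  exact Complex.ofReal_re _

theorem timeForm_eq_integral_window {H T M : ℝ} (hH : 1 / 2 < H) (hH1 : H < 1)
    {a : ℝ → ℂ} (ha : TimeAdmissible T M a) :
    timeForm H a =
      ∫ q : ℝ × ℝ, windowWeight (2 - 2 * H) q.1 * ‖windowIntegral a q‖ ^ 2 := by
  rw [timeForm_eq_re_timePairing, timePairing_eq_integral_window hH hH1 ha ha]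
  rw [← Complex.ofReal_re (∫ q : ℝ × ℝ, windowWeight (2 - 2 * H) q.1 * ‖windowIntegral a q‖ ^ 2),
    ← integral_complex_ofReal]
  congr 2
  funext q
  rw [Complex.mul_conj, Complex.normSq_eq_norm_sq, ← Complex.ofReal_mul]

/-! ### Seminorm properties of the time form -/

theorem eLpNorm_two_toReal_eq_sqrt {X : Type*} [MeasurableSpace X] {μ : Measure X} {f : X → ℂ}
    (hf : MemLp f 2 μ) : (eLpNorm f 2 μ).toReal = √(∫ x, ‖f x‖ ^ 2 ∂μ) := by
  rw [hf.eLpNorm_eq_integral_rpow_norm (by norm_num) (by norm_num), ENNReal.toReal_ofReal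
    (Real.rpow_nonneg (integral_nonneg fun _ => Real.rpow_nonneg (norm_nonneg _) _) _),
    Real.sqrt_eq_rpow]
  norm_num

theorem sqrt_integral_norm_sq_add_le {X : Type*} [MeasurableSpace X] {μ : Measure X}
    {f g : X → ℂ} (hf : MemLp f 2 μ) (hg : MemLp g 2 μ) :
    √(∫ x, ‖f x + g x‖ ^ 2 ∂μ) ≤ √(∫ x, ‖f x‖ ^ 2 ∂μ) + √(∫ x, ‖g x‖ ^ 2 ∂μ) := by
  have h := eLpNorm_two_toReal_eq_sqrt (hf.add hg)
  simp only [Pi.add_apply] at h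
  rw [← h, ← eLpNorm_two_toReal_eq_sqrt hf, ← eLpNorm_two_toReal_eq_sqrt hg,
    ← ENNReal.toReal_add hf.eLpNorm_ne_top hg.eLpNorm_ne_top]
  exact ENNReal.toReal_mono (ENNReal.add_ne_top.2 ⟨hf.eLpNorm_ne_top, hg.eLpNorm_ne_top⟩)
    (eLpNorm_add_le hf.1 hg.1 (by norm_num))

theorem windowIntegral_eq_setIntegral (a : ℝ → ℂ) (q : ℝ × ℝ) :
    windowIntegral a q = ∫ t in Ioc q.2 (q.2 + q.1), a t := by
  unfold windowIntegral
  rw [← integral_indicator measurableSet_Ioc]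
  congr 1
  funext t
  unfold inWindow
  by_cases h : t ∈ Ioc q.2 (q.2 + q.1) <;> simp [h]

theorem measurable_windowIntegral {a : ℝ → ℂ} (ha : Measurable a) :
    Measurable (windowIntegral a) := by
  have hm : Measurable (fun p : (ℝ × ℝ) × ℝ => (inWindow p.2 p.1 : ℂ) * a p.2) := by
    have := measurable_inWindow.comp (by fun_prop : Measurable fun p : (ℝ × ℝ) × ℝ => (p.2, p.1))
    simp only [Function.comp_def] at this
    fun_prop
  exact (hm.stronglyMeasurable.integral_prod_right (ν := (volume : Measure ℝ))).measurable

theorem windowIntegral_add {T T' M M' : ℝ} {a b : ℝ → ℂ} (ha : TimeAdmissible T M a)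
    (hb : TimeAdmissible T' M' b) (q : ℝ × ℝ) :
    windowIntegral (fun t => a t + b t) q = windowIntegral a q + windowIntegral b q := by
  simp_rw [windowIntegral_eq_setIntegral]
  exact integral_add ha.integrable.integrableOn hb.integrable.integrableOn

theorem windowIntegral_const_mul (c : ℂ) (a : ℝ → ℂ) (q : ℝ × ℝ) :
    windowIntegral (fun t => c * a t) q = c * windowIntegral a q := by
  simp_rw [windowIntegral_eq_setIntegral]
  exact integral_const_mul c a

theorem TimeAdmissible.memLp_two {T M : ℝ} {a : ℝ → ℂ} (ha : TimeAdmissible T M a) :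
    MemLp a 2 := by
  have h : MemLp ((Icc 0 T).indicator fun _ : ℝ => M) 2 :=
    memLp_indicator_const 2 measurableSet_Icc M (Or.inr (by simp))
  refine h.mono ha.measurable.aestronglyMeasurable (ae_of_all _ fun t => ?_)
  exact (ha.norm_le_indicator t).trans (le_abs_self _)

theorem memLp_two_window {H T M : ℝ} (hH : 1 / 2 < H) (hH1 : H < 1) {a : ℝ → ℂ}
    (ha : TimeAdmissible T M a) :
    MemLp (fun q : ℝ × ℝ => (√(windowWeight (2 - 2 * H) q.1) : ℂ) * windowIntegral a q) 2 := by
  have h1 := measurable_windowIntegral ha.measurable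
  have h2 := measurable_windowWeight (2 - 2 * H)
  refine (memLp_two_iff_integrable_sq_norm (Measurable.aestronglyMeasurable (by fun_prop))).2 ?_
  refine (integrable_timeForm_window hH hH1 ha).congr (ae_of_all _ fun q => ?_)
  simp only
  rw [norm_mul, mul_pow, Complex.norm_real, Real.norm_eq_abs, sq_abs,
    Real.sq_sqrt (windowWeight_nonneg (by linarith) _)]

theorem timeForm_eq_integral_sqrt_window {H T M : ℝ} (hH : 1 / 2 < H) (hH1 : H < 1)
    {a : ℝ → ℂ} (ha : TimeAdmissible T M a) :
    timeForm H a =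
      ∫ q : ℝ × ℝ, ‖(√(windowWeight (2 - 2 * H) q.1) : ℂ) * windowIntegral a q‖ ^ 2 := by
  rw [timeForm_eq_integral_window hH hH1 ha]
  congr 1
  funext q
  rw [norm_mul, mul_pow, Complex.norm_real, Real.norm_eq_abs, sq_abs,
    Real.sq_sqrt (windowWeight_nonneg (by linarith) _)]

theorem timeForm_half_eq {a : ℝ → ℂ} {T M : ℝ} (ha : TimeAdmissible T M a) :
    timeForm (1 / 2) a = ∫ t, ‖a t‖ ^ 2 := by
  unfold timeForm
  rw [if_pos rfl, ha.setIntegral_Ioi (fun _ z => ‖z‖ ^ 2) (by simp)]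

theorem timeForm_nonneg {H T M : ℝ} (hH : 1 / 2 ≤ H) (hH1 : H < 1) {a : ℝ → ℂ}
    (ha : TimeAdmissible T M a) : 0 ≤ timeForm H a := by
  rcases hH.eq_or_lt with rfl | hH
  · rw [timeForm_half_eq ha]
    positivity
  · rw [timeForm_eq_integral_sqrt_window hH hH1 ha]
    positivity

/-- Minkowski's inequality: the time form is the squared `L²` norm of a linear image of the profile,
namely itself for `H = 1/2` and its weighted window integrals otherwise. -/
theorem sqrt_timeForm_add_le {H T M M' : ℝ} (hH : 1 / 2 ≤ H) (hH1 : H < 1) {a b : ℝ → ℂ}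
    (ha : TimeAdmissible T M a) (hb : TimeAdmissible T M' b) :
    √(timeForm H (fun t => a t + b t)) ≤ √(timeForm H a) + √(timeForm H b) := by
  rcases hH.eq_or_lt with rfl | hH
  · rw [timeForm_half_eq ha, timeForm_half_eq hb, timeForm_half_eq (ha.add hb)]
    exact sqrt_integral_norm_sq_add_le ha.memLp_two hb.memLp_two
  · rw [timeForm_eq_integral_sqrt_window hH hH1 ha, timeForm_eq_integral_sqrt_window hH hH1 hb,
      timeForm_eq_integral_sqrt_window hH hH1 (ha.add hb)]
    simp_rw [windowIntegral_add ha hb, mul_add]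
    exact sqrt_integral_norm_sq_add_le (memLp_two_window hH hH1 ha) (memLp_two_window hH hH1 hb)

theorem timeForm_const_mul {H T M : ℝ} (hH : 1 / 2 ≤ H) (hH1 : H < 1) {a : ℝ → ℂ}
    (ha : TimeAdmissible T M a) (c : ℂ) :
    timeForm H (fun t => c * a t) = ‖c‖ ^ 2 * timeForm H a := by
  rcases hH.eq_or_lt with rfl | hH
  · rw [timeForm_half_eq ha, timeForm_half_eq (ha.const_mul c), ← integral_const_mul]
    simp_rw [norm_mul, mul_pow]
  · rw [timeForm_eq_integral_window hH hH1 ha, timeForm_eq_integral_window hH hH1 (ha.const_mul c),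
      ← integral_const_mul]
    simp_rw [windowIntegral_const_mul, norm_mul, mul_pow]
    congr 1
    funext q
    ring

theorem timeForm_add_le {H T M M' : ℝ} (hH : 1 / 2 ≤ H) (hH1 : H < 1) {a b : ℝ → ℂ}
    (ha : TimeAdmissible T M a) (hb : TimeAdmissible T M' b) :
    timeForm H (fun t => a t + b t) ≤ 2 * timeForm H a + 2 * timeForm H b := by
  have h := sqrt_timeForm_add_le hH hH1 ha hb
  have ha0 := timeForm_nonneg hH hH1 ha
  have hb0 := timeForm_nonneg hH hH1 hb
  have hab := timeForm_nonneg hH hH1 (ha.add hb)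
  rw [← Real.sq_sqrt hab, ← Real.sq_sqrt ha0, ← Real.sq_sqrt hb0]
  nlinarith [sq_nonneg (√(timeForm H a) - √(timeForm H b)), Real.sqrt_nonneg (timeForm H a),
    Real.sqrt_nonneg (timeForm H b), Real.sqrt_nonneg (timeForm H (fun t => a t + b t))]

/-! ### Upper bound for oscillating functions -/

theorem norm_windowIntegral_le_length {T M : ℝ} {a : ℝ → ℂ} (ha : TimeAdmissible T M a)
    {q : ℝ × ℝ} (hq : 0 ≤ q.1) : ‖windowIntegral a q‖ ≤ M * q.1 := by
  rw [windowIntegral_eq_setIntegral]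
  have := norm_setIntegral_le_of_norm_le_const (μ := volume) (s := Ioc q.2 (q.2 + q.1)) (f := a)
    (C := M) (by simp) (fun t _ => ha.bound t)
  simpa [Measure.real, ENNReal.toReal_ofReal hq] using this

theorem norm_windowIntegral_le_support {T M : ℝ} (hT : 0 ≤ T) {a : ℝ → ℂ}
    (ha : TimeAdmissible T M a) (q : ℝ × ℝ) : ‖windowIntegral a q‖ ≤ M * T := by
  rw [windowIntegral_eq_setIntegral]
  calc ‖∫ t in Ioc q.2 (q.2 + q.1), a t‖ ≤ ∫ t in Ioc q.2 (q.2 + q.1), ‖a t‖ :=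
        norm_integral_le_integral_norm _
    _ ≤ ∫ t, ‖a t‖ := setIntegral_le_integral ha.integrable.norm (ae_of_all _ fun _ => norm_nonneg _)
    _ ≤ ∫ t, (Icc 0 T).indicator (fun _ => M) t := by
        refine integral_mono ha.integrable.norm ?_ ha.norm_le_indicator
        exact (integrable_indicator_iff measurableSet_Icc).2 (integrableOn_const (by simp))
    _ = M * T := by
        rw [integral_indicator measurableSet_Icc, setIntegral_const]
        simp [Measure.real, ENNReal.toReal_ofReal hT, mul_comm]

theorem windowIntegral_eq_zero {T M : ℝ} {a : ℝ → ℂ} (ha : TimeAdmissible T M a) {q : ℝ × ℝ}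
    (hq : q.2 ∉ Icc (-q.1) T) : windowIntegral a q = 0 := by
  rw [windowIntegral_eq_setIntegral]
  refine setIntegral_eq_zero_of_forall_eq_zero fun t ht => ha.support t fun h => hq ⟨?_, ?_⟩
  · linarith [ht.2, h.1]
  · linarith [ht.1, h.2]

/-- The factor `T + w` is the length of the set of positions for which a window of length `w` can
meet `[0,T]`. Below `κ` the integrand is of order `w^(-γ)`, integrable at `0` because `γ < 1`; above
`κ` it decays like `κ² w^(-γ-2)(T+w)`. Both pieces are of order `κ^(1-γ)`, using `κ ≤ T` to absorb
one spare power of `κ`. -/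
theorem lintegral_window_le {γ : ℝ} (hγ : 0 < γ) (hγ1 : γ < 1) {T κ : ℝ} (hT : 0 < T)
    (hκ : 0 < κ) (hκT : κ ≤ T) :
    ∫⁻ w : ℝ, ENNReal.ofReal (windowWeight γ w * min w κ ^ 2 * (T + w)) ≤
      ENNReal.ofReal (γ * (γ + 1) * T * (2 / (1 - γ) + 1 / (γ + 1) + 1 / γ) * κ ^ (1 - γ)) := by
  have hsplit : ∀ w : ℝ, ENNReal.ofReal (windowWeight γ w * min w κ ^ 2 * (T + w)) ≤
      (Ioc 0 κ).indicator (fun w => ENNReal.ofReal (γ * (γ + 1) * (2 * T) * w ^ (-γ))) w +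
      (Ioi κ).indicator (fun w => ENNReal.ofReal (γ * (γ + 1) * κ ^ 2 *
        (T * w ^ (-γ - 2) + w ^ (-γ - 1)))) w := by
    intro w
    rcases le_or_gt w 0 with hw | hw
    · rw [windowWeight, indicator_of_notMem (by simpa using hw)]
      simp
    have e2 : w ^ (-γ) = w ^ (-γ - 2) * w ^ 2 := by
      rw [← Real.rpow_natCast w 2, ← Real.rpow_add hw]; congr 1; push_cast; ring
    have e1 : w ^ (-γ - 1) = w ^ (-γ - 2) * w := by
      rw [← Real.rpow_add_one hw.ne']; congr 1; ring
    have hp : 0 < w ^ (-γ - 2) := Real.rpow_pos_of_pos hw _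
    rw [windowWeight, indicator_of_mem (show w ∈ Ioi (0 : ℝ) from hw)]
    rcases le_or_gt w κ with h | h
    · rw [indicator_of_mem (show w ∈ Ioc 0 κ from ⟨hw, h⟩),
        indicator_of_notMem (show w ∉ Ioi κ from not_lt.2 h), add_zero, min_eq_left h, e2]
      refine ENNReal.ofReal_le_ofReal ?_
      have : T + w ≤ 2 * T := by linarith
      calc γ * (γ + 1) * w ^ (-γ - 2) * w ^ 2 * (T + w)
          ≤ γ * (γ + 1) * w ^ (-γ - 2) * w ^ 2 * (2 * T) := by gcongr
        _ = _ := by ring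
    · rw [indicator_of_notMem (show w ∉ Ioc 0 κ from fun h' => not_lt.2 h'.2 h),
        indicator_of_mem (show w ∈ Ioi κ from h), zero_add, min_eq_right h.le, e1]
      refine ENNReal.ofReal_le_ofReal (le_of_eq ?_)
      ring
  refine (lintegral_mono hsplit).trans ?_
  rw [lintegral_add_left (Measurable.indicator (by fun_prop) measurableSet_Ioc),
    lintegral_indicator measurableSet_Ioc, lintegral_indicator measurableSet_Ioi]
  have i0 : IntegrableOn (fun w : ℝ => w ^ (-γ)) (Ioc 0 κ) := by
    have := intervalIntegral.intervalIntegrable_rpow' (a := 0) (b := κ) (r := -γ) (by linarith)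
    rwa [intervalIntegrable_iff_integrableOn_Ioc_of_le hκ.le] at this
  have i1 : IntegrableOn (fun w : ℝ => w ^ (-γ - 1)) (Ioi κ) :=
    integrableOn_Ioi_rpow_of_lt (by linarith) hκ
  have i2 : IntegrableOn (fun w : ℝ => w ^ (-γ - 2)) (Ioi κ) :=
    integrableOn_Ioi_rpow_of_lt (by linarith) hκ
  rw [← ofReal_integral_eq_lintegral_ofReal (i0.const_mul _) (by
      filter_upwards [ae_restrict_mem measurableSet_Ioc] with w hw
      have := hw.1
      simp only [Pi.zero_apply]
      positivity),
    ← ofReal_integral_eq_lintegral_ofReal (f := fun w : ℝ => γ * (γ + 1) * κ ^ 2 *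
        (T * w ^ (-γ - 2) + w ^ (-γ - 1))) (((i2.const_mul T).add i1).const_mul _) (by
      filter_upwards [ae_restrict_mem measurableSet_Ioi] with w hw
      have : 0 < w := hκ.trans hw
      simp only [Pi.zero_apply]
      positivity)]
  rw [integral_const_mul, integral_const_mul, integral_add (i2.const_mul T) i1,
    integral_const_mul, integral_Ioi_rpow_of_lt (by linarith) hκ,
    integral_Ioi_rpow_of_lt (by linarith) hκ, ← intervalIntegral.integral_of_le hκ.le,
    integral_rpow (Or.inl (by linarith)), Real.zero_rpow (by linarith), sub_zero]
  have e0 : -γ + 1 = 1 - γ := by ring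
  have e1 : -γ - 1 + 1 = -γ := by ring
  have e2 : -γ - 2 + 1 = -γ - 1 := by ring
  have e3 : κ ^ (-γ) = κ ^ (-γ - 1) * κ := by
    rw [← Real.rpow_add_one hκ.ne']; congr 1; ring
  have e4 : κ ^ (1 - γ) = κ ^ (-γ - 1) * κ ^ 2 := by
    rw [← Real.rpow_natCast κ 2, ← Real.rpow_add hκ]; congr 1; push_cast; ring
  have hp : 0 < κ ^ (-γ - 1) := Real.rpow_pos_of_pos hκ _
  have h1γ : 0 < 1 - γ := by linarith
  rw [e0, e1, e2, e3, e4, ← ENNReal.ofReal_add (by positivity) (by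
    refine mul_nonneg (by positivity) (add_nonneg (mul_nonneg hT.le ?_) ?_)
    · rw [neg_div, ← div_neg]; exact div_nonneg hp.le (by linarith)
    · rw [neg_div, ← div_neg]; exact div_nonneg (by positivity) (by linarith))]
  refine ENNReal.ofReal_le_ofReal ?_
  have h5 : -κ ^ (-γ - 1) / (-γ - 1) = κ ^ (-γ - 1) / (γ + 1) := by
    rw [show -γ - 1 = -(γ + 1) by ring, neg_div_neg_eq]
  have h6 : -(κ ^ (-γ - 1) * κ) / -γ = κ ^ (-γ - 1) * κ / γ := neg_div_neg_eq _ _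
  rw [h5, h6]
  have h7 : γ * (γ + 1) * κ ^ 2 * (κ ^ (-γ - 1) * κ / γ) ≤
      γ * (γ + 1) * κ ^ 2 * (κ ^ (-γ - 1) * T / γ) := by gcongr
  calc _ ≤ γ * (γ + 1) * (2 * T) * (κ ^ (-γ - 1) * κ ^ 2 / (1 - γ)) +
      (γ * (γ + 1) * κ ^ 2 * (T * (κ ^ (-γ - 1) / (γ + 1))) +
      γ * (γ + 1) * κ ^ 2 * (κ ^ (-γ - 1) * T / γ)) := by
        rw [mul_add (γ * (γ + 1) * κ ^ 2)]
        gcongr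
    _ = _ := by ring

/-- A window integral is at most `M min(w, κ)`, by size for short windows and by cancellation for
long ones, and it vanishes unless the window can meet `[0,T]`. -/
theorem timeForm_le_of_windowIntegral_le {H : ℝ} (hH : 1 / 2 < H) (hH1 : H < 1) {T κ M : ℝ}
    (hT : 0 < T) (hκ : 0 < κ) (hκT : κ ≤ T) {a : ℝ → ℂ} (ha : TimeAdmissible T M a)
    (hosc : ∀ q : ℝ × ℝ, 0 < q.1 → ‖windowIntegral a q‖ ≤ M * κ) :
    timeForm H a ≤ (2 - 2 * H) * (2 - 2 * H + 1) * T *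
      (2 / (1 - (2 - 2 * H)) + 1 / ((2 - 2 * H) + 1) + 1 / (2 - 2 * H)) *
        κ ^ (1 - (2 - 2 * H)) * M ^ 2 := by
  set γ := 2 - 2 * H with hγdef
  have hγ : 0 < γ := by linarith
  have hγ1 : γ < 1 := by linarith
  have hM := ha.nonneg
  have hpt : ∀ w r : ℝ, ENNReal.ofReal (windowWeight γ w * ‖windowIntegral a (w, r)‖ ^ 2) ≤
      ENNReal.ofReal (windowWeight γ w * min w κ ^ 2 * M ^ 2) *
        (Icc (-w) T).indicator (fun _ => 1) r := by
    intro w r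
    by_cases hr : r ∈ Icc (-w) T
    · rw [indicator_of_mem hr, mul_one]
      refine ENNReal.ofReal_le_ofReal ?_
      rcases le_or_gt w 0 with hw | hw
      · rw [windowWeight, indicator_of_notMem (by simpa using hw)]
        simp
      rw [mul_assoc, ← mul_pow]
      have h0 := windowWeight_nonneg hγ w
      gcongr
      rw [mul_comm, mul_min_of_nonneg _ _ hM]
      exact le_min (norm_windowIntegral_le_length ha (q := (w, r)) hw.le) (hosc (w, r) hw)
    · rw [windowIntegral_eq_zero ha hr]
      simp
  rw [timeForm_eq_integral_window hH hH1 ha, ← hγdef]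
  rw [integral_eq_lintegral_of_nonneg_ae (ae_of_all _ fun q =>
    mul_nonneg (windowWeight_nonneg hγ _) (sq_nonneg _))
    (integrable_timeForm_window hH hH1 ha).aestronglyMeasurable]
  refine ENNReal.toReal_le_of_le_ofReal (by have : 0 < 1 - γ := by linarith
                                            positivity) ?_
  rw [Measure.volume_eq_prod, lintegral_prod _ (by
    have := measurable_windowIntegral ha.measurable
    have := measurable_windowWeight γ
    fun_prop)]
  calc ∫⁻ w, ∫⁻ r, ENNReal.ofReal (windowWeight γ w * ‖windowIntegral a (w, r)‖ ^ 2)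
      ≤ ∫⁻ w, ENNReal.ofReal (windowWeight γ w * min w κ ^ 2 * (T + w)) *
          ENNReal.ofReal (M ^ 2) := by
        refine lintegral_mono fun w => (lintegral_mono (hpt w)).trans ?_
        rw [lintegral_const_mul' _ _ ENNReal.ofReal_ne_top, lintegral_indicator measurableSet_Icc,
          setLIntegral_const, one_mul, Real.volume_Icc, sub_neg_eq_add]
        have h0 : 0 ≤ windowWeight γ w * min w κ ^ 2 :=
          mul_nonneg (windowWeight_nonneg hγ w) (sq_nonneg _)
        rw [← ENNReal.ofReal_mul (mul_nonneg h0 (sq_nonneg _)),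
          ← ENNReal.ofReal_mul' (sq_nonneg _)]
        exact ENNReal.ofReal_le_ofReal (le_of_eq (by ring))
    _ ≤ ENNReal.ofReal (γ * (γ + 1) * T * (2 / (1 - γ) + 1 / (γ + 1) + 1 / γ) * κ ^ (1 - γ)) *
          ENNReal.ofReal (M ^ 2) := by
        rw [lintegral_mul_const' _ _ ENNReal.ofReal_ne_top]
        gcongr
        exact lintegral_window_le hγ hγ1 hT hκ hκT
    _ = _ := by rw [← ENNReal.ofReal_mul' (sq_nonneg _)]

/-- A function of time supported in `[0, T]`, bounded by `M`, whose primitives oscillate at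
frequency `ρ`, has time form at most of order `M² ρ^(1-2H)`. -/
theorem exists_timeForm_le {H : ℝ} (hH : 1 / 2 ≤ H) (hH1 : H < 1) {T : ℝ} (hT : 0 < T) :
    ∃ C : ℝ, 0 < C ∧ ∀ (a : ℝ → ℂ) (M ρ : ℝ), 0 < ρ → TimeAdmissible T M a →
      (∀ q : ℝ × ℝ, 0 < q.1 → ‖windowIntegral a q‖ ≤ M * (4 / ρ)) →
      timeForm H a ≤ C * M ^ 2 * ρ ^ (1 - 2 * H) := by
  rcases hH.eq_or_lt with rfl | hH
  · refine ⟨T, hT, fun a M ρ hρ ha _ => ?_⟩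
    rw [timeForm_half_eq ha]
    have h1 : (1 : ℝ) - 2 * (1 / 2) = 0 := by norm_num
    rw [h1, Real.rpow_zero, mul_one]
    calc ∫ t, ‖a t‖ ^ 2 ≤ ∫ t, (Icc 0 T).indicator (fun _ => M ^ 2) t := by
          refine integral_mono ?_ ?_ fun t => ?_
          · exact (memLp_two_iff_integrable_sq_norm ha.measurable.aestronglyMeasurable).1
              ha.memLp_two
          · exact (integrable_indicator_iff measurableSet_Icc).2 (integrableOn_const (by simp))
          · by_cases ht : t ∈ Icc 0 T
            · rw [indicator_of_mem ht]
              have := ha.bound t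
              simp only
              gcongr
            · rw [indicator_of_notMem ht, ha.support t ht]; simp
      _ = T * M ^ 2 := by
          rw [integral_indicator measurableSet_Icc, setIntegral_const]
          simp [Measure.real, ENNReal.toReal_ofReal hT.le]
  · set γ := 2 - 2 * H with hγ
    have hγ0 : 0 < γ := by linarith
    have h1γ : 0 < 1 - γ := by linarith
    set C := γ * (γ + 1) * T * (2 / (1 - γ) + 1 / (γ + 1) + 1 / γ) with hC
    have hC0 : 0 < C := by positivity
    refine ⟨C * 4 ^ (1 - γ), by positivity, fun a M ρ hρ ha hosc => ?_⟩
    have hM := ha.nonneg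
    -- The oscillation scale is capped at `T` to meet the requirement `κ ≤ T`; at low frequency the
    -- trivial bound `M * T` on window integrals replaces the oscillation bound.
    have h := timeForm_le_of_windowIntegral_le hH hH1 (κ := min (4 / ρ) T) hT (by positivity)
      (min_le_right _ _) ha (fun q hq => by
        rw [mul_min_of_nonneg _ _ hM]
        exact le_min (hosc q hq) (norm_windowIntegral_le_support hT.le ha q))
    refine h.trans ?_
    rw [← hγ, ← hC]
    have h2 : min (4 / ρ) T ^ (1 - γ) ≤ 4 ^ (1 - γ) * ρ ^ (1 - 2 * H) := by
      calc min (4 / ρ) T ^ (1 - γ) ≤ (4 / ρ) ^ (1 - γ) :=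
            Real.rpow_le_rpow (by positivity) (min_le_left _ _) h1γ.le
        _ = 4 ^ (1 - γ) * ρ ^ (1 - 2 * H) := by
            rw [Real.div_rpow (by norm_num) hρ.le, div_eq_mul_inv, ← Real.rpow_neg hρ.le]
            congr 2
            rw [hγ]; ring
    calc C * min (4 / ρ) T ^ (1 - γ) * M ^ 2 ≤ C * (4 ^ (1 - γ) * ρ ^ (1 - 2 * H)) * M ^ 2 := by
          gcongr
      _ = _ := by ring

/-! ### The time profile of the wave kernel at frequency `ρ` -/

/-- The function `s ↦ sin((t-s)ρ)/ρ` on `[0, t]`, extended by zero. -/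
def waveTime (t ρ : ℝ) (s : ℝ) : ℂ :=
  (Icc (0 : ℝ) t).indicator (fun r => ((Real.sin ((t - r) * ρ) / ρ : ℝ) : ℂ)) s

theorem gFourier_eq {N : ℕ} (t : ℝ) (x : Space N) (s : ℝ) (ξ : Space N) :
    gFourier t x s ξ =
      Complex.exp (-Complex.I * ((inner ℝ x ξ : ℝ) : ℂ)) * waveTime t ‖ξ‖ s := by
  unfold gFourier waveTime waveFourier
  by_cases h : s ∈ Icc 0 t <;> simp [h]

/-- Since `sin 0 = 0`, the cutoff at `s = t` is absorbed into a positive part, which is nonexpansive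
in `t`. Profiles with different end times then compare without case distinctions. -/
theorem waveTime_of_nonneg {t s : ℝ} (hs : 0 ≤ s) (ρ : ℝ) :
    waveTime t ρ s = ((Real.sin (max 0 (t - s) * ρ) / ρ : ℝ) : ℂ) := by
  unfold waveTime
  by_cases h : s ≤ t
  · rw [indicator_of_mem (mem_Icc.2 ⟨hs, h⟩), max_eq_right (by linarith)]
  · rw [indicator_of_notMem (fun h' => h (mem_Icc.1 h').2), max_eq_left (by linarith)]
    simp

theorem waveTime_of_neg {t s : ℝ} (hs : s < 0) (ρ : ℝ) : waveTime t ρ s = 0 :=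
  indicator_of_notMem (fun h => absurd h.1 (not_le.2 hs)) _

theorem waveTime_admissible {t T ρ : ℝ} (htT : t ≤ T) (hρ : 0 < ρ) :
    TimeAdmissible T (1 / ρ) (waveTime t ρ) where
  measurable := Measurable.indicator (by fun_prop) measurableSet_Icc
  bound s := by
    unfold waveTime
    refine (norm_indicator_le_norm_self _ _).trans ?_
    rw [Complex.norm_real, Real.norm_eq_abs, abs_div, abs_of_pos hρ]
    gcongr
    exact Real.abs_sin_le_one _
  support s hs := indicator_of_notMem (fun h => hs ⟨h.1, h.2.trans htT⟩) _

/-- A primitive of `waveTime t ρ`. -/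
def wavePrimitive (t ρ v : ℝ) : ℝ := Real.cos (max 0 (min t (t - v)) * ρ) / ρ ^ 2

/-- `wavePrimitive` clamps `t - v` to `[0,t]`, so it is continuous on the line, constant outside
`[0,t]`, and has the right derivative except possibly at `0` and `t`. The fundamental theorem of
calculus tolerates these two points. -/
theorem windowIntegral_waveTime {t ρ : ℝ} (ht : 0 ≤ t) (hρ : 0 < ρ) {q : ℝ × ℝ} (hq : 0 ≤ q.1) :
    windowIntegral (waveTime t ρ) q =
      ((wavePrimitive t ρ (q.2 + q.1) - wavePrimitive t ρ q.2 : ℝ) : ℂ) := by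
  rw [windowIntegral_eq_setIntegral, ← intervalIntegral.integral_of_le (by linarith)]
  have hcont : Continuous (fun v => ((wavePrimitive t ρ v : ℝ) : ℂ)) := by
    unfold wavePrimitive
    fun_prop
  rw [integral_eq_of_hasDerivAt_off_countable (fun v => ((wavePrimitive t ρ v : ℝ) : ℂ))
    (waveTime t ρ) (s := {0, t}) (by simp) hcont.continuousOn]
  · push_cast; ring
  · rintro v ⟨-, hv⟩
    simp only [mem_insert_iff, mem_singleton_iff, not_or] at hv
    rcases lt_or_gt_of_ne hv.1 with h0 | h0
    · rw [waveTime_of_neg h0]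
      refine (hasDerivAt_const v (((Real.cos (t * ρ) / ρ ^ 2 : ℝ)) : ℂ)).congr_of_eventuallyEq ?_
      filter_upwards [eventually_lt_nhds h0] with y hy
      unfold wavePrimitive
      rw [min_eq_left (by linarith), max_eq_right ht]
    rcases lt_or_gt_of_ne hv.2 with h1 | h1
    · have hd : HasDerivAt (fun v : ℝ => Real.cos ((t - v) * ρ) / ρ ^ 2)
          (Real.sin ((t - v) * ρ) / ρ) v := by
        have h2 : HasDerivAt (fun v : ℝ => (t - v) * ρ) (-1 * ρ) v :=
          ((hasDerivAt_id v).const_sub t).mul_const ρ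
        have h3 := h2.cos.div_const (ρ ^ 2)
        have h4 : -Real.sin ((t - v) * ρ) * (-1 * ρ) / ρ ^ 2 = Real.sin ((t - v) * ρ) / ρ := by
          field_simp
        rwa [h4] at h3
      have e : waveTime t ρ v = ((Real.sin ((t - v) * ρ) / ρ : ℝ) : ℂ) :=
        indicator_of_mem (mem_Icc.2 ⟨h0.le, h1.le⟩) _
      rw [e]
      refine hd.ofReal_comp.congr_of_eventuallyEq ?_
      filter_upwards [eventually_lt_nhds h1, eventually_gt_nhds h0] with y hy hy0
      unfold wavePrimitive
      rw [min_eq_right (by linarith), max_eq_right (by linarith)]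
    · have e : waveTime t ρ v = 0 := indicator_of_notMem (fun h => absurd h.2 (not_le.2 h1)) _
      rw [e]
      refine (hasDerivAt_const v (((Real.cos (0 * ρ) / ρ ^ 2 : ℝ)) : ℂ)).congr_of_eventuallyEq ?_
      filter_upwards [eventually_gt_nhds h1] with y hy
      unfold wavePrimitive
      rw [max_eq_left ((min_le_right _ _).trans (by linarith))]
  · exact (waveTime_admissible le_rfl hρ).integrable.intervalIntegrable

theorem abs_cos_sub_cos_le (x y : ℝ) : |Real.cos x - Real.cos y| ≤ 2 * min 1 |x - y| := by
  have h1 : |Real.cos x - Real.cos y| ≤ |x - y| := by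
    have h := Real.cos_sub_cos x y
    rw [h, abs_mul, abs_mul, abs_neg, abs_two]
    have h2 := Real.abs_sin_le_one ((x + y) / 2)
    have h3 : |Real.sin ((x - y) / 2)| ≤ |(x - y) / 2| := Real.abs_sin_le_abs
    rw [abs_div, abs_two] at h3
    nlinarith [abs_nonneg (Real.sin ((x + y) / 2)), abs_nonneg (Real.sin ((x - y) / 2))]
  have h2 : |Real.cos x - Real.cos y| ≤ 2 := by
    have := abs_sub (Real.cos x) (Real.cos y)
    linarith [Real.abs_cos_le_one x, Real.abs_cos_le_one y]
  rw [mul_min_of_nonneg _ _ zero_le_two]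
  exact le_min (by linarith) (by linarith [abs_nonneg (x - y)])

theorem abs_sin_sub_sin_le (x y : ℝ) : |Real.sin x - Real.sin y| ≤ 2 * min 1 |x - y| := by
  have h := abs_cos_sub_cos_le (Real.pi / 2 - x) (Real.pi / 2 - y)
  rw [Real.cos_pi_div_two_sub, Real.cos_pi_div_two_sub] at h
  rwa [show Real.pi / 2 - x - (Real.pi / 2 - y) = -(x - y) by ring, abs_neg] at h

theorem waveTime_sub_admissible {t s T ρ : ℝ} (ht : t ∈ Icc 0 T) (hs : s ∈ Icc 0 T)
    (hρ : 0 < ρ) :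
    TimeAdmissible T (2 * min 1 (|t - s| * ρ) / ρ)
      (fun r => waveTime t ρ r - waveTime s ρ r) where
  measurable := ((waveTime_admissible ht.2 hρ).sub (waveTime_admissible hs.2 hρ)).measurable
  support := ((waveTime_admissible ht.2 hρ).sub (waveTime_admissible hs.2 hρ)).support
  bound r := by
    rcases lt_or_ge r 0 with hr | hr
    · rw [waveTime_of_neg hr, waveTime_of_neg hr, sub_self, norm_zero]
      positivity
    · rw [waveTime_of_nonneg hr, waveTime_of_nonneg hr, ← Complex.ofReal_sub,
        Complex.norm_real, Real.norm_eq_abs, ← sub_div, abs_div, abs_of_pos hρ]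
      gcongr
      refine (abs_sin_sub_sin_le _ _).trans ?_
      gcongr
      rw [← sub_mul, abs_mul, abs_of_pos hρ]
      refine mul_le_mul_of_nonneg_right ?_ hρ.le
      refine (abs_max_sub_max_le_max _ _ _ _).trans (max_le ?_ ?_)
      · simp only [sub_self, abs_zero]; exact abs_nonneg _
      rw [sub_sub_sub_cancel_right]

/-- Clamping is nonexpansive, so the two arguments of the cosine differ by at most `|t-s| ρ`,
whatever `v`. -/
theorem abs_wavePrimitive_sub_le {t s ρ : ℝ} (hρ : 0 < ρ) (v : ℝ) :
    |wavePrimitive t ρ v - wavePrimitive s ρ v| ≤ 2 * min 1 (|t - s| * ρ) / ρ ^ 2 := by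
  unfold wavePrimitive
  rw [← sub_div, abs_div, abs_of_pos (by positivity : 0 < ρ ^ 2)]
  gcongr
  refine (abs_cos_sub_cos_le _ _).trans ?_
  gcongr
  rw [← sub_mul, abs_mul, abs_of_pos hρ]
  refine mul_le_mul_of_nonneg_right ?_ hρ.le
  refine (abs_max_sub_max_le_max _ _ _ _).trans (max_le ?_ ?_)
  · simp only [sub_self, abs_zero]; exact abs_nonneg _
  refine (abs_min_sub_min_le_max _ _ _ _).trans (max_le le_rfl ?_)
  rw [sub_sub_sub_cancel_right]

/-- Split the increment as `(e₁ - e₂) a_t + e₂ (a_t - a_s)`, with `a_t` the wave profile. Both terms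
have size at most `2 min(1, δρ)/ρ`, the first through the phases, the second through the Lipschitz
bound in time, and their primitives gain a further `1/ρ`. The general oscillation bound then
contributes `ρ^(-2) ρ^(1-2H)`. -/
theorem exists_timeForm_wave_le {H : ℝ} (hH : 1 / 2 ≤ H) (hH1 : H < 1) {T : ℝ} (hT : 0 < T) :
    ∃ C : ℝ, 0 < C ∧ ∀ (t s ρ δ : ℝ) (e₁ e₂ : ℂ), t ∈ Icc 0 T → s ∈ Icc 0 T → 0 < ρ →
      ‖e₁‖ = 1 → ‖e₂‖ = 1 → ‖e₁ - e₂‖ ≤ δ * ρ → |t - s| ≤ δ →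
      timeForm H (fun r => e₁ * waveTime t ρ r - e₂ * waveTime s ρ r) ≤
        C * (ρ ^ (-1 - 2 * H) * min 1 (δ * ρ) ^ 2) := by
  obtain ⟨C, hC, h⟩ := exists_timeForm_le hH hH1 hT
  -- `16 = 2·4 + 2·4`: a factor 2 from splitting a square, and 4 from `(2 min(1, δρ))²`, for each of
  -- the two terms.
  refine ⟨16 * C, by positivity, fun t s ρ δ e₁ e₂ ht hs hρ he₁ he₂ he hts => ?_⟩
  have hpow : ρ ^ (1 - 2 * H) = ρ ^ (-1 - 2 * H) * ρ ^ 2 := by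
    rw [← Real.rpow_natCast ρ 2, ← Real.rpow_add hρ]; congr 1; push_cast; ring
  have hδ : 0 ≤ δ := (abs_nonneg _).trans hts
  have hA : timeForm H (waveTime t ρ) ≤ C * ρ ^ (-1 - 2 * H) := by
    have := h (waveTime t ρ) (1 / ρ) ρ hρ (waveTime_admissible ht.2 hρ) fun q hq => by
      rw [windowIntegral_waveTime ht.1 hρ hq.le, Complex.norm_real, Real.norm_eq_abs]
      unfold wavePrimitive
      rw [← sub_div, abs_div, abs_of_pos (by positivity : 0 < ρ ^ 2)]
      calc _ ≤ 4 / ρ ^ 2 := by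
            gcongr
            refine (abs_cos_sub_cos_le _ _).trans ?_
            linarith [min_le_left 1 |max 0 (min t (t - (q.2 + q.1))) * ρ -
              max 0 (min t (t - q.2)) * ρ|]
        _ = _ := by field_simp
    refine this.trans (le_of_eq ?_)
    rw [hpow]
    field_simp
  have hB : timeForm H (fun r => waveTime t ρ r - waveTime s ρ r) ≤
      4 * C * ρ ^ (-1 - 2 * H) * min 1 (δ * ρ) ^ 2 := by
    have := h _ _ ρ hρ (waveTime_sub_admissible ht hs hρ) fun q hq => by
      have e : windowIntegral (fun r => waveTime t ρ r - waveTime s ρ r) q =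
          windowIntegral (waveTime t ρ) q - windowIntegral (waveTime s ρ) q := by
        simp_rw [windowIntegral_eq_setIntegral]
        exact integral_sub (waveTime_admissible ht.2 hρ).integrable.integrableOn
          (waveTime_admissible hs.2 hρ).integrable.integrableOn
      rw [e, windowIntegral_waveTime ht.1 hρ hq.le, windowIntegral_waveTime hs.1 hρ hq.le,
        ← Complex.ofReal_sub, Complex.norm_real, Real.norm_eq_abs]
      have h1 := abs_wavePrimitive_sub_le (t := t) (s := s) hρ (q.2 + q.1)
      have h2 := abs_wavePrimitive_sub_le (t := t) (s := s) hρ q.2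
      have h3 := abs_sub (wavePrimitive t ρ (q.2 + q.1) - wavePrimitive s ρ (q.2 + q.1))
        (wavePrimitive t ρ q.2 - wavePrimitive s ρ q.2)
      have h4 : 2 * min 1 (|t - s| * ρ) / ρ * (4 / ρ) =
        4 * (2 * min 1 (|t - s| * ρ) / ρ ^ 2) := by field_simp
      have h5 : 0 ≤ 2 * min 1 (|t - s| * ρ) / ρ ^ 2 := by positivity
      rw [h4, show wavePrimitive t ρ (q.2 + q.1) - wavePrimitive t ρ q.2 -
        (wavePrimitive s ρ (q.2 + q.1) - wavePrimitive s ρ q.2) =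
        wavePrimitive t ρ (q.2 + q.1) - wavePrimitive s ρ (q.2 + q.1) -
        (wavePrimitive t ρ q.2 - wavePrimitive s ρ q.2) by ring]
      linarith
    refine this.trans ?_
    rw [hpow]
    have h6 : min 1 (|t - s| * ρ) ≤ min 1 (δ * ρ) := by gcongr
    calc C * (2 * min 1 (|t - s| * ρ) / ρ) ^ 2 * (ρ ^ (-1 - 2 * H) * ρ ^ 2)
        = 4 * C * ρ ^ (-1 - 2 * H) * min 1 (|t - s| * ρ) ^ 2 := by field_simp; ring
      _ ≤ _ := by gcongr
  have hE : ‖e₁ - e₂‖ ^ 2 ≤ 4 * min 1 (δ * ρ) ^ 2 := by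
    have h1 : ‖e₁ - e₂‖ ≤ 2 * min 1 (δ * ρ) := by
      rw [mul_min_of_nonneg _ _ zero_le_two]
      refine le_min ?_ ?_
      · linarith [norm_sub_le e₁ e₂]
      · have : 0 ≤ δ * ρ := by positivity
        linarith
    calc ‖e₁ - e₂‖ ^ 2 ≤ (2 * min 1 (δ * ρ)) ^ 2 := by gcongr
      _ = _ := by ring
  have e : (fun r => e₁ * waveTime t ρ r - e₂ * waveTime s ρ r) =
      fun r => (e₁ - e₂) * waveTime t ρ r + e₂ * (waveTime t ρ r - waveTime s ρ r) := by
    funext r; ring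
  rw [e]
  have ha := waveTime_admissible ht.2 hρ
  have hd := waveTime_sub_admissible ht hs hρ
  refine (timeForm_add_le hH hH1 (ha.const_mul _) (hd.const_mul _)).trans ?_
  rw [timeForm_const_mul hH hH1 ha, timeForm_const_mul hH hH1 hd, he₂]
  have h0 : 0 ≤ timeForm H (waveTime t ρ) := timeForm_nonneg hH hH1 ha
  calc 2 * (‖e₁ - e₂‖ ^ 2 * timeForm H (waveTime t ρ)) +
        2 * (1 ^ 2 * timeForm H (fun r => waveTime t ρ r - waveTime s ρ r))
      ≤ 2 * (4 * min 1 (δ * ρ) ^ 2 * (C * ρ ^ (-1 - 2 * H))) +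
        2 * (1 ^ 2 * (4 * C * ρ ^ (-1 - 2 * H) * min 1 (δ * ρ) ^ 2)) := by gcongr
    _ = _ := by ring

/-! ### Lower bound -/

theorem norm_sub_mul_sq (e₁ e₂ : ℂ) (he₁ : ‖e₁‖ = 1) (he₂ : ‖e₂‖ = 1) (x y : ℝ) :
    ‖e₁ * (x : ℂ) - e₂ * (y : ℂ)‖ ^ 2 =
      x ^ 2 + y ^ 2 - 2 * (e₁ * (starRingEnd ℂ) e₂).re * x * y := by
  have h1 : e₁.re ^ 2 + e₁.im ^ 2 = 1 := by
    have := Complex.sq_norm e₁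
    rw [he₁, Complex.normSq_apply] at this
    linarith
  have h2 : e₂.re ^ 2 + e₂.im ^ 2 = 1 := by
    have := Complex.sq_norm e₂
    rw [he₂, Complex.normSq_apply] at this
    linarith
  rw [Complex.sq_norm, Complex.normSq_apply]
  simp only [Complex.sub_re, Complex.mul_re, Complex.ofReal_re, Complex.ofReal_im, mul_zero,
    sub_zero, Complex.sub_im, Complex.mul_im, Complex.conj_re, Complex.conj_im, zero_add]
  linear_combination x ^ 2 * h1 + y ^ 2 * h2

/-- Averaging over a quarter period. -/
theorem le_integral_norm_sub_sin_sq {e₁ e₂ : ℂ} (he₁ : ‖e₁‖ = 1) (he₂ : ‖e₂‖ = 1) {ρ L : ℝ}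
    (hρ : 0 < ρ) (A B : ℝ) :
    (L - Real.pi / (2 * ρ)) * (1 - (e₁ * (starRingEnd ℂ) e₂).re * Real.cos (A - B)) ≤
      ∫ r in (0 : ℝ)..L, ‖e₁ * (Real.sin (A - r * ρ) : ℂ) - e₂ * (Real.sin (B - r * ρ) : ℂ)‖ ^ 2 := by
  set h := Real.pi / (2 * ρ) with hh
  have hh0 : 0 < h := by have := Real.pi_pos; positivity
  set g : ℝ → ℝ := fun r =>
    ‖e₁ * (Real.sin (A - r * ρ) : ℂ) - e₂ * (Real.sin (B - r * ρ) : ℂ)‖ ^ 2 with hg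
  have hgc : Continuous g := by
    simp only [hg]
    fun_prop
  have hg0 : ∀ r, 0 ≤ g r := fun r => sq_nonneg _
  -- `hρ = π/2`: a shift by `h` turns each sine into minus a cosine, so the two squared moduli add
  -- up to a constant in `r`.
  have hsum : ∀ r, g r + g (r + h) =
      2 * (1 - (e₁ * (starRingEnd ℂ) e₂).re * Real.cos (A - B)) := by
    intro r
    simp only [hg]
    rw [norm_sub_mul_sq _ _ he₁ he₂, norm_sub_mul_sq _ _ he₁ he₂]
    have hs : ∀ A : ℝ, Real.sin (A - (r + h) * ρ) = -Real.cos (A - r * ρ) := by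
      intro A
      have : h * ρ = Real.pi / 2 := by rw [hh]; field_simp
      rw [add_mul, this, ← sub_sub, Real.sin_sub_pi_div_two]
    have h0 := Real.cos_sub (A - r * ρ) (B - r * ρ)
    rw [sub_sub_sub_cancel_right] at h0
    rw [hs, hs, h0]
    have h1 := Real.sin_sq_add_cos_sq (A - r * ρ)
    have h2 := Real.sin_sq_add_cos_sq (B - r * ρ)
    linear_combination h1 + h2
  have hi : ∀ x y, IntervalIntegrable g volume x y := fun x y => hgc.intervalIntegrable x y
  -- Each comparison drops the integral of a nonnegative function over an interval of length `h`.
  -- With oriented integrals this is valid even when `L < h`.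
  have h1 : ∫ r in (0 : ℝ)..(L - h), g r ≤ ∫ r in (0 : ℝ)..L, g r := by
    rw [← intervalIntegral.integral_add_adjacent_intervals (hi 0 (L - h)) (hi (L - h) L)]
    have := intervalIntegral.integral_nonneg (μ := volume) (f := g) (a := L - h) (b := L)
      (by linarith) (fun r _ => hg0 r)
    linarith
  have h2 : ∫ r in (0 : ℝ)..(L - h), g (r + h) ≤ ∫ r in (0 : ℝ)..L, g r := by
    rw [intervalIntegral.integral_comp_add_right, zero_add, sub_add_cancel,
      ← intervalIntegral.integral_add_adjacent_intervals (hi 0 h) (hi h L)]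
    have := intervalIntegral.integral_nonneg (μ := volume) (f := g) (a := 0) (b := h)
      hh0.le (fun r _ => hg0 r)
    linarith
  have h3 : (∫ r in (0 : ℝ)..(L - h), g r) + ∫ r in (0 : ℝ)..(L - h), g (r + h) =
      (L - h) * (2 * (1 - (e₁ * (starRingEnd ℂ) e₂).re * Real.cos (A - B))) := by
    rw [← intervalIntegral.integral_add (hi _ _) ((by fun_prop :
      Continuous fun r => g (r + h)).intervalIntegrable _ _)]
    simp_rw [hsum]
    rw [intervalIntegral.integral_const, smul_eq_mul, sub_zero]
  linarith

theorem abs_re_mul_conj_le {e₁ e₂ : ℂ} (he₁ : ‖e₁‖ = 1) (he₂ : ‖e₂‖ = 1) :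
    |(e₁ * (starRingEnd ℂ) e₂).re| ≤ 1 := by
  refine (Complex.abs_re_le_norm _).trans ?_
  rw [norm_mul, RCLike.norm_conj, he₁, he₂, one_mul]

theorem one_sub_mul_cos_nonneg {κ : ℝ} (hκ : |κ| ≤ 1) (φ : ℝ) : 0 ≤ 1 - κ * Real.cos φ := by
  have h := Real.abs_cos_le_one φ
  have : |κ * Real.cos φ| ≤ 1 := by
    rw [abs_mul]
    exact mul_le_one₀ hκ (abs_nonneg _) h
  linarith [le_abs_self (κ * Real.cos φ)]

/-- Such a window sees neither cutoff. By the sum-to-product formula, each difference of cosines is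
a sine at the midpoint of the window times a factor depending on `w` and `ρ` only, so the relative
phase `(t-s)ρ` survives. -/
theorem windowIntegral_wave_interior {t s ρ : ℝ} (hρ : 0 < ρ) (e₁ e₂ : ℂ) {w r : ℝ}
    (hw : 0 ≤ w) (hr : 0 ≤ r) (hrt : r + w ≤ t) (hrs : r + w ≤ s) :
    windowIntegral (fun v => e₁ * waveTime t ρ v - e₂ * waveTime s ρ v) (w, r) =
      ((2 * Real.sin (w * ρ / 2) / ρ ^ 2 : ℝ) : ℂ) *
        (e₁ * (Real.sin ((t - w / 2) * ρ - r * ρ) : ℂ) -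
          e₂ * (Real.sin ((s - w / 2) * ρ - r * ρ) : ℂ)) := by
  have h1 : ∀ t, r + w ≤ t → windowIntegral (waveTime t ρ) (w, r) =
      ((2 * Real.sin (w * ρ / 2) / ρ ^ 2 : ℝ) : ℂ) *
        (Real.sin ((t - w / 2) * ρ - r * ρ) : ℂ) := by
    intro t ht
    rw [windowIntegral_waveTime (by linarith) hρ hw, ← Complex.ofReal_mul]
    congr 1
    unfold wavePrimitive
    simp only
    rw [min_eq_right (by linarith), max_eq_right (by linarith), min_eq_right (by linarith),
      max_eq_right (by linarith), ← sub_div, Real.cos_sub_cos]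
    have e1 : ((t - (r + w)) * ρ + (t - r) * ρ) / 2 = (t - w / 2) * ρ - r * ρ := by ring
    have e2 : ((t - (r + w)) * ρ - (t - r) * ρ) / 2 = -(w * ρ / 2) := by ring
    rw [e1, e2, Real.sin_neg]
    ring
  have h2 : windowIntegral (fun v => e₁ * waveTime t ρ v - e₂ * waveTime s ρ v) (w, r) =
      e₁ * windowIntegral (waveTime t ρ) (w, r) - e₂ * windowIntegral (waveTime s ρ) (w, r) := by
    rw [← windowIntegral_const_mul, ← windowIntegral_const_mul]
    simp_rw [windowIntegral_eq_setIntegral]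
    exact integral_sub ((waveTime_admissible le_rfl hρ).const_mul _).integrable.integrableOn
      ((waveTime_admissible le_rfl hρ).const_mul _).integrable.integrableOn
  rw [h2, h1 t hrt, h1 s hrs]
  ring

theorem wave_sub_admissible {t s T ρ : ℝ} (e₁ e₂ : ℂ) (ht : t ≤ T) (hs : s ≤ T) (hρ : 0 < ρ) :
    TimeAdmissible T (‖e₁‖ * (1 / ρ) + ‖e₂‖ * (1 / ρ))
      (fun r => e₁ * waveTime t ρ r - e₂ * waveTime s ρ r) :=
  ((waveTime_admissible ht hρ).const_mul e₁).sub ((waveTime_admissible hs hρ).const_mul e₂)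

/-- Only times in `(0, a]` are kept, where both profiles are full sine waves. The condition `ρ ≥
8/a` makes a quarter period at most `a/2`. -/
theorem le_timeForm_wave_half {a : ℝ} {t s ρ : ℝ} {e₁ e₂ : ℂ} (ha : 0 < a)
    (ht : a ≤ t) (hs : a ≤ s) (hρ : 8 / a ≤ ρ) (he₁ : ‖e₁‖ = 1) (he₂ : ‖e₂‖ = 1) :
    a / 2 * ρ ^ (-2 : ℝ) * (1 - (e₁ * (starRingEnd ℂ) e₂).re * Real.cos ((t - s) * ρ)) ≤
      timeForm (1 / 2) (fun r => e₁ * waveTime t ρ r - e₂ * waveTime s ρ r) := by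
  have hρ0 : 0 < ρ := lt_of_lt_of_le (by positivity) hρ
  have hadm := wave_sub_admissible e₁ e₂ (le_max_left t s) (le_max_right t s) hρ0
  rw [timeForm_half_eq hadm]
  have h8 : 8 ≤ ρ * a := by rwa [div_le_iff₀ ha] at hρ
  have hpi : Real.pi / (2 * ρ) ≤ a / 2 := by
    rw [div_le_iff₀ (by positivity)]
    nlinarith [Real.pi_le_four]
  have hκ := one_sub_mul_cos_nonneg (abs_re_mul_conj_le he₁ he₂) ((t - s) * ρ)
  have key := le_integral_norm_sub_sin_sq he₁ he₂ hρ0 (t * ρ) (s * ρ) (L := a)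
  have hintg := (memLp_two_iff_integrable_sq_norm hadm.measurable.aestronglyMeasurable).1
    hadm.memLp_two
  calc _ ≤ ρ ^ (-2 : ℝ) * ((a - Real.pi / (2 * ρ)) *
        (1 - (e₁ * (starRingEnd ℂ) e₂).re * Real.cos (t * ρ - s * ρ))) := by
        rw [← sub_mul]
        have : a / 2 ≤ a - Real.pi / (2 * ρ) := by linarith
        calc _ = ρ ^ (-2 : ℝ) * (a / 2 *
              (1 - (e₁ * (starRingEnd ℂ) e₂).re * Real.cos ((t - s) * ρ))) := by ring
          _ ≤ _ := by gcongr
    _ ≤ ρ ^ (-2 : ℝ) * ∫ r in (0 : ℝ)..a, ‖e₁ * (Real.sin (t * ρ - r * ρ) : ℂ) -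
          e₂ * (Real.sin (s * ρ - r * ρ) : ℂ)‖ ^ 2 := by gcongr
    _ = ∫ r in Ioc 0 a, ‖e₁ * waveTime t ρ r - e₂ * waveTime s ρ r‖ ^ 2 := by
        rw [intervalIntegral.integral_of_le ha.le, ← integral_const_mul]
        refine setIntegral_congr_fun measurableSet_Ioc fun r hr => ?_
        have e : ∀ t, a ≤ t → waveTime t ρ r = ((Real.sin (t * ρ - r * ρ) : ℝ) : ℂ) *
            ((ρ⁻¹ : ℝ) : ℂ) := fun t ht => by
          unfold waveTime
          rw [indicator_of_mem (mem_Icc.2 ⟨hr.1.le, hr.2.trans ht⟩), sub_mul, div_eq_mul_inv,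
            Complex.ofReal_mul]
        rw [e t ht, e s hs, ← mul_assoc, ← mul_assoc, ← sub_mul _ _ ((ρ⁻¹ : ℝ) : ℂ), norm_mul, mul_pow,
          Complex.norm_real, Real.norm_eq_abs, sq_abs, mul_comm]
        congr 1
        rw [Real.rpow_neg hρ0.le, inv_pow]
        norm_num
    _ ≤ _ := setIntegral_le_integral hintg (ae_of_all _ fun _ => sq_nonneg _)

/-- Only windows inside `[0,a]` with length in `[1/ρ, 2/ρ]` are kept. Their weight is of order
`ρ^(γ+2)`, their squared integrals of order `ρ^(-4)` before averaging, and the lengths range over an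
interval of size `1/ρ`: the product is `ρ^(γ-3) = ρ^(-1-2H)`. -/
theorem le_timeForm_wave_of_half_lt {H : ℝ} (hH : 1 / 2 < H) (hH1 : H < 1) {a : ℝ} {t s ρ : ℝ}
    {e₁ e₂ : ℂ} (ha : 0 < a) (ht : a ≤ t) (hs : a ≤ s) (hρ : 8 / a ≤ ρ) (he₁ : ‖e₁‖ = 1)
    (he₂ : ‖e₂‖ = 1) :
    (2 - 2 * H) * (2 - 2 * H + 1) * 2 ^ (-(2 - 2 * H) - 2) * (4 / Real.pi ^ 2) * (a / 2) *
      ρ ^ (-1 - 2 * H) * (1 - (e₁ * (starRingEnd ℂ) e₂).re * Real.cos ((t - s) * ρ)) ≤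
      timeForm H (fun r => e₁ * waveTime t ρ r - e₂ * waveTime s ρ r) := by
  set γ := 2 - 2 * H with hγdef
  have hγ : 0 < γ := by linarith
  have hρ0 : 0 < ρ := lt_of_lt_of_le (by positivity) hρ
  have hadm := wave_sub_admissible e₁ e₂ (le_max_left t s) (le_max_right t s) hρ0
  set F := fun r => e₁ * waveTime t ρ r - e₂ * waveTime s ρ r with hF
  have h8 : 8 ≤ ρ * a := by rwa [div_le_iff₀ ha] at hρ
  have hpi : Real.pi / (2 * ρ) ≤ a / 4 := by
    rw [div_le_iff₀ (by positivity)]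
    nlinarith [Real.pi_le_four]
  have h2ρ : 2 / ρ ≤ a / 4 := by
    rw [div_le_iff₀ hρ0]
    nlinarith
  have hκ := one_sub_mul_cos_nonneg (abs_re_mul_conj_le he₁ he₂) ((t - s) * ρ)
  set κ := 1 - (e₁ * (starRingEnd ℂ) e₂).re * Real.cos ((t - s) * ρ) with hκdef
  -- The largest start for which every window considered still ends before `a`. Both `2/ρ` and the
  -- quarter period are at most `a/4`, so averaging over `(0, L]` keeps at least `a/2`.
  set L := a - 2 / ρ with hL
  have hL0 : 0 ≤ L := by linarith
  set c := γ * (γ + 1) * (2 / ρ) ^ (-γ - 2) * (4 / Real.pi ^ 2 / ρ ^ 4) with hc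
  have hpi0 := Real.pi_pos
  have hc0 : 0 < c := by positivity
  have hI := integrable_timeForm_window hH hH1 hadm
  rw [timeForm_eq_integral_window hH hH1 hadm, ← hγdef]
  rw [← hγdef] at hI
  have hset : ∫ q in Icc (1 / ρ) (2 / ρ) ×ˢ Ioc 0 L, windowWeight γ q.1 * ‖windowIntegral F q‖ ^ 2 ≤
      ∫ q : ℝ × ℝ, windowWeight γ q.1 * ‖windowIntegral F q‖ ^ 2 :=
    setIntegral_le_integral hI (ae_of_all _ fun q =>
      mul_nonneg (windowWeight_nonneg hγ _) (sq_nonneg _))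
  refine le_trans ?_ hset
  have hIon : IntegrableOn (fun q : ℝ × ℝ => windowWeight γ q.1 * ‖windowIntegral F q‖ ^ 2)
    (Icc (1 / ρ) (2 / ρ) ×ˢ Ioc 0 L) := hI.integrableOn
  rw [Measure.volume_eq_prod] at hIon ⊢
  rw [setIntegral_prod _ hIon]
  have hinner : ∀ w ∈ Icc (1 / ρ) (2 / ρ), c * (a / 2 * κ) ≤
      ∫ r in Ioc 0 L, windowWeight γ w * ‖windowIntegral F (w, r)‖ ^ 2 := by
    intro w hw
    have hw0 : 0 < w := lt_of_lt_of_le (by positivity) hw.1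
    have hwρ1 : 1 ≤ w * ρ := by have := hw.1; rwa [div_le_iff₀ hρ0] at this
    have hwρ2 : w * ρ ≤ 2 := by have := hw.2; rwa [le_div_iff₀ hρ0] at this
    -- Here `wρ/2` lies in `[1/2, 1]`, and Jordan's inequality `2x/π ≤ sin x` applies.
    have hsin : 1 / Real.pi ≤ Real.sin (w * ρ / 2) := by
      have := Real.mul_le_sin (x := w * ρ / 2) (by positivity) (by linarith [Real.pi_gt_three])
      refine le_trans ?_ this
      rw [div_le_iff₀ hpi0]
      field_simp
      linarith
    have key := le_integral_norm_sub_sin_sq he₁ he₂ hρ0 ((t - w / 2) * ρ) ((s - w / 2) * ρ)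
      (L := L)
    have hwt : γ * (γ + 1) * (2 / ρ) ^ (-γ - 2) ≤ windowWeight γ w := by
      rw [windowWeight, indicator_of_mem (show w ∈ Ioi (0 : ℝ) from hw0)]
      have := Real.rpow_le_rpow_of_nonpos hw0 hw.2 (by linarith : -γ - 2 ≤ 0)
      gcongr
    have hsq : 4 / Real.pi ^ 2 / ρ ^ 4 ≤ (2 * Real.sin (w * ρ / 2) / ρ ^ 2) ^ 2 := by
      have h1 : (1 / Real.pi) ^ 2 ≤ Real.sin (w * ρ / 2) ^ 2 := by gcongr
      calc 4 / Real.pi ^ 2 / ρ ^ 4 = 4 * (1 / Real.pi) ^ 2 / ρ ^ 4 := by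
            field_simp
        _ ≤ 4 * Real.sin (w * ρ / 2) ^ 2 / ρ ^ 4 := by gcongr
        _ = _ := by ring
    have hw' := windowWeight_nonneg hγ w
    calc c * (a / 2 * κ) ≤ (windowWeight γ w * (2 * Real.sin (w * ρ / 2) / ρ ^ 2) ^ 2) *
          ((L - Real.pi / (2 * ρ)) * κ) := by
          rw [hc]
          have : a / 2 ≤ L - Real.pi / (2 * ρ) := by linarith
          gcongr
      _ ≤ (windowWeight γ w * (2 * Real.sin (w * ρ / 2) / ρ ^ 2) ^ 2) *
          ∫ r in (0 : ℝ)..L, ‖e₁ * (Real.sin ((t - w / 2) * ρ - r * ρ) : ℂ) -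
            e₂ * (Real.sin ((s - w / 2) * ρ - r * ρ) : ℂ)‖ ^ 2 := by
          rw [← sub_mul, sub_sub_sub_cancel_right] at key
          gcongr
      _ = _ := by
          rw [intervalIntegral.integral_of_le hL0, ← integral_const_mul]
          refine setIntegral_congr_fun measurableSet_Ioc fun r hr => ?_
          have hrw : r + w ≤ a := by linarith [hr.2, hw.2]
          rw [hF, windowIntegral_wave_interior hρ0 e₁ e₂ hw0.le hr.1.le (hrw.trans ht)
            (hrw.trans hs), norm_mul, mul_pow, Complex.norm_real, Real.norm_eq_abs, sq_abs,
            mul_assoc]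
  have hconst : ∫ w in Icc (1 / ρ) (2 / ρ), c * (a / 2 * κ) = 1 / ρ * (c * (a / 2 * κ)) := by
    rw [setIntegral_const, smul_eq_mul, Measure.real, Real.volume_Icc, ENNReal.toReal_ofReal
      (by rw [sub_nonneg]; gcongr; norm_num)]
    ring
  calc _ = 1 / ρ * (c * (a / 2 * κ)) := by
        have e1 : (2 / ρ) ^ (-γ - 2) = 2 ^ (-γ - 2) * (ρ ^ (-1 - 2 * H) * ρ ^ 5) := by
          rw [Real.div_rpow (by norm_num) hρ0.le, div_eq_mul_inv, ← Real.rpow_neg hρ0.le,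
            ← Real.rpow_natCast ρ 5, ← Real.rpow_add hρ0]
          congr 2
          push_cast
          rw [hγdef]; ring
        rw [hc, e1]
        field_simp
    _ ≤ _ := by
        rw [← hconst]
        refine setIntegral_mono_on (integrableOn_const (by simp)) ?_ measurableSet_Icc hinner
        have hIon' := hIon
        rw [IntegrableOn, ← Measure.prod_restrict] at hIon'
        exact hIon'.integral_prod_left

/-- Lower bound for the time form of an increment of the wave kernel, at high frequencies. -/
theorem exists_le_timeForm_wave {H : ℝ} (hH : 1 / 2 ≤ H) (hH1 : H < 1) {a : ℝ} (ha : 0 < a) :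
    ∃ c : ℝ, 0 < c ∧ ∀ (t s ρ : ℝ) (e₁ e₂ : ℂ), a ≤ t → a ≤ s → 8 / a ≤ ρ →
      ‖e₁‖ = 1 → ‖e₂‖ = 1 →
      c * ρ ^ (-1 - 2 * H) * (1 - (e₁ * (starRingEnd ℂ) e₂).re * Real.cos ((t - s) * ρ)) ≤
        timeForm H (fun r => e₁ * waveTime t ρ r - e₂ * waveTime s ρ r) := by
  rcases hH.eq_or_lt with rfl | hH
  · refine ⟨a / 2, by positivity, fun t s ρ e₁ e₂ ht hs hρ he₁ he₂ => ?_⟩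
    have := le_timeForm_wave_half ha ht hs hρ he₁ he₂
    rwa [show (-1 : ℝ) - 2 * (1 / 2) = -2 by norm_num]
  · refine ⟨_, ?_, fun t s ρ e₁ e₂ ht hs hρ he₁ he₂ =>
      le_timeForm_wave_of_half_lt hH hH1 ha ht hs hρ he₁ he₂⟩
    have : 0 < 2 - 2 * H := by linarith
    have := Real.pi_pos
    positivity

/-! ### Radial integrals -/

/-- In polar coordinates, split at radius 1: the exponent `p` controls the origin and `q` controls
infinity. -/
theorem integrable_min_norm_rpow {N : ℕ} [Nontrivial (Space N)] {p q : ℝ} (hp : p < N)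
    (hq : (N : ℝ) < q) :
    Integrable (fun ξ : Space N => min (‖ξ‖ ^ (-p)) (‖ξ‖ ^ (-q))) := by
  have hN : 0 < N := by
    have := Module.finrank_pos (R := ℝ) (M := Space N)
    rwa [finrank_euclideanSpace_fin] at this
  refine (integrable_fun_norm_addHaar volume (f := fun r : ℝ => min (r ^ (-p)) (r ^ (-q)))).2 ?_
  rw [finrank_euclideanSpace_fin, ← Ioc_union_Ioi_eq_Ioi zero_le_one]
  have hpow : ∀ (e y : ℝ), 0 < y → y ^ (N - 1) * y ^ e = y ^ ((N : ℝ) - 1 + e) := fun e y hy => by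
    rw [← Real.rpow_natCast, ← Real.rpow_add hy, Nat.cast_sub hN, Nat.cast_one]
  have hmeas : ∀ S : Set ℝ, AEStronglyMeasurable
      (fun y : ℝ => y ^ (N - 1) • min (y ^ (-p)) (y ^ (-q))) (volume.restrict S) := fun S => by
    refine Measurable.aestronglyMeasurable ?_
    simp only [smul_eq_mul]
    exact (by fun_prop : Measurable fun y : ℝ => y ^ (N - 1)).mul
      ((by fun_prop : Measurable fun y : ℝ => y ^ (-p)).min (by fun_prop))
  have hnn : ∀ y : ℝ, 0 < y → 0 ≤ y ^ (N - 1) * min (y ^ (-p)) (y ^ (-q)) := fun y hy => by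
    positivity
  refine IntegrableOn.union ?_ ?_
  · have i0 : IntegrableOn (fun y : ℝ => y ^ ((N : ℝ) - 1 + -p)) (Ioc 0 1) := by
      have := intervalIntegral.intervalIntegrable_rpow' (a := 0) (b := 1)
        (r := (N : ℝ) - 1 + -p) (by linarith)
      rwa [intervalIntegrable_iff_integrableOn_Ioc_of_le zero_le_one] at this
    refine i0.mono' (hmeas _) ?_
    filter_upwards [ae_restrict_mem measurableSet_Ioc] with y hy
    rw [smul_eq_mul, Real.norm_eq_abs, abs_of_nonneg (hnn y hy.1), ← hpow _ _ hy.1]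
    have := hy.1
    gcongr
    exact min_le_left _ _
  · have i1 : IntegrableOn (fun y : ℝ => y ^ ((N : ℝ) - 1 + -q)) (Ioi 1) :=
      integrableOn_Ioi_rpow_of_lt (by linarith) zero_lt_one
    refine i1.mono' (hmeas _) ?_
    filter_upwards [ae_restrict_mem measurableSet_Ioi] with y hy
    have hy0 : 0 < y := zero_lt_one.trans hy
    rw [smul_eq_mul, Real.norm_eq_abs, abs_of_nonneg (hnn y hy0), ← hpow _ _ hy0]
    gcongr
    exact min_le_right _ _

/-- Rescaling `ξ` by `δ` extracts `δ^(p-N)` and leaves a fixed majorant, of order `‖ξ‖^(2-p)` at the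
origin and `‖ξ‖^(-p)` at infinity. The two conditions on `p` are its integrability at these two
ends. -/
theorem lintegral_scaled_radial {N : ℕ} [Nontrivial (Space N)] {p : ℝ} (hp : (N : ℝ) < p)
    (hp2 : p < N + 2) : ∃ C : ℝ, 0 < C ∧ ∀ δ : ℝ, 0 < δ →
      ∫⁻ ξ : Space N, ENNReal.ofReal (‖ξ‖ ^ (-p) * min 1 (δ * ‖ξ‖) ^ 2) ≤
        ENNReal.ofReal (C * δ ^ (p - N)) := by
  set g : Space N → ℝ := fun ξ => min (‖ξ‖ ^ (-(p - 2))) (‖ξ‖ ^ (-p)) with hg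
  have hgi : Integrable g := integrable_min_norm_rpow (by linarith) hp
  have hg0 : ∀ ξ, 0 ≤ g ξ := fun ξ => le_min (by positivity) (by positivity)
  have hI0 : 0 ≤ ∫ ξ, g ξ := integral_nonneg hg0
  -- The added `1` makes the constant positive without showing that the integral is.
  refine ⟨(∫ ξ, g ξ) + 1, by linarith, fun δ hδ => ?_⟩
  have hpt : ∀ ξ : Space N, ‖ξ‖ ^ (-p) * min 1 (δ * ‖ξ‖) ^ 2 ≤ δ ^ p * g (δ • ξ) := by
    intro ξ
    rcases (norm_nonneg ξ).eq_or_lt with h0 | h0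
    · rw [← h0]
      simp only [mul_zero, min_eq_right zero_le_one]
      have := hg0 (δ • ξ)
      simp only [ne_eq, OfNat.ofNat_ne_zero, not_false_eq_true, zero_pow, mul_zero]
      positivity
    · have hδξ : 0 < δ * ‖ξ‖ := by positivity
      simp only [hg]
      rw [norm_smul, Real.norm_eq_abs, abs_of_pos hδ]
      have e1 : ‖ξ‖ ^ (-p) = δ ^ p * (δ * ‖ξ‖) ^ (-p) := by
        rw [Real.mul_rpow hδ.le h0.le, ← mul_assoc, ← Real.rpow_add hδ, add_neg_cancel,
          Real.rpow_zero, one_mul]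
      have e2 : (δ * ‖ξ‖) ^ (-(p - 2)) = (δ * ‖ξ‖) ^ (-p) * (δ * ‖ξ‖) ^ 2 := by
        rw [← Real.rpow_natCast _ 2, ← Real.rpow_add hδξ]; congr 1; push_cast; ring
      rw [e1, mul_assoc]
      refine mul_le_mul_of_nonneg_left (le_min ?_ ?_) (by positivity)
      · rw [e2]
        gcongr
        exact min_le_right _ _
      · calc (δ * ‖ξ‖) ^ (-p) * min 1 (δ * ‖ξ‖) ^ 2 ≤ (δ * ‖ξ‖) ^ (-p) * 1 ^ 2 := by
              gcongr
              exact min_le_left _ _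
          _ = _ := by ring
  refine (lintegral_mono fun ξ => ENNReal.ofReal_le_ofReal (hpt ξ)).trans ?_
  rw [← ofReal_integral_eq_lintegral_ofReal ((hgi.comp_smul hδ.ne').const_mul _)
    (ae_of_all _ fun ξ => mul_nonneg (by positivity) (hg0 _)), integral_const_mul,
    Measure.integral_comp_smul, finrank_euclideanSpace_fin, smul_eq_mul,
    abs_of_pos (by positivity)]
  refine ENNReal.ofReal_le_ofReal ?_
  rw [Real.rpow_sub hδ, Real.rpow_natCast]
  have : 0 < δ ^ p / δ ^ N := by positivity
  calc δ ^ p * ((δ ^ N)⁻¹ * ∫ ξ, g ξ) = (∫ ξ, g ξ) * (δ ^ p / δ ^ N) := by ring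
    _ ≤ _ := by gcongr; linarith

/-! ### Averages of squared sines over shells -/

/-- The spherical shell `l ≤ ‖ξ‖ ≤ 5l`. -/
def shell (N : ℕ) (l : ℝ) : Set (Space N) := {ξ | l ≤ ‖ξ‖ ∧ ‖ξ‖ ≤ 5 * l}

theorem measurableSet_shell (N : ℕ) (l : ℝ) : MeasurableSet (shell N l) :=
  (measurableSet_le measurable_const measurable_norm).inter
    (measurableSet_le measurable_norm measurable_const)

/-- Translating by `v` parallel to `z` with `⟨z, v⟩ = π/2` turns `sin²` into `cos²`, so the
integrals over a ball and over its translate add up to the volume of the ball. The ball has radius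
`l` and a centre of norm `3l`, and `‖v‖ ≤ l`; hence both balls fit between radii `l` and `5l`. -/
theorem le_lintegral_shell_sin_inner {N : ℕ} [Nontrivial (Space N)] {z : Space N} (hz : z ≠ 0)
    {l : ℝ} (hl : Real.pi / (2 * ‖z‖) ≤ l) :
    ENNReal.ofReal (l ^ N) * volume (Metric.ball (0 : Space N) 1) ≤
      2 * ∫⁻ ξ in shell N l, ENNReal.ofReal (Real.sin (inner ℝ z ξ) ^ 2) := by
  have hz0 : 0 < ‖z‖ := norm_pos_iff.2 hz
  have hpi := Real.pi_pos
  have hl0 : 0 < l := lt_of_lt_of_le (by positivity) hl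
  set ξ₀ : Space N := (3 * l / ‖z‖) • z with hξ₀
  set v : Space N := (Real.pi / (2 * ‖z‖ ^ 2)) • z with hv
  have hnξ : ‖ξ₀‖ = 3 * l := by
    rw [hξ₀, norm_smul, Real.norm_eq_abs, abs_of_pos (by positivity)]
    field_simp
  have hnv : ‖v‖ ≤ l := by
    rw [hv, norm_smul, Real.norm_eq_abs, abs_of_pos (by positivity)]
    refine le_trans (le_of_eq ?_) hl
    field_simp
  have hinn : inner ℝ z v = Real.pi / 2 := by
    rw [hv, inner_smul_right, real_inner_self_eq_norm_sq]
    field_simp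
  have hsub : ∀ c : Space N, ‖c - ξ₀‖ ≤ l → Metric.ball c l ⊆ shell N l := by
    intro c hc ξ hξ
    rw [mem_ball_iff_norm] at hξ
    have h1 : ‖ξ - ξ₀‖ ≤ 2 * l := by
      have := norm_add_le (ξ - c) (c - ξ₀)
      rw [sub_add_sub_cancel] at this
      linarith
    have h2 := norm_sub_norm_le ξ ξ₀
    have h3 := norm_sub_norm_le ξ₀ ξ
    rw [norm_sub_rev] at h3
    exact ⟨by linarith, by linarith⟩
  set f : Space N → ℝ≥0∞ := fun ξ => ENNReal.ofReal (Real.sin (inner ℝ z ξ) ^ 2) with hf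
  have hfm : Measurable f := by
    simp only [hf]
    fun_prop
  have h1 : ∫⁻ ξ in Metric.ball ξ₀ l, f ξ ≤ ∫⁻ ξ in shell N l, f ξ :=
    lintegral_mono_set (hsub ξ₀ (by simpa using hl0.le))
  have h2 : ∫⁻ ξ in Metric.ball ξ₀ l, f (ξ + v) ≤ ∫⁻ ξ in shell N l, f ξ := by
    have hpre : (fun x : Space N => x + v) ⁻¹' Metric.ball (ξ₀ + v) l = Metric.ball ξ₀ l := by
      ext x
      simp
    rw [← hpre, (measurePreserving_add_right (volume : Measure (Space N)) v).setLIntegral_comp_preimage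
      measurableSet_ball hfm]
    exact lintegral_mono_set (hsub _ (by simpa using hnv))
  have h3 : ∫⁻ ξ in Metric.ball ξ₀ l, f ξ + f (ξ + v) = volume (Metric.ball ξ₀ l) := by
    rw [← setLIntegral_one]
    refine lintegral_congr fun ξ => ?_
    simp only [hf]
    rw [inner_add_right, hinn, Real.sin_add_pi_div_two, ← ENNReal.ofReal_add (sq_nonneg _)
      (sq_nonneg _), Real.sin_sq_add_cos_sq, ENNReal.ofReal_one]
  rw [lintegral_add_left hfm] at h3
  have h4 := Measure.addHaar_ball (volume : Measure (Space N)) ξ₀ hl0.le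
  rw [finrank_euclideanSpace_fin] at h4
  rw [← h4, ← h3, two_mul]
  exact add_le_add h1 h2

/-- The integral is half the length, `2l`, up to boundary terms of total size at most `1/(2τ) ≤ l`.
-/
theorem le_integral_sin_sq {τ l : ℝ} (hτ : 0 < τ) (hl : 1 / (2 * τ) ≤ l) :
    l ≤ ∫ y in l..(5 * l), Real.sin (τ * y) ^ 2 := by
  rw [intervalIntegral.integral_comp_mul_left (fun y => Real.sin y ^ 2) hτ.ne', integral_sin_sq,
    smul_eq_mul]
  have h1 : |Real.sin (τ * l) * Real.cos (τ * l)| ≤ 1 / 2 := by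
    rw [show Real.sin (τ * l) * Real.cos (τ * l) = Real.sin (2 * (τ * l)) / 2 by
      rw [Real.sin_two_mul]; ring, abs_div, abs_two]
    linarith [Real.abs_sin_le_one (2 * (τ * l))]
  have h2 : |Real.sin (τ * (5 * l)) * Real.cos (τ * (5 * l))| ≤ 1 / 2 := by
    rw [show Real.sin (τ * (5 * l)) * Real.cos (τ * (5 * l)) = Real.sin (2 * (τ * (5 * l))) / 2 by
      rw [Real.sin_two_mul]; ring, abs_div, abs_two]
    linarith [Real.abs_sin_le_one (2 * (τ * (5 * l)))]
  have h3 := neg_abs_le (Real.sin (τ * l) * Real.cos (τ * l))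
  have h4 := le_abs_self (Real.sin (τ * (5 * l)) * Real.cos (τ * (5 * l)))
  rw [div_le_iff₀ (by positivity)] at hl
  rw [inv_mul_eq_div, le_div_iff₀ hτ]
  nlinarith

/-- In polar coordinates, bound `r^(N-1)` below by `l^(N-1)` and apply the one-dimensional estimate.
The angular constant is `N` times the volume of the unit ball, and `N ≥ 1`. -/
theorem le_lintegral_shell_sin_norm {N : ℕ} [Nontrivial (Space N)] {τ l : ℝ} (hτ : τ ≠ 0)
    (hl : 1 / (2 * |τ|) ≤ l) :
    ENNReal.ofReal (l ^ N) * volume (Metric.ball (0 : Space N) 1) ≤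
      ∫⁻ ξ in shell N l, ENNReal.ofReal (Real.sin (τ * ‖ξ‖) ^ 2) := by
  have hN : 0 < N := by
    have := Module.finrank_pos (R := ℝ) (M := Space N)
    rwa [finrank_euclideanSpace_fin] at this
  have hτ0 : 0 < |τ| := abs_pos.2 hτ
  have hl0 : 0 < l := lt_of_lt_of_le (by positivity) hl
  set F : ℝ → ℝ := (Icc l (5 * l)).indicator (fun y => Real.sin (τ * y) ^ 2) with hF
  have hFm : Measurable F := Measurable.indicator (by fun_prop) measurableSet_Icc
  have hF0 : ∀ y, 0 ≤ F y := fun y => indicator_nonneg (fun _ _ => sq_nonneg _) _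
  have hFi : IntegrableOn (fun y : ℝ => y ^ (Module.finrank ℝ (Space N) - 1) • F y) (Ioi 0) := by
    refine Integrable.integrableOn ?_
    have : (fun y : ℝ => y ^ (Module.finrank ℝ (Space N) - 1) • F y) =
        (Icc l (5 * l)).indicator (fun y =>
          y ^ (Module.finrank ℝ (Space N) - 1) * Real.sin (τ * y) ^ 2) := by
      funext y
      by_cases hy : y ∈ Icc l (5 * l) <;> simp [hF, hy]
    rw [this, integrable_indicator_iff measurableSet_Icc]
    exact (by fun_prop : Continuous fun y : ℝ =>
      y ^ (Module.finrank ℝ (Space N) - 1) * Real.sin (τ * y) ^ 2).continuousOn.integrableOn_Icc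
  have hintg : Integrable (fun ξ : Space N => F ‖ξ‖) :=
    (integrable_fun_norm_addHaar volume).2 hFi
  have e : ∫⁻ ξ in shell N l, ENNReal.ofReal (Real.sin (τ * ‖ξ‖) ^ 2) =
      ∫⁻ ξ : Space N, ENNReal.ofReal (F ‖ξ‖) := by
    rw [← lintegral_indicator (measurableSet_shell N l)]
    refine lintegral_congr fun ξ => ?_
    by_cases h : ξ ∈ shell N l
    · rw [indicator_of_mem h, hF, indicator_of_mem (show ‖ξ‖ ∈ Icc l (5 * l) from h)]
    · rw [indicator_of_notMem h, hF, indicator_of_notMem (show ‖ξ‖ ∉ Icc l (5 * l) from h)]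
      simp
  rw [e, ← ofReal_integral_eq_lintegral_ofReal hintg (ae_of_all _ fun ξ => hF0 _),
    integral_fun_norm_addHaar volume F]
  have hV : volume (Metric.ball (0 : Space N) 1) =
      ENNReal.ofReal (volume.real (Metric.ball (0 : Space N) 1)) := by
    rw [Measure.real, ENNReal.ofReal_toReal]
    exact measure_ball_lt_top.ne
  rw [hV, ← ENNReal.ofReal_mul (by positivity)]
  refine ENNReal.ofReal_le_ofReal ?_
  have hbound : l ^ N ≤ ∫ y in Ioi (0 : ℝ), y ^ (Module.finrank ℝ (Space N) - 1) • F y := by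
    calc l ^ N = l ^ (N - 1) * l := by rw [← pow_succ, Nat.sub_add_cancel hN]
      _ ≤ l ^ (N - 1) * ∫ y in l..(5 * l), Real.sin (|τ| * y) ^ 2 := by
          gcongr
          exact le_integral_sin_sq hτ0 hl
      _ = ∫ y in Ioc l (5 * l), l ^ (N - 1) * F y := by
          rw [intervalIntegral.integral_of_le (by linarith), integral_const_mul]
          congr 1
          refine setIntegral_congr_fun measurableSet_Ioc fun y hy => ?_
          rw [hF, indicator_of_mem (Ioc_subset_Icc_self hy)]
          rcases abs_choice τ with h | h <;> simp [h]
      _ ≤ ∫ y in Ioc l (5 * l), y ^ (Module.finrank ℝ (Space N) - 1) • F y := by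
          rw [finrank_euclideanSpace_fin] at *
          refine setIntegral_mono_on ?_ (hFi.mono_set fun y hy => hl0.trans hy.1)
            measurableSet_Ioc fun y hy => ?_
          · refine Integrable.const_mul ?_ _
            refine Integrable.integrableOn ?_
            rw [hF, integrable_indicator_iff measurableSet_Icc]
            exact (by fun_prop : Continuous fun y : ℝ =>
              Real.sin (τ * y) ^ 2).continuousOn.integrableOn_Icc
          · rw [smul_eq_mul]
            have := hF0 y
            have := hy.1.le
            gcongr
      _ ≤ _ := by
          refine setIntegral_mono_set hFi ?_
            (Eventually.of_forall fun y hy => hl0.trans hy.1)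
          filter_upwards [ae_restrict_mem measurableSet_Ioi] with y hy
          have : (0 : ℝ) < y := hy
          have := hF0 y
          simp only [Pi.zero_apply, smul_eq_mul]
          positivity
  rw [nsmul_eq_mul, smul_eq_mul, finrank_euclideanSpace_fin]
  rw [finrank_euclideanSpace_fin] at hbound
  have hN1 : (1 : ℝ) ≤ N := by exact_mod_cast hN
  have hV0 : 0 ≤ volume.real (Metric.ball (0 : Space N) 1) := measureReal_nonneg
  calc l ^ N * volume.real (Metric.ball (0 : Space N) 1)
      = 1 * (volume.real (Metric.ball (0 : Space N) 1) * l ^ N) := by ring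
    _ ≤ _ := by gcongr

/-- The difference of the two sides is `(cos θ - cos φ)² + sin² φ`. Oscillation of either angle
alone therefore keeps `1 - cos θ cos φ` large on average. -/
theorem sin_sq_le_one_sub_cos_mul (θ φ : ℝ) :
    Real.sin θ ^ 2 ≤ 2 * (1 - Real.cos θ * Real.cos φ) := by
  have h1 := Real.sin_sq_add_cos_sq θ
  have h2 := Real.sin_sq_add_cos_sq φ
  nlinarith [sq_nonneg (Real.cos θ - Real.cos φ), sq_nonneg (Real.sin φ)]

/-- The average of `1 - cos(z·ξ)cos(τ‖ξ‖)` over a large shell is bounded below. -/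
theorem le_lintegral_shell_one_sub {N : ℕ} [Nontrivial (Space N)] {z : Space N} {τ l δ : ℝ}
    (hδ : 0 < δ) (hmax : δ = max |τ| ‖z‖) (hl : 2 / δ ≤ l) :
    ENNReal.ofReal (l ^ N) * volume (Metric.ball (0 : Space N) 1) ≤
      4 * ∫⁻ ξ in shell N l,
        ENNReal.ofReal (1 - Real.cos (inner ℝ z ξ) * Real.cos (τ * ‖ξ‖)) := by
  have hpt : ∀ θ φ : ℝ, ENNReal.ofReal (Real.sin θ ^ 2) ≤
      2 * ENNReal.ofReal (1 - Real.cos θ * Real.cos φ) := fun θ φ => by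
    rw [← ENNReal.ofReal_ofNat, ← ENNReal.ofReal_mul (by norm_num)]
    exact ENNReal.ofReal_le_ofReal (sin_sq_le_one_sub_cos_mul θ φ)
  -- Whichever increment realises `δ` supplies the oscillation; the other cosine is discarded.
  rcases le_total |τ| ‖z‖ with h | h
  · have hδz : δ = ‖z‖ := by rw [hmax, max_eq_right h]
    have hz : z ≠ 0 := norm_pos_iff.1 (hδz ▸ hδ)
    refine (le_lintegral_shell_sin_inner hz (l := l) ?_).trans ?_
    · rw [← hδz]
      refine le_trans ?_ hl
      rw [div_le_div_iff₀ (by positivity) hδ]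
      nlinarith [Real.pi_le_four]
    · rw [show (4 : ℝ≥0∞) = 2 * 2 by norm_num, mul_assoc]
      gcongr
      rw [← lintegral_const_mul' _ _ (by norm_num)]
      exact lintegral_mono fun ξ => hpt _ _
  · have hδτ : δ = |τ| := by rw [hmax, max_eq_left h]
    have hτ : τ ≠ 0 := abs_pos.1 (hδτ ▸ hδ)
    refine (le_lintegral_shell_sin_norm hτ (l := l) ?_).trans ?_
    · rw [← hδτ]
      refine le_trans ?_ hl
      rw [div_le_div_iff₀ (by positivity) hδ]
      nlinarith
    · refine le_trans (b := 2 * ∫⁻ ξ in shell N l,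
        ENNReal.ofReal (1 - Real.cos (inner ℝ z ξ) * Real.cos (τ * ‖ξ‖))) ?_ (by gcongr; norm_num)
      rw [← lintegral_const_mul' _ _ (by norm_num)]
      refine lintegral_mono fun ξ => ?_
      rw [mul_comm (Real.cos _)]
      exact hpt _ _

/-! ### Two-sided bounds for the norm of kernel increments -/

/-- The phase `e^{-i x·ξ}`. -/
def phase {N : ℕ} (x ξ : Space N) : ℂ := Complex.exp (-Complex.I * ((inner ℝ x ξ : ℝ) : ℂ))

theorem phase_eq {N : ℕ} (x ξ : Space N) :
    phase x ξ = Complex.exp (((-inner ℝ x ξ : ℝ) : ℂ) * Complex.I) := by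
  unfold phase
  push_cast
  ring_nf

theorem norm_phase {N : ℕ} (x ξ : Space N) : ‖phase x ξ‖ = 1 := by
  rw [phase_eq, Complex.norm_exp_ofReal_mul_I]

theorem phase_mul_conj {N : ℕ} (x y ξ : Space N) :
    phase x ξ * (starRingEnd ℂ) (phase y ξ) = phase (x - y) ξ := by
  unfold phase
  rw [← Complex.exp_conj, ← Complex.exp_add, inner_sub_left]
  congr 1
  simp only [map_mul, map_neg, Complex.conj_I, Complex.conj_ofReal]
  push_cast
  ring

theorem phase_re {N : ℕ} (x ξ : Space N) : (phase x ξ).re = Real.cos (inner ℝ x ξ) := by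
  rw [phase_eq, Complex.exp_ofReal_mul_I_re, Real.cos_neg]

theorem norm_phase_sub_le {N : ℕ} (x y ξ : Space N) :
    ‖phase x ξ - phase y ξ‖ ≤ ‖x - y‖ * ‖ξ‖ := by
  have e : phase x ξ - phase y ξ = phase y ξ * (phase (x - y) ξ - 1) := by
    unfold phase
    rw [mul_sub, ← Complex.exp_add, mul_one, inner_sub_left]
    congr 2
    push_cast
    ring
  rw [e, norm_mul, norm_phase, one_mul, phase_eq, mul_comm (Complex.ofReal _)]
  refine Real.norm_exp_I_mul_ofReal_sub_one_le.trans ?_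
  rw [norm_neg]
  exact norm_inner_le_norm _ _

/-- The bound at fixed frequency times `C₂ ‖ξ‖^(-β)` is the radial integrand with `p = 1 + 2H + β`.
The two-sided condition on `β` reads `N < p < N + 2`. -/
theorem exists_hpNormSq_le {N : ℕ} [Nontrivial (Space N)] {H β : ℝ} (hH : 1 / 2 ≤ H)
    (hH1 : H < 1) (hβlow : (N : ℝ) - 2 * H - 1 < β) (hβup : β < (N : ℝ) - 2 * H + 1)
    {f h : Space N → ℝ} (hfh : IsSpatialCovariance β f h) {T : ℝ} (hT : 0 < T) :
    ∃ C : ℝ, 0 < C ∧ ∀ (t s : ℝ) (x y : Space N) (δ : ℝ), t ∈ Icc 0 T → s ∈ Icc 0 T → 0 < δ →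
      |t - s| ≤ δ → ‖x - y‖ ≤ δ →
      hpNormSq H h (fun r ξ => gFourier t x r ξ - gFourier s y r ξ) ≤
        ENNReal.ofReal (C * δ ^ (2 * H + 1 - N + β)) := by
  obtain ⟨C₁, C₂, hC₁, hC₂, hcomp⟩ := hfh.comparable
  obtain ⟨C, hC, hCb⟩ := exists_timeForm_wave_le hH hH1 hT
  obtain ⟨K, hK, hKb⟩ := lintegral_scaled_radial (N := N) (p := 1 + 2 * H + β)
    (by linarith) (by linarith)
  refine ⟨C * C₂ * K, by positivity, fun t s x y δ ht hs hδ hts hxy => ?_⟩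
  unfold hpNormSq
  calc _ ≤ ∫⁻ ξ : Space N, ENNReal.ofReal (C * C₂) *
        ENNReal.ofReal (‖ξ‖ ^ (-(1 + 2 * H + β)) * min 1 (δ * ‖ξ‖) ^ 2) := by
        refine lintegral_mono_ae ?_
        filter_upwards [hcomp, Measure.ae_ne volume (0 : Space N)] with ξ hξ hξ0
        have hρ : 0 < ‖ξ‖ := norm_pos_iff.2 hξ0
        rw [← ENNReal.ofReal_mul (by positivity)]
        refine ENNReal.ofReal_le_ofReal ?_
        simp_rw [gFourier_eq]
        have h1 := hCb t s ‖ξ‖ δ (phase x ξ) (phase y ξ) ht hs hρ (norm_phase _ _)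
          (norm_phase _ _) ((norm_phase_sub_le x y ξ).trans (by gcongr)) hts
        have h0 : 0 ≤ h ξ := le_trans (by positivity) hξ.1
        calc _ ≤ C * (‖ξ‖ ^ (-1 - 2 * H) * min 1 (δ * ‖ξ‖) ^ 2) * (C₂ * ‖ξ‖ ^ (-β)) :=
              mul_le_mul h1 hξ.2 h0 (by positivity)
          _ = _ := by
              rw [show -(1 + 2 * H + β) = (-1 - 2 * H) + -β by ring, Real.rpow_add hρ]
              ring
    _ ≤ ENNReal.ofReal (C * C₂) * ENNReal.ofReal (K * δ ^ (1 + 2 * H + β - N)) := by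
        rw [lintegral_const_mul' _ _ ENNReal.ofReal_ne_top]
        gcongr
        exact hKb δ hδ
    _ = _ := by
        rw [← ENNReal.ofReal_mul (by positivity)]
        congr 1
        rw [show 1 + 2 * H + β - N = 2 * H + 1 - N + β by ring]
        ring

/-- A single shell of frequencies of order `1/δ` suffices: there the spectral factor is of order
`δ^p` with `p = 1 + 2H + β`, the volume is of order `δ^(-N)`, and the oscillating factor has average
bounded below. -/
theorem exists_le_hpNormSq {N : ℕ} [Nontrivial (Space N)] {H β : ℝ} (hH : 1 / 2 ≤ H)
    (hH1 : H < 1) (hβ : 0 < β) {f h : Space N → ℝ} (hfh : IsSpatialCovariance β f h)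
    {a : ℝ} (D : ℝ) (ha : 0 < a) :
    ∃ c : ℝ, 0 < c ∧ ∀ (t s : ℝ) (x y : Space N) (δ : ℝ), a ≤ t → a ≤ s → 0 < δ → δ ≤ D →
      δ = max |t - s| ‖x - y‖ →
      ENNReal.ofReal (c * δ ^ (2 * H + 1 - N + β)) ≤
        hpNormSq H h (fun r ξ => gFourier t x r ξ - gFourier s y r ξ) := by
  obtain ⟨C₁, C₂, hC₁, hC₂, hcomp⟩ := hfh.comparable
  obtain ⟨c, hc, hcb⟩ := exists_le_timeForm_wave hH hH1 ha
  -- With `l = M/δ`, the entry `2` gives the `l ≥ 2/δ` needed for the shell average, and `8D/a`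
  -- gives `l ≥ 8/a` for all `δ ≤ D`, the range where the time form is bounded below.
  set M := max 2 (8 * D / a) with hM
  have hM0 : 0 < M := lt_of_lt_of_le two_pos (le_max_left _ _)
  set V := volume.real (Metric.ball (0 : Space N) 1) with hV
  have hVe : volume (Metric.ball (0 : Space N) 1) = ENNReal.ofReal V := by
    rw [hV, Measure.real, ENNReal.ofReal_toReal measure_ball_lt_top.ne]
  have hV0 : 0 < V := ENNReal.toReal_pos (Metric.measure_ball_pos _ _ one_pos).ne'
    measure_ball_lt_top.ne
  set p := 1 + 2 * H + β with hp
  have hp0 : 0 ≤ p := by linarith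
  refine ⟨c * C₁ * 5 ^ (-p) * (V / 4) * M ^ ((N : ℝ) - p), by positivity,
    fun t s x y δ ht hs hδ hδD hmax => ?_⟩
  set l := M / δ with hl
  have hl0 : 0 < l := by positivity
  have hl8 : 8 / a ≤ l := by
    rw [hl, le_div_iff₀ hδ]
    calc 8 / a * δ ≤ 8 / a * D := by gcongr
      _ = 8 * D / a := by ring
      _ ≤ M := le_max_right _ _
  have hl2 : 2 / δ ≤ l := by
    rw [hl]; gcongr; exact le_max_left _ _
  have hshell := le_lintegral_shell_one_sub (z := x - y) (τ := t - s) hδ hmax hl2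
  unfold hpNormSq
  calc ENNReal.ofReal (c * C₁ * 5 ^ (-p) * (V / 4) * M ^ ((N : ℝ) - p) *
          δ ^ (2 * H + 1 - N + β))
      = ENNReal.ofReal (c * C₁ * (5 * l) ^ (-p)) * (ENNReal.ofReal (1 / 4) *
          (ENNReal.ofReal (l ^ N) * volume (Metric.ball (0 : Space N) 1))) := by
        rw [hVe, ← ENNReal.ofReal_mul (by positivity), ← ENNReal.ofReal_mul (by positivity),
          ← ENNReal.ofReal_mul (by positivity)]
        congr 1
        have e1 : δ ^ (2 * H + 1 - N + β) = δ ^ p / δ ^ N := by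
          rw [← Real.rpow_natCast, ← Real.rpow_sub hδ, hp]; congr 1; ring
        have e2 : M ^ ((N : ℝ) - p) = M ^ N / M ^ p := by
          rw [Real.rpow_sub hM0, Real.rpow_natCast]
        rw [e1, e2, hl, Real.mul_rpow (by norm_num) (by positivity),
          Real.div_rpow hM0.le hδ.le, div_pow, Real.rpow_neg hM0.le, Real.rpow_neg hδ.le]
        have := Real.rpow_pos_of_pos hM0 p
        have := Real.rpow_pos_of_pos hδ p
        field_simp
    _ ≤ ENNReal.ofReal (c * C₁ * (5 * l) ^ (-p)) * (∫⁻ ξ in shell N l,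
        ENNReal.ofReal (1 - Real.cos (inner ℝ (x - y) ξ) * Real.cos ((t - s) * ‖ξ‖))) := by
        gcongr
        calc _ ≤ ENNReal.ofReal (1 / 4) * (4 * ∫⁻ ξ in shell N l,
              ENNReal.ofReal (1 - Real.cos (inner ℝ (x - y) ξ) * Real.cos ((t - s) * ‖ξ‖))) := by
              gcongr
          _ = _ := by
              rw [← mul_assoc, ← ENNReal.ofReal_ofNat, ← ENNReal.ofReal_mul (by norm_num)]
              norm_num
    _ = ∫⁻ ξ in shell N l, ENNReal.ofReal (c * C₁ * (5 * l) ^ (-p)) *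
        ENNReal.ofReal (1 - Real.cos (inner ℝ (x - y) ξ) * Real.cos ((t - s) * ‖ξ‖)) := by
        rw [lintegral_const_mul' _ _ ENNReal.ofReal_ne_top]
    _ ≤ ∫⁻ ξ in shell N l, ENNReal.ofReal
        (timeForm H (fun r => gFourier t x r ξ - gFourier s y r ξ) * h ξ) := by
        refine lintegral_mono_ae ?_
        filter_upwards [ae_restrict_of_ae hcomp, ae_restrict_mem (measurableSet_shell N l)]
          with ξ hξ hξl
        have hρ : 0 < ‖ξ‖ := hl0.trans_le hξl.1
        rw [← ENNReal.ofReal_mul (by positivity)]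
        refine ENNReal.ofReal_le_ofReal ?_
        simp_rw [gFourier_eq]
        have h1 := hcb t s ‖ξ‖ (phase x ξ) (phase y ξ) ht hs (hl8.trans hξl.1) (norm_phase _ _)
          (norm_phase _ _)
        rw [phase_mul_conj, phase_re] at h1
        have hκ := one_sub_mul_cos_nonneg (Real.abs_cos_le_one (inner ℝ (x - y) ξ))
          ((t - s) * ‖ξ‖)
        have h5 : (5 * l) ^ (-p) ≤ ‖ξ‖ ^ (-p) :=
          Real.rpow_le_rpow_of_nonpos hρ hξl.2 (by linarith)
        calc _ ≤ c * C₁ * ‖ξ‖ ^ (-p) *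
              (1 - Real.cos (inner ℝ (x - y) ξ) * Real.cos ((t - s) * ‖ξ‖)) := by gcongr
          _ = (c * ‖ξ‖ ^ (-1 - 2 * H) *
              (1 - Real.cos (inner ℝ (x - y) ξ) * Real.cos ((t - s) * ‖ξ‖))) *
              (C₁ * ‖ξ‖ ^ (-β)) := by
              rw [show -p = (-1 - 2 * H) + -β by rw [hp]; ring, Real.rpow_add hρ]
              ring
          _ ≤ _ := mul_le_mul h1 hξ.1 (by positivity) (le_trans (by positivity) h1)
    _ ≤ _ := setLIntegral_le_lintegral _ _

/-! ### Spatial Fourier transforms of test functions -/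

open scoped FourierTransform ContDiff in
theorem fourierN_eq_fourier {N : ℕ} (g : Space N → ℂ) (ξ : Space N) :
    fourierN g ξ = 𝓕 g ((2 * Real.pi)⁻¹ • ξ) := by
  rw [Real.fourier_eq']
  unfold fourierN
  refine integral_congr_ae (ae_of_all _ fun x => ?_)
  simp only [smul_eq_mul]
  congr 2
  rw [inner_smul_right]
  push_cast
  have : (Real.pi : ℂ) ≠ 0 := by exact_mod_cast Real.pi_ne_zero
  field_simp

/-- The slice of a test function at time `t`, as a complex function. -/
def slice {N : ℕ} (φ : Test N) (t : ℝ) (x : Space N) : ℂ := (φ (t, x) : ℂ)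

theorem spatialFourier_eq {N : ℕ} (φ : Test N) (t : ℝ) (ξ : Space N) :
    spatialFourier φ t ξ = fourierN (slice φ t) ξ := rfl

theorem exists_support_bound {N : ℕ} (φ : Test N) : ∃ T R : ℝ, 0 < T ∧ 0 < R ∧
    ∀ t x, φ (t, x) ≠ 0 → t ∈ Icc 0 T ∧ ‖x‖ ≤ R := by
  obtain ⟨r, hr⟩ := (φ.hasCompactSupport.isCompact.isBounded).exists_norm_le
  refine ⟨max r 1, max r 1, by positivity, by positivity, fun t x h => ?_⟩
  have hmem : (t, x) ∈ tsupport φ := subset_tsupport _ h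
  have h1 := hr _ hmem
  have h2 : 0 < t := φ.tsupport_subset hmem
  rw [Prod.norm_def] at h1
  have h3 := (le_max_left _ _).trans h1
  have h4 := (le_max_right _ _).trans h1
  exact ⟨⟨h2.le, ((le_abs_self t).trans h3).trans (le_max_left _ _)⟩, h4.trans (le_max_left _ _)⟩

open scoped ContDiff in
theorem slice_contDiff {N : ℕ} (φ : Test N) (t : ℝ) : ContDiff ℝ ∞ (slice φ t) := by
  have h : ContDiff ℝ ∞ φ := φ.contDiff
  exact Complex.ofRealCLM.contDiff.comp (h.comp (contDiff_const.prodMk contDiff_id))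

theorem slice_hasCompactSupport {N : ℕ} (φ : Test N) (t : ℝ) : HasCompactSupport (slice φ t) := by
  obtain ⟨T, R, -, -, h⟩ := exists_support_bound φ
  refine HasCompactSupport.intro (isCompact_closedBall (0 : Space N) R) fun x hx => ?_
  by_contra hne
  refine hx (mem_closedBall_zero_iff.2 (h t x fun h0 => hne ?_).2)
  unfold slice
  rw [h0]
  simp

open scoped ContDiff in
-- A slice is the space-time function composed with an affine embedding whose linear part has norm
-- at most 1, so its derivatives are bounded by the full ones. All slices live in one ball, which
-- makes the bound uniform in time.
theorem exists_iteratedFDeriv_slice_bound {N : ℕ} (φ : Test N) (n : ℕ) :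
    ∃ C : ℝ, 0 ≤ C ∧ ∀ t, ∫ x, ‖iteratedFDeriv ℝ n (slice φ t) x‖ ≤ C := by
  set Φ : ℝ × Space N → ℂ := fun p => (φ p : ℂ) with hΦ
  have hφ : ContDiff ℝ ∞ φ := φ.contDiff
  have hΦd : ContDiff ℝ ∞ Φ := Complex.ofRealCLM.contDiff.comp hφ
  have hΦc : HasCompactSupport Φ := φ.hasCompactSupport.comp_left (g := fun x : ℝ => (x : ℂ)) (by simp)
  obtain ⟨C, hC⟩ := (hΦc.iteratedFDeriv (𝕜 := ℝ) n).exists_bound_of_continuous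
    (hΦd.continuous_iteratedFDeriv (m := n) (by exact_mod_cast le_top))
  obtain ⟨R, hR⟩ := (hΦc.isCompact.isBounded).exists_norm_le
  have hC0 : 0 ≤ C := (norm_nonneg _).trans (hC 0)
  have hpt : ∀ t x, ‖iteratedFDeriv ℝ n (slice φ t) x‖ ≤
      (Metric.closedBall (0 : Space N) R).indicator (fun _ => C) x := by
    intro t x
    have e : slice φ t = (fun p => Φ (p + (t, 0))) ∘ (ContinuousLinearMap.inr ℝ ℝ (Space N)) := by
      funext x
      simp [slice, hΦ]
    have hd : ContDiff ℝ ∞ (fun p => Φ (p + (t, 0))) := hΦd.comp (contDiff_id.add contDiff_const)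
    rw [e, ContinuousLinearMap.iteratedFDeriv_comp_right _ hd _ (by exact_mod_cast le_top),
      iteratedFDeriv_comp_add_right]
    have hval : ContinuousLinearMap.inr ℝ ℝ (Space N) x + (t, 0) = (t, x) := by simp
    rw [hval]
    refine (ContinuousMultilinearMap.norm_compContinuousLinearMap_le _ _).trans ?_
    have h1 : ∏ _i : Fin n, ‖ContinuousLinearMap.inr ℝ ℝ (Space N)‖ ≤ 1 :=
      Finset.prod_le_one (fun _ _ => norm_nonneg _)
        (fun _ _ => ContinuousLinearMap.norm_inr_le_one ℝ ℝ (Space N))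
    by_cases hx : x ∈ Metric.closedBall (0 : Space N) R
    · rw [indicator_of_mem hx]
      calc _ ≤ C * 1 := mul_le_mul (hC _) h1 (Finset.prod_nonneg fun _ _ => norm_nonneg _) hC0
        _ = C := mul_one C
    · rw [indicator_of_notMem hx]
      have h0 : iteratedFDeriv ℝ n Φ (t, x) = 0 := by
        by_contra hne
        have hmem : (t, x) ∈ tsupport Φ := support_iteratedFDeriv_subset n hne
        refine hx (mem_closedBall_zero_iff.2 ((norm_snd_le (t, x)).trans (hR _ hmem)))
      rw [h0, norm_zero, zero_mul]
  have hi : Integrable ((Metric.closedBall (0 : Space N) R).indicator (fun _ => C)) :=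
    (integrable_indicator_iff measurableSet_closedBall).2
      (integrableOn_const (measure_closedBall_lt_top.ne))
  refine ⟨∫ x, (Metric.closedBall (0 : Space N) R).indicator (fun _ => C) x,
    integral_nonneg fun x => indicator_nonneg (fun _ _ => hC0) x, fun t => ?_⟩
  exact integral_mono_of_nonneg (ae_of_all _ fun _ => norm_nonneg _) hi (ae_of_all _ (hpt t))

open scoped FourierTransform ContDiff in
/-- Uniform in time decay of the spatial Fourier transform of a test function. -/
theorem exists_spatialFourier_decay {N : ℕ} (φ : Test N) (n : ℕ) :
    ∃ B : ℝ, 0 ≤ B ∧ ∀ t ξ, ‖ξ‖ ^ n * ‖spatialFourier φ t ξ‖ ≤ B := by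
  choose C hC0 hC using exists_iteratedFDeriv_slice_bound φ
  refine ⟨(2 * Real.pi) ^ n * (2 ^ n * ∑ p ∈ Finset.range (0 + 1) ×ˢ Finset.range (n + 1), C p.2),
    by
      have := Real.pi_pos
      have : 0 ≤ ∑ p ∈ Finset.range (0 + 1) ×ˢ Finset.range (n + 1), C p.2 :=
        Finset.sum_nonneg fun p _ => hC0 _
      positivity, fun t ξ => ?_⟩
  rw [spatialFourier_eq, fourierN_eq_fourier]
  have hpi := Real.pi_pos
  have hintg : ∀ (k m : ℕ), (k : ℕ∞) ≤ (⊤ : ℕ∞) → (m : ℕ∞) ≤ (⊤ : ℕ∞) →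
      Integrable (fun v => ‖v‖ ^ k * ‖iteratedFDeriv ℝ m (slice φ t) v‖) := by
    intro k m _ _
    have hc : Continuous (fun v => ‖v‖ ^ k * ‖iteratedFDeriv ℝ m (slice φ t) v‖) := by
      have := (slice_contDiff φ t).continuous_iteratedFDeriv (m := m) (by exact_mod_cast le_top)
      fun_prop
    refine hc.integrable_of_hasCompactSupport ?_
    exact ((slice_hasCompactSupport φ t).iteratedFDeriv (𝕜 := ℝ) m).norm.mul_left
  have h := Real.pow_mul_norm_iteratedFDeriv_fourier_le (K := ⊤) (N := ⊤)
    (f := slice φ t) (slice_contDiff φ t) hintg (k := 0) (n := n) le_top le_top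
    ((2 * Real.pi)⁻¹ • ξ)
  rw [norm_iteratedFDeriv_zero, norm_smul, Real.norm_eq_abs, abs_of_pos (by positivity),
    mul_pow] at h
  calc ‖ξ‖ ^ n * ‖𝓕 (slice φ t) ((2 * Real.pi)⁻¹ • ξ)‖
      = (2 * Real.pi) ^ n * ((2 * Real.pi)⁻¹ ^ n * ‖ξ‖ ^ n *
          ‖𝓕 (slice φ t) ((2 * Real.pi)⁻¹ • ξ)‖) := by
        rw [inv_pow]
        field_simp
    _ ≤ _ := by
        refine mul_le_mul_of_nonneg_left (h.trans ?_) (by positivity)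
        simp only [pow_zero, one_mul, Nat.cast_zero, mul_zero, zero_add]
        gcongr with p hp
        have hp1 : p.1 = 0 := by
          have := (Finset.mem_product.1 hp).1
          simpa using this
        simp only [hp1, pow_zero, one_mul]
        exact hC p.2 t

theorem measurable_spatialFourier {N : ℕ} (φ : Test N) :
    Measurable (fun p : ℝ × Space N => spatialFourier φ p.1 p.2) := by
  have hφ : Continuous φ := φ.continuous
  have hm : StronglyMeasurable (fun q : (ℝ × Space N) × Space N =>
      Complex.exp (-Complex.I * ((inner ℝ q.2 q.1.2 : ℝ) : ℂ)) * ((φ (q.1.1, q.2) : ℝ) : ℂ)) := by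
    refine Continuous.stronglyMeasurable ?_
    fun_prop
  exact (hm.integral_prod_right (ν := (volume : Measure (Space N)))).measurable

theorem spatialFourier_of_notMem {N : ℕ} {φ : Test N} {T : ℝ}
    (h : ∀ t x, φ (t, x) ≠ 0 → t ∈ Icc 0 T) {t : ℝ} (ht : t ∉ Icc 0 T) (ξ : Space N) :
    spatialFourier φ t ξ = 0 := by
  have h0 : ∀ x, φ (t, x) = 0 := fun x => by
    by_contra hne
    exact ht (h t x hne)
  unfold spatialFourier fourierN
  simp_rw [h0, Complex.ofReal_zero, mul_zero, integral_zero]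

/-- A common time horizon and bound for the spatial Fourier transform. -/
theorem exists_spatialFourier_admissible {N : ℕ} (φ : Test N) :
    ∃ T M : ℝ, 0 < T ∧ ∀ ξ, TimeAdmissible T M (fun t => spatialFourier φ t ξ) := by
  obtain ⟨T, R, hT, -, h⟩ := exists_support_bound φ
  obtain ⟨B, -, hB⟩ := exists_spatialFourier_decay φ 0
  refine ⟨T, B, hT, fun ξ => TimeAdmissible.mk ?_ (fun t => ?_) (fun t ht => ?_)⟩
  · exact Measurable.of_uncurry_right (f := fun t ξ => spatialFourier φ t ξ)
      (measurable_spatialFourier φ)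
  · have := hB t ξ
    rwa [pow_zero, one_mul] at this
  · exact spatialFourier_of_notMem (fun t x hx => (h t x hx).1) ht ξ

/-- Decay of order `N` is all that is needed: multiplied by `‖ξ‖^(-β)` with `β > 0` it is integrable
at infinity. -/
theorem exists_spatialFourier_min_bound {N : ℕ} (φ : Test N) :
    ∃ B : ℝ, 0 ≤ B ∧ ∀ t ξ, ξ ≠ 0 →
      ‖spatialFourier φ t ξ‖ ≤ B * min 1 (‖ξ‖ ^ (-(N : ℝ))) := by
  obtain ⟨B₀, h0, hB₀⟩ := exists_spatialFourier_decay φ 0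
  obtain ⟨B₁, h1, hB₁⟩ := exists_spatialFourier_decay φ N
  refine ⟨max B₀ B₁, le_max_of_le_left h0, fun t ξ hξ => ?_⟩
  have hρ : 0 < ‖ξ‖ := norm_pos_iff.2 hξ
  rw [mul_min_of_nonneg _ _ (le_max_of_le_left h0)]
  refine le_min ?_ ?_
  · have := hB₀ t ξ
    rw [pow_zero, one_mul] at this
    linarith [le_max_left B₀ B₁]
  · rw [Real.rpow_neg hρ.le, Real.rpow_natCast, ← div_eq_mul_inv, le_div_iff₀ (by positivity),
      mul_comm]
    exact (hB₁ t ξ).trans (le_max_right _ _)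

/-! ### The covariance of the noise in Fourier variables -/

open scoped ContDiff in
-- Integrability of `f` is given only against Schwartz functions; testing with a smooth bump equal
-- to 1 on the ball yields an honest integrable function to use in Fubini.
theorem exists_integrable_cutoff {N : ℕ} {β : ℝ} {f h : Space N → ℝ}
    (hfh : IsSpatialCovariance β f h) (R : ℝ) :
    ∃ F : Space N → ℂ, Integrable F ∧ ∀ x, ‖x‖ ≤ R → F x = (f x : ℂ) := by
  let g : ContDiffBump (0 : Space N) := ⟨max R 1, max R 1 + 1, by positivity, by linarith⟩
  have hgd : ContDiff ℝ ∞ (fun x => ((g x : ℝ) : ℂ)) := Complex.ofRealCLM.contDiff.comp g.contDiff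
  have hgc : HasCompactSupport (fun x => ((g x : ℝ) : ℂ)) :=
    g.hasCompactSupport.comp_left (g := fun x : ℝ => (x : ℂ)) (by simp)
  refine ⟨_, hfh.integrable (hgc.toSchwartzMap hgd), fun x hx => ?_⟩
  have h1 : g x = 1 := g.one_of_mem_closedBall
    (mem_closedBall_zero_iff.2 (hx.trans (le_max_left R 1)))
  change (f x : ℂ) * ((g x : ℝ) : ℂ) = _
  rw [h1]
  simp

/-- The correlation `z ↦ ∫ u(x) v(x - z) dx`. -/
def correlation {N : ℕ} (u v : Space N → ℂ) (z : Space N) : ℂ := ∫ x, u x * v (x - z)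

open scoped Convolution in
theorem correlation_eq_convolution_real {N : ℕ} (u v : Space N → ℂ) :
    correlation u v = u ⋆[ContinuousLinearMap.mul ℝ ℂ, volume] (fun y => v (-y)) := by
  funext z
  rw [convolution_def, correlation]
  simp only [ContinuousLinearMap.mul_apply', neg_sub]

open scoped Convolution in
theorem correlation_eq_convolution {N : ℕ} (u v : Space N → ℂ) :
    correlation u v = u ⋆[ContinuousLinearMap.mul ℂ ℂ, volume] (fun y => v (-y)) := by
  funext z
  rw [convolution_def, correlation]
  simp only [ContinuousLinearMap.mul_apply', neg_sub]

open scoped ContDiff in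
theorem correlation_contDiff {N : ℕ} {u v : Space N → ℂ} (hu : Integrable u)
    (hv : ContDiff ℝ ∞ v) (hvc : HasCompactSupport v) : ContDiff ℝ ∞ (correlation u v) := by
  rw [correlation_eq_convolution_real]
  have hwc : HasCompactSupport (fun y => v (-y)) := hvc.comp_homeomorph (Homeomorph.neg (Space N))
  exact hwc.contDiff_convolution_right (ContinuousLinearMap.mul ℝ ℂ) hu.locallyIntegrable
    (hv.comp contDiff_neg)

theorem correlation_hasCompactSupport {N : ℕ} {u v : Space N → ℂ} (huc : HasCompactSupport u)
    (hvc : HasCompactSupport v) : HasCompactSupport (correlation u v) := by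
  rw [correlation_eq_convolution_real]
  have hwc : HasCompactSupport (fun y => v (-y)) := hvc.comp_homeomorph (Homeomorph.neg (Space N))
  exact huc.convolution _ hwc

theorem fourierN_correlation {N : ℕ} {u v : Space N → ℂ} (hu : Integrable u)
    (hv : Integrable v) (ξ : Space N) :
    fourierN (correlation u v) ξ = fourierN u ξ * fourierN (fun y => v (-y)) ξ := by
  rw [fourierN_eq_fourier, fourierN_eq_fourier, fourierN_eq_fourier, correlation_eq_convolution,
    Real.fourier_mul_convolution_eq hu hv.comp_neg]

/-- Substitute `z = x - y` and exchange the integrals. The supports of `u` and `v` confine `z` to a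
ball of radius `Ru + Rv`, where `f` may be replaced by its integrable cutoff. -/
theorem integral_cov_eq_correlation {N : ℕ} {β : ℝ} {f h : Space N → ℝ}
    (hfh : IsSpatialCovariance β f h) {u v : Space N → ℂ} (hu : Continuous u)
    (hv : Continuous v) (huc : HasCompactSupport u) (hvc : HasCompactSupport v) :
    ∫ x, ∫ y, u x * (f (x - y) : ℂ) * v y = ∫ z, (f z : ℂ) * correlation u v z := by
  have hui : Integrable u := hu.integrable_of_hasCompactSupport huc
  obtain ⟨Ru, hRu⟩ := huc.isCompact.isBounded.exists_norm_le
  obtain ⟨Rv, hRv⟩ := hvc.isCompact.isBounded.exists_norm_le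
  obtain ⟨F, hFi, hF⟩ := exists_integrable_cutoff hfh (Ru + Rv)
  have hcut : ∀ x z, u x * (f z : ℂ) * v (x - z) = u x * F z * v (x - z) := by
    intro x z
    by_cases hx : u x = 0
    · rw [hx]; ring
    by_cases hz : v (x - z) = 0
    · rw [hz]; ring
    rw [hF z]
    have h1 := hRu x (subset_tsupport _ hx)
    have h2 := hRv _ (subset_tsupport _ hz)
    have := norm_sub_le x (x - z)
    rw [sub_sub_cancel] at this
    linarith
  have hFub : Integrable (Function.uncurry fun x z : Space N => u x * F z * v (x - z))
      ((volume : Measure (Space N)).prod volume) := by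
    obtain ⟨C, hC⟩ := hvc.exists_bound_of_continuous hv
    refine (hui.mul_prod hFi).mul_bdd (c := C) ?_ (ae_of_all _ fun p => hC _)
    exact (hv.comp (continuous_fst.sub continuous_snd)).aestronglyMeasurable
  calc ∫ x, ∫ y, u x * (f (x - y) : ℂ) * v y = ∫ x, ∫ z, u x * F z * v (x - z) := by
        refine integral_congr_ae (ae_of_all _ fun x => ?_)
        simp only
        rw [← integral_sub_left_eq_self (fun z => u x * F z * v (x - z)) volume x]
        refine integral_congr_ae (ae_of_all _ fun y => ?_)
        simp only
        rw [← hcut, sub_sub_cancel]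
    _ = ∫ z, ∫ x, u x * F z * v (x - z) := integral_integral_swap hFub
    _ = ∫ z, (f z : ℂ) * correlation u v z := by
        refine integral_congr_ae (ae_of_all _ fun z => ?_)
        simp only
        rw [correlation, ← integral_const_mul]
        refine integral_congr_ae (ae_of_all _ fun x => ?_)
        simp only
        rw [← hcut]
        ring

open scoped ContDiff in
-- The correlation is smooth with compact support, hence Schwartz, so the spectral identity for `f`
-- applies to it; its transform is a product because it is a convolution.
theorem integral_cov_eq_fourier {N : ℕ} {β : ℝ} {f h : Space N → ℝ}
    (hfh : IsSpatialCovariance β f h) {u v : Space N → ℂ} (hu : ContDiff ℝ ∞ u)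
    (hv : ContDiff ℝ ∞ v) (huc : HasCompactSupport u) (hvc : HasCompactSupport v) :
    ∫ x, ∫ y, u x * (f (x - y) : ℂ) * v y =
      ∫ ξ, fourierN u ξ * fourierN (fun y => v (-y)) ξ * (h ξ : ℂ) := by
  have hui : Integrable u := hu.continuous.integrable_of_hasCompactSupport huc
  have hvi : Integrable v := hv.continuous.integrable_of_hasCompactSupport hvc
  rw [integral_cov_eq_correlation hfh hu.continuous hv.continuous huc hvc]
  have key := hfh.fourier ((correlation_hasCompactSupport huc hvc).toSchwartzMap
    (correlation_contDiff hui hv hvc))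
  simp_rw [← fourierN_correlation hui hvi]
  exact key

theorem fourierN_neg_of_real {N : ℕ} (v : Space N → ℝ) (ξ : Space N) :
    fourierN (fun y => (v (-y) : ℂ)) ξ = (starRingEnd ℂ) (fourierN (fun y => (v y : ℂ)) ξ) := by
  unfold fourierN
  rw [← integral_conj, ← integral_neg_eq_self]
  refine integral_congr_ae (ae_of_all _ fun y => ?_)
  simp only [neg_neg, map_mul, Complex.conj_ofReal, ← Complex.exp_conj, map_neg, Complex.conj_I,
    inner_neg_left]
  push_cast
  ring_nf

theorem integral_slice_cov {N : ℕ} {β : ℝ} {f h : Space N → ℝ}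
    (hfh : IsSpatialCovariance β f h) (φ ψ : Test N) (t s : ℝ) :
    ((∫ x, ∫ y, φ (t, x) * f (x - y) * ψ (s, y) : ℝ) : ℂ) =
      ∫ ξ, spatialFourier φ t ξ * (starRingEnd ℂ) (spatialFourier ψ s ξ) * (h ξ : ℂ) := by
  have h1 := integral_cov_eq_fourier hfh (slice_contDiff φ t) (slice_contDiff ψ s)
    (slice_hasCompactSupport φ t) (slice_hasCompactSupport ψ s)
  have h2 : ∀ ξ, fourierN (fun y => slice ψ s (-y)) ξ = (starRingEnd ℂ) (spatialFourier ψ s ξ) :=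
    fun ξ => fourierN_neg_of_real (fun y => ψ (s, y)) ξ
  simp_rw [h2, ← spatialFourier_eq] at h1
  rw [← h1, ← integral_complex_ofReal]
  refine integral_congr_ae (ae_of_all _ fun x => ?_)
  simp only
  rw [← integral_complex_ofReal]
  refine integral_congr_ae (ae_of_all _ fun y => ?_)
  simp [slice]

/-! ### The noise covariance as an integral of time pairings -/

/-- A majorant with separated time and frequency variables, for the exchange of integrals in
`noiseCov`. At the origin `β < N` suffices; at infinity the decay of one transform is enough, the
other being merely bounded. -/
theorem exists_pair_bound {N : ℕ} [Nontrivial (Space N)] {β : ℝ} (hβ : 0 < β) (hβN : β < N)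
    {f h : Space N → ℝ} (hfh : IsSpatialCovariance β f h) (φ ψ : Test N) :
    ∃ (T : ℝ) (g : Space N → ℝ), Integrable g ∧ ∀ᵐ ξ, ∀ t s,
      ‖spatialFourier φ t ξ * (starRingEnd ℂ) (spatialFourier ψ s ξ) * (h ξ : ℂ)‖ ≤
        (Icc 0 T).indicator (fun _ => (1 : ℝ)) t * (Icc 0 T).indicator (fun _ => (1 : ℝ)) s *
          g ξ := by
  obtain ⟨C₁, C₂, hC₁, hC₂, hcomp⟩ := hfh.comparable
  obtain ⟨B, hB0, hB⟩ := exists_spatialFourier_min_bound φ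
  obtain ⟨B', hB0', hB'⟩ := exists_spatialFourier_min_bound ψ
  obtain ⟨T, R, hT, -, hsupp⟩ := exists_support_bound φ
  obtain ⟨T', R', hT', -, hsupp'⟩ := exists_support_bound ψ
  have hgi := (integrable_min_norm_rpow (N := N) (p := β) (q := β + N) hβN
    (by linarith)).const_mul (B * B' * C₂)
  refine ⟨max T T', _, hgi, ?_⟩
  filter_upwards [hcomp, Measure.ae_ne volume (0 : Space N)] with ξ hξ hξ0 t s
  have hρ : 0 < ‖ξ‖ := norm_pos_iff.2 hξ0
  have h0 : 0 ≤ h ξ := le_trans (by positivity) hξ.1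
  by_cases ht : t ∈ Icc 0 (max T T')
  · by_cases hs : s ∈ Icc 0 (max T T')
    · rw [indicator_of_mem ht, indicator_of_mem hs, one_mul, one_mul, norm_mul, norm_mul,
        RCLike.norm_conj, Complex.norm_real, Real.norm_eq_abs, abs_of_nonneg h0]
      have hm : min 1 (‖ξ‖ ^ (-(N : ℝ))) ≤ 1 := min_le_left _ _
      have hm0 : 0 ≤ min 1 (‖ξ‖ ^ (-(N : ℝ))) := by positivity
      calc ‖spatialFourier φ t ξ‖ * ‖spatialFourier ψ s ξ‖ * h ξ
          ≤ (B * min 1 (‖ξ‖ ^ (-(N : ℝ)))) * (B' * 1) * (C₂ * ‖ξ‖ ^ (-β)) := by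
            have h1 := hB t ξ hξ0
            have h2 := (hB' s ξ hξ0).trans (mul_le_mul_of_nonneg_left hm hB0')
            have h3 := hξ.2
            gcongr
        _ = B * B' * C₂ * (min 1 (‖ξ‖ ^ (-(N : ℝ))) * ‖ξ‖ ^ (-β)) := by ring
        _ = _ := by
            rw [min_mul_of_nonneg _ _ (by positivity), one_mul, ← Real.rpow_add hρ,
              show -(β + (N : ℝ)) = -(N : ℝ) + -β by ring]
    · rw [spatialFourier_of_notMem (fun t x hx => (hsupp' t x hx).1)
        (fun h' => hs ⟨h'.1, h'.2.trans (le_max_right _ _)⟩) ξ, indicator_of_notMem hs]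
      simp
  · rw [spatialFourier_of_notMem (fun t x hx => (hsupp t x hx).1)
      (fun h' => ht ⟨h'.1, h'.2.trans (le_max_left _ _)⟩) ξ, indicator_of_notMem ht]
    simp

theorem measurable_pair {N : ℕ} {h : Space N → ℝ} (hh : Measurable h) (φ ψ : Test N) :
    Measurable (fun z : (ℝ × ℝ) × Space N => spatialFourier φ z.1.1 z.2 *
      (starRingEnd ℂ) (spatialFourier ψ z.1.2 z.2) * (h z.2 : ℂ)) := by
  have h1 := (measurable_spatialFourier φ).comp
    (by fun_prop : Measurable fun z : (ℝ × ℝ) × Space N => (z.1.1, z.2))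
  have h2 := (measurable_spatialFourier ψ).comp
    (by fun_prop : Measurable fun z : (ℝ × ℝ) × Space N => (z.1.2, z.2))
  have h3 : Measurable (fun z : (ℝ × ℝ) × Space N => (h z.2 : ℂ)) := by fun_prop
  exact (h1.mul (Complex.continuous_conj.measurable.comp h2)).mul h3

theorem noiseCov_eq_half {N : ℕ} [Nontrivial (Space N)] {β : ℝ} (hβ : 0 < β) (hβN : β < N)
    {f h : Space N → ℝ} (hfh : IsSpatialCovariance β f h) (φ ψ : Test N) :
    Integrable (fun ξ => timePairing (1 / 2) (fun t => spatialFourier φ t ξ)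
        (fun t => spatialFourier ψ t ξ) * (h ξ : ℂ)) ∧
    (noiseCov (1 / 2) f φ ψ : ℂ) = ∫ ξ, timePairing (1 / 2) (fun t => spatialFourier φ t ξ)
        (fun t => spatialFourier ψ t ξ) * (h ξ : ℂ) := by
  obtain ⟨T, g, hg, hbound⟩ := exists_pair_bound hβ hβN hfh φ ψ
  have hK : Integrable ((Icc 0 T).indicator (fun _ => (1 : ℝ)))
      (volume.restrict (Ioi (0 : ℝ))) :=
    ((integrable_indicator_iff measurableSet_Icc).2
      (integrableOn_const (by simp))).integrableOn
  have hF : Integrable (Function.uncurry fun (t : ℝ) (ξ : Space N) => spatialFourier φ t ξ *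
      (starRingEnd ℂ) (spatialFourier ψ t ξ) * (h ξ : ℂ))
      ((volume.restrict (Ioi (0 : ℝ))).prod volume) := by
    refine (hK.mul_prod hg).mono' ?_ ?_
    · exact ((measurable_pair hfh.measurable_density φ ψ).comp
        (by fun_prop : Measurable fun z : ℝ × Space N => ((z.1, z.1), z.2))).aestronglyMeasurable
    · filter_upwards [(Measure.quasiMeasurePreserving_snd
        (μ := volume.restrict (Ioi (0 : ℝ))) (ν := (volume : Measure (Space N)))).ae hbound]
        with z hz
      refine (hz z.1 z.1).trans (le_of_eq ?_)
      by_cases h1 : z.1 ∈ Icc 0 T <;> simp [h1]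
  have hin : ∀ ξ, ∫ t in Ioi (0 : ℝ), spatialFourier φ t ξ *
      (starRingEnd ℂ) (spatialFourier ψ t ξ) * (h ξ : ℂ) =
      timePairing (1 / 2) (fun t => spatialFourier φ t ξ)
        (fun t => spatialFourier ψ t ξ) * (h ξ : ℂ) := fun ξ => by
    unfold timePairing
    rw [if_pos rfl, integral_mul_const]
  have hI := hF.integral_prod_right
  simp only [Function.uncurry_apply_pair] at hI
  simp_rw [hin] at hI
  refine ⟨hI, ?_⟩
  unfold noiseCov
  rw [if_pos rfl, ← integral_complex_ofReal]
  simp_rw [integral_slice_cov hfh φ ψ]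
  rw [integral_integral_swap hF]
  simp_rw [hin]

theorem noiseCov_eq_of_half_lt {N : ℕ} [Nontrivial (Space N)] {H β : ℝ} (hH : 1 / 2 < H)
    (hβ : 0 < β) (hβN : β < N)
    {f h : Space N → ℝ} (hfh : IsSpatialCovariance β f h) (φ ψ : Test N) :
    Integrable (fun ξ => timePairing H (fun t => spatialFourier φ t ξ)
        (fun t => spatialFourier ψ t ξ) * (h ξ : ℂ)) ∧
    (noiseCov H f φ ψ : ℂ) = ∫ ξ, timePairing H (fun t => spatialFourier φ t ξ)
        (fun t => spatialFourier ψ t ξ) * (h ξ : ℂ) := by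
  obtain ⟨T, g, hg, hbound⟩ := exists_pair_bound hβ hβN hfh φ ψ
  set μ : Measure ℝ := volume.restrict (Ioi (0 : ℝ)) with hμ
  have hK : Integrable (fun p : ℝ × ℝ => (Icc 0 T).indicator (fun _ => (1 : ℝ)) p.1 *
      (Icc 0 T).indicator (fun _ => (1 : ℝ)) p.2 * |p.1 - p.2| ^ (-(2 - 2 * H))) (μ.prod μ) := by
    rw [hμ, Measure.prod_restrict]
    exact (integrable_abs_sub_rpow (by linarith) T).integrableOn
  set G : ℝ × ℝ → Space N → ℂ := fun p ξ => ((|p.1 - p.2| ^ (2 * H - 2) : ℝ) : ℂ) *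
    (spatialFourier φ p.1 ξ * (starRingEnd ℂ) (spatialFourier ψ p.2 ξ) * (h ξ : ℂ)) with hG
  have hF : Integrable (Function.uncurry G) ((μ.prod μ).prod volume) := by
    refine (hK.mul_prod hg).mono' ?_ ?_
    · refine Measurable.aestronglyMeasurable ?_
      exact (by fun_prop : Measurable fun z : (ℝ × ℝ) × Space N =>
        ((|z.1.1 - z.1.2| ^ (2 * H - 2) : ℝ) : ℂ)).mul
        (measurable_pair hfh.measurable_density φ ψ)
    · filter_upwards [(Measure.quasiMeasurePreserving_snd
        (μ := μ.prod μ) (ν := (volume : Measure (Space N)))).ae hbound] with z hz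
      simp only [Function.uncurry, hG]
      rw [norm_mul, Complex.norm_real, Real.norm_eq_abs,
        abs_of_nonneg (Real.rpow_nonneg (abs_nonneg _) _),
        show 2 * H - 2 = -(2 - 2 * H) by ring]
      refine (mul_le_mul_of_nonneg_left (hz z.1.1 z.1.2)
        (Real.rpow_nonneg (abs_nonneg _) _)).trans (le_of_eq ?_)
      ring
  -- Only almost everywhere, since splitting the integral over time pairs uses integrability of the
  -- section at `ξ`.
  have hin : ∀ᵐ ξ, ∫ p, G p ξ ∂(μ.prod μ) = timePairing H (fun t => spatialFourier φ t ξ)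
        (fun t => spatialFourier ψ t ξ) * (h ξ : ℂ) := by
    filter_upwards [hF.prod_left_ae] with ξ hξ
    simp only [Function.uncurry_apply_pair] at hξ
    unfold timePairing
    rw [if_neg hH.ne', integral_prod _ hξ, ← integral_mul_const]
    refine integral_congr_ae (ae_of_all _ fun t => ?_)
    simp only
    rw [← integral_mul_const]
    refine integral_congr_ae (ae_of_all _ fun s => ?_)
    simp only [hG]
    ring
  refine ⟨hF.integral_prod_right.congr hin, ?_⟩
  rw [← integral_congr_ae hin, ← integral_integral_swap hF, integral_prod (fun p => ∫ ξ, G p ξ) hF.integral_prod_left]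
  unfold noiseCov
  rw [if_neg hH.ne', ← integral_complex_ofReal]
  refine integral_congr_ae (ae_of_all _ fun t => ?_)
  simp only
  rw [← integral_complex_ofReal]
  refine integral_congr_ae (ae_of_all _ fun s => ?_)
  simp only [hG]
  rw [integral_const_mul, ← integral_slice_cov hfh φ ψ, ← Complex.ofReal_mul,
    ← integral_const_mul]
  congr 1
  refine integral_congr_ae (ae_of_all _ fun x => ?_)
  simp only
  rw [← integral_const_mul]
  refine integral_congr_ae (ae_of_all _ fun y => ?_)
  ring

theorem noiseCov_eq {N : ℕ} [Nontrivial (Space N)] {H β : ℝ} (hH : 1 / 2 ≤ H)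
    (hβ : 0 < β) (hβN : β < N)
    {f h : Space N → ℝ} (hfh : IsSpatialCovariance β f h) (φ ψ : Test N) :
    Integrable (fun ξ => timePairing H (fun t => spatialFourier φ t ξ)
        (fun t => spatialFourier ψ t ξ) * (h ξ : ℂ)) ∧
    (noiseCov H f φ ψ : ℂ) = ∫ ξ, timePairing H (fun t => spatialFourier φ t ξ)
        (fun t => spatialFourier ψ t ξ) * (h ξ : ℂ) := by
  rcases hH.eq_or_lt with rfl | hH
  · exact noiseCov_eq_half hβ hβN hfh φ ψ
  · exact noiseCov_eq_of_half_lt hH hβ hβN hfh φ ψ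

theorem integral_sub_sub_add {X : Type*} [MeasurableSpace X] {μ : Measure X}
    {f₁ f₂ f₃ f₄ : X → ℂ} (h₁ : Integrable f₁ μ) (h₂ : Integrable f₂ μ) (h₃ : Integrable f₃ μ)
    (h₄ : Integrable f₄ μ) :
    ∫ x, (f₁ x - f₂ x - f₃ x + f₄ x) ∂μ =
      (∫ x, f₁ x ∂μ) - (∫ x, f₂ x ∂μ) - (∫ x, f₃ x ∂μ) + ∫ x, f₄ x ∂μ := by
  rw [integral_add (f := fun x => f₁ x - f₂ x - f₃ x) ((h₁.sub h₂).sub h₃) h₄,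
    integral_sub (f := fun x => f₁ x - f₂ x) (h₁.sub h₂) h₃, integral_sub h₁ h₂]

/-- For `H > 1/2` the expansion is carried out on window integrals, where the four terms are
integrable functions of the one variable `q`. -/
theorem timeForm_sub {H T M M' : ℝ} (hH : 1 / 2 ≤ H) (hH1 : H < 1) {a b : ℝ → ℂ}
    (ha : TimeAdmissible T M a) (hb : TimeAdmissible T M' b) :
    timeForm H (fun t => a t - b t) =
      (timePairing H a a - timePairing H a b - timePairing H b a + timePairing H b b).re := by
  rw [timeForm_eq_re_timePairing]
  congr 1
  rcases hH.eq_or_lt with rfl | hH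
  · have hintg : ∀ {a b : ℝ → ℂ} {M M' : ℝ}, TimeAdmissible T M a → TimeAdmissible T M' b →
        IntegrableOn (fun t => a t * (starRingEnd ℂ) (b t)) (Ioi 0) := fun {a b M M'} ha hb =>
      (ha.integrable.mul_bdd (c := M')
        (Complex.continuous_conj.measurable.comp hb.measurable).aestronglyMeasurable
        (ae_of_all _ fun t => by simpa using hb.bound t)).integrableOn
    unfold timePairing
    simp only [if_true]
    rw [← integral_sub_sub_add (hintg ha ha) (hintg ha hb) (hintg hb ha) (hintg hb hb)]
    refine integral_congr_ae (ae_of_all _ fun t => ?_)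
    simp only [map_sub]
    ring
  · have hintg := fun {a b : ℝ → ℂ} {M M' : ℝ} (ha : TimeAdmissible T M a)
      (hb : TimeAdmissible T M' b) => integrable_timePairing_window hH hH1 ha hb
    rw [timePairing_eq_integral_window hH hH1 ha ha, timePairing_eq_integral_window hH hH1 ha hb,
      timePairing_eq_integral_window hH hH1 hb ha, timePairing_eq_integral_window hH hH1 hb hb,
      timePairing_eq_integral_window hH hH1 (ha.sub hb) (ha.sub hb)]
    rw [← integral_sub_sub_add (hintg ha ha) (hintg ha hb) (hintg hb ha) (hintg hb hb)]
    refine integral_congr_ae (ae_of_all _ fun q => ?_)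
    have e : windowIntegral (fun t => a t - b t) q = windowIntegral a q - windowIntegral b q := by
      simp_rw [windowIntegral_eq_setIntegral]
      exact integral_sub ha.integrable.integrableOn hb.integrable.integrableOn
    simp only [e, map_sub]
    ring

/-- The isometry property of the noise on differences of test functions. -/
theorem hpNormSq_sub_eq_noiseCov {N : ℕ} [Nontrivial (Space N)] {H β : ℝ} (hH : 1 / 2 ≤ H)
    (hH1 : H < 1) (hβ : 0 < β) (hβN : β < N)
    {f h : Space N → ℝ} (hfh : IsSpatialCovariance β f h) (φ ψ : Test N) :
    hpNormSq H h (fun s ξ => spatialFourier φ s ξ - spatialFourier ψ s ξ) =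
      ENNReal.ofReal (noiseCov H f φ φ - noiseCov H f φ ψ - noiseCov H f ψ φ +
        noiseCov H f ψ ψ) := by
  obtain ⟨T, M, hT, hadm⟩ := exists_spatialFourier_admissible φ
  obtain ⟨T', M', hT', hadm'⟩ := exists_spatialFourier_admissible ψ
  have ha := fun ξ => (hadm ξ).mono (le_max_left T T') le_rfl
  have hb := fun ξ => (hadm' ξ).mono (le_max_right T T') le_rfl
  obtain ⟨i1, e1⟩ := noiseCov_eq hH hβ hβN hfh φ φ
  obtain ⟨i2, e2⟩ := noiseCov_eq hH hβ hβN hfh φ ψ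
  obtain ⟨i3, e3⟩ := noiseCov_eq hH hβ hβN hfh ψ φ
  obtain ⟨i4, e4⟩ := noiseCov_eq hH hβ hβN hfh ψ ψ
  have hpt : ∀ ξ, timeForm H (fun s => spatialFourier φ s ξ - spatialFourier ψ s ξ) * h ξ =
      (timePairing H (fun t => spatialFourier φ t ξ) (fun t => spatialFourier φ t ξ) * (h ξ : ℂ) -
      timePairing H (fun t => spatialFourier φ t ξ) (fun t => spatialFourier ψ t ξ) * (h ξ : ℂ) -
      timePairing H (fun t => spatialFourier ψ t ξ) (fun t => spatialFourier φ t ξ) * (h ξ : ℂ) +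
      timePairing H (fun t => spatialFourier ψ t ξ) (fun t => spatialFourier ψ t ξ) *
        (h ξ : ℂ)).re := by
    intro ξ
    rw [timeForm_sub hH hH1 (ha ξ) (hb ξ), ← sub_mul, ← sub_mul, ← add_mul, Complex.re_mul_ofReal]
  have hi := ((i1.sub i2).sub i3).add i4
  have hnn : ∀ᵐ ξ, 0 ≤ h ξ := by
    obtain ⟨C₁, C₂, hC₁, hC₂, hcomp⟩ := hfh.comparable
    filter_upwards [hcomp] with ξ hξ using le_trans (by positivity) hξ.1
  unfold hpNormSq
  rw [← ofReal_integral_eq_lintegral_ofReal]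
  · congr 1
    simp_rw [hpt]
    have h5 : ∫ ξ, (timePairing H (fun t => spatialFourier φ t ξ)
        (fun t => spatialFourier φ t ξ) * (h ξ : ℂ) -
      timePairing H (fun t => spatialFourier φ t ξ) (fun t => spatialFourier ψ t ξ) * (h ξ : ℂ) -
      timePairing H (fun t => spatialFourier ψ t ξ) (fun t => spatialFourier φ t ξ) * (h ξ : ℂ) +
      timePairing H (fun t => spatialFourier ψ t ξ) (fun t => spatialFourier ψ t ξ) *
        (h ξ : ℂ)) = ((noiseCov H f φ φ - noiseCov H f φ ψ - noiseCov H f ψ φ +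
        noiseCov H f ψ ψ : ℝ) : ℂ) := by
      push_cast
      rw [e1, e2, e3, e4, integral_sub_sub_add i1 i2 i3 i4]
    have h6 := integral_re hi
    simp only [Pi.add_apply, Pi.sub_apply] at h6
    rw [h5] at h6
    exact h6
  · refine hi.re.congr (ae_of_all _ fun ξ => ?_)
    exact (hpt ξ).symm
  · filter_upwards [hnn] with ξ hξ
    exact mul_nonneg (timeForm_nonneg hH hH1 ((ha ξ).sub (hb ξ))) hξ

/-! ### The norm of the Hilbert space of the noise -/

/-- Jointly measurable fields which at almost every frequency are admissible functions of time. -/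
structure FieldAdmissible {N : ℕ} (m : ℝ → Space N → ℂ) : Prop where
  measurable : Measurable (Function.uncurry m)
  admissible : ∀ᵐ ξ, ∃ T M, TimeAdmissible T M (fun s => m s ξ)

theorem FieldAdmissible.sub {N : ℕ} {m m' : ℝ → Space N → ℂ} (hm : FieldAdmissible m)
    (hm' : FieldAdmissible m') : FieldAdmissible (fun s ξ => m s ξ - m' s ξ) where
  measurable := hm.measurable.sub hm'.measurable
  admissible := by
    filter_upwards [hm.admissible, hm'.admissible] with ξ ⟨T, M, h⟩ ⟨T', M', h'⟩
    exact ⟨max T T', M + M', (h.mono (le_max_left _ _) le_rfl).sub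
      (h'.mono (le_max_right _ _) le_rfl)⟩

theorem spatialFourier_fieldAdmissible {N : ℕ} (φ : Test N) :
    FieldAdmissible (fun s ξ => spatialFourier φ s ξ) where
  measurable := measurable_spatialFourier φ
  admissible := by
    obtain ⟨T, M, -, h⟩ := exists_spatialFourier_admissible φ
    exact ae_of_all _ fun ξ => ⟨T, M, h ξ⟩

theorem gFourier_fieldAdmissible {N : ℕ} [Nontrivial (Space N)] (t : ℝ) (x : Space N) :
    FieldAdmissible (gFourier t x) where
  measurable := by
    have e : Function.uncurry (gFourier t x) =
        (Prod.fst ⁻¹' (Icc (0 : ℝ) t)).indicator (fun p : ℝ × Space N =>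
          Complex.exp (-Complex.I * ((inner ℝ x p.2 : ℝ) : ℂ)) *
            ((Real.sin ((t - p.1) * ‖p.2‖) / ‖p.2‖ : ℝ) : ℂ)) := by
      funext p
      by_cases h : p.1 ∈ Icc 0 t
      · rw [indicator_of_mem (show p ∈ Prod.fst ⁻¹' (Icc (0 : ℝ) t) from h)]
        simp only [Function.uncurry, gFourier, waveFourier]
        rw [indicator_of_mem h]
      · rw [indicator_of_notMem (show p ∉ Prod.fst ⁻¹' (Icc (0 : ℝ) t) from h)]
        simp only [Function.uncurry, gFourier]
        rw [indicator_of_notMem h]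
    rw [e]
    exact Measurable.indicator (by fun_prop) (measurable_fst measurableSet_Icc)
  admissible := by
    filter_upwards [Measure.ae_ne volume (0 : Space N)] with ξ hξ
    simp_rw [gFourier_eq]
    exact ⟨t, _, (waveTime_admissible le_rfl (norm_pos_iff.2 hξ)).const_mul _⟩

theorem measurable_timeForm_field {N : ℕ} (H : ℝ) {m : ℝ → Space N → ℂ}
    (hm : Measurable (Function.uncurry m)) :
    Measurable (fun ξ => timeForm H (fun s => m s ξ)) := by
  unfold timeForm
  split_ifs
  · have h1 : Measurable (fun p : Space N × ℝ => ‖m p.2 p.1‖ ^ 2) :=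
      (hm.comp (measurable_swap : Measurable (Prod.swap : Space N × ℝ → ℝ × Space N))).norm.pow_const 2
    exact (h1.stronglyMeasurable.integral_prod_right
      (ν := volume.restrict (Ioi (0 : ℝ)))).measurable
  · have h1 : Measurable (fun p : (Space N × ℝ) × ℝ =>
        m p.1.2 p.1.1 * (starRingEnd ℂ) (m p.2 p.1.1) *
          ((|p.1.2 - p.2| ^ (2 * H - 2) : ℝ) : ℂ)) := by
      have ha := hm.comp (by fun_prop : Measurable fun p : (Space N × ℝ) × ℝ => (p.1.2, p.1.1))
      have hb := hm.comp (by fun_prop : Measurable fun p : (Space N × ℝ) × ℝ => (p.2, p.1.1))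
      exact (ha.mul (Complex.continuous_conj.measurable.comp hb)).mul (by fun_prop)
    have h2 := h1.stronglyMeasurable.integral_prod_right' (ν := volume.restrict (Ioi (0 : ℝ)))
    have h3 := h2.integral_prod_right' (ν := volume.restrict (Ioi (0 : ℝ)))
    exact Complex.measurable_re.comp h3.measurable

theorem timeForm_neg (H : ℝ) (a : ℝ → ℂ) : timeForm H (fun t => -a t) = timeForm H a := by
  unfold timeForm
  simp only [norm_neg, map_neg, neg_mul_neg]

theorem eLpNorm_two_sq {A : Type*} [MeasurableSpace A] (μ : Measure A) (f : A → ℝ) :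
    eLpNorm f 2 μ ^ 2 = ∫⁻ x, ‖f x‖ₑ ^ 2 ∂μ := by
  have h := eLpNorm_nnreal_pow_eq_lintegral (μ := μ) (p := 2) (f := f) (by norm_num)
  simpa only [ENNReal.coe_ofNat, NNReal.coe_ofNat, ENNReal.rpow_ofNat] using h

theorem tendsto_zero_of_tendsto_sq {ι : Type*} {l : Filter ι} {F : ι → ℝ≥0∞}
    (h : Tendsto (fun n => F n ^ 2) l (𝓝 0)) : Tendsto F l (𝓝 0) := by
  have h1 := (ENNReal.continuous_rpow_const (y := (1 / 2 : ℝ))).tendsto 0 |>.comp h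
  rw [ENNReal.zero_rpow_of_pos (by norm_num)] at h1
  refine h1.congr fun n => ?_
  simp only [Function.comp_apply]
  rw [← ENNReal.rpow_ofNat, ← ENNReal.rpow_mul]
  norm_num

/-- The norm of the Hilbert space of the noise. -/
def hpNorm {N : ℕ} (H : ℝ) (h : Space N → ℝ) (m : ℝ → Space N → ℂ) : ℝ≥0∞ :=
  eLpNorm (fun ξ => √(timeForm H (fun s => m s ξ) * h ξ)) 2 volume

theorem hpNormSq_eq {N : ℕ} (H : ℝ) (h : Space N → ℝ) (m : ℝ → Space N → ℂ) :
    hpNormSq H h m = hpNorm H h m ^ 2 := by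
  unfold hpNormSq hpNorm
  rw [eLpNorm_two_sq]
  refine lintegral_congr fun ξ => ?_
  rw [Real.enorm_eq_ofReal (Real.sqrt_nonneg _), ← ENNReal.ofReal_pow (Real.sqrt_nonneg _)]
  rcases le_total 0 (timeForm H (fun s => m s ξ) * h ξ) with h0 | h0
  · rw [Real.sq_sqrt h0]
  · rw [Real.sqrt_eq_zero_of_nonpos h0, ENNReal.ofReal_of_nonpos h0]
    simp

theorem hpNorm_sub_comm {N : ℕ} (H : ℝ) (h : Space N → ℝ) (m m' : ℝ → Space N → ℂ) :
    hpNorm H h (fun s ξ => m s ξ - m' s ξ) = hpNorm H h (fun s ξ => m' s ξ - m s ξ) := by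
  unfold hpNorm
  congr 1
  funext ξ
  rw [← timeForm_neg]
  simp only [neg_sub]

/-- Two layers of Minkowski: in time at almost every frequency, then in `L²(dξ)` for the resulting
nonnegative functions. -/
theorem hpNorm_sub_le {N : ℕ} {H β : ℝ} (hH : 1 / 2 ≤ H) (hH1 : H < 1) {f h : Space N → ℝ}
    (hfh : IsSpatialCovariance β f h) {m₁ m₂ m₃ : ℝ → Space N → ℂ} (h₁ : FieldAdmissible m₁)
    (h₂ : FieldAdmissible m₂) (h₃ : FieldAdmissible m₃) :
    hpNorm H h (fun s ξ => m₁ s ξ - m₃ s ξ) ≤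
      hpNorm H h (fun s ξ => m₁ s ξ - m₂ s ξ) + hpNorm H h (fun s ξ => m₂ s ξ - m₃ s ξ) := by
  have hnn : ∀ᵐ ξ, 0 ≤ h ξ := by
    obtain ⟨C₁, C₂, hC₁, hC₂, hcomp⟩ := hfh.comparable
    filter_upwards [hcomp] with ξ hξ using le_trans (by positivity) hξ.1
  have hmeas : ∀ {m : ℝ → Space N → ℂ}, FieldAdmissible m → AEStronglyMeasurable
      (fun ξ => √(timeForm H (fun s => m s ξ) * h ξ)) volume := fun hm =>
    ((measurable_timeForm_field H hm.measurable).mul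
      hfh.measurable_density).sqrt.aestronglyMeasurable
  unfold hpNorm
  refine le_trans ?_ (eLpNorm_add_le (hmeas (h₁.sub h₂)) (hmeas (h₂.sub h₃)) (by norm_num))
  refine eLpNorm_mono_ae ?_
  filter_upwards [hnn, (h₁.sub h₂).admissible, (h₂.sub h₃).admissible] with ξ hξ ⟨T, M, ha⟩
    ⟨T', M', hb⟩
  have ha' := ha.mono (le_max_left T T') le_rfl
  have hb' := hb.mono (le_max_right T T') le_rfl
  have key := sqrt_timeForm_add_le hH hH1 ha' hb'
  simp only [sub_add_sub_cancel] at key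
  simp only [Pi.add_apply]
  rw [Real.norm_of_nonneg (Real.sqrt_nonneg _), Real.norm_of_nonneg (by positivity),
    Real.sqrt_mul' _ hξ, Real.sqrt_mul' _ hξ, Real.sqrt_mul' _ hξ, ← add_mul]
  gcongr

theorem tendsto_hpNormSq_sub {N : ℕ} {H β : ℝ} (hH : 1 / 2 ≤ H) (hH1 : H < 1) {f h : Space N → ℝ}
    (hfh : IsSpatialCovariance β f h) {m m' : ℝ → Space N → ℂ} {A B : ℕ → ℝ → Space N → ℂ}
    (hm : FieldAdmissible m) (hm' : FieldAdmissible m') (hA : ∀ n, FieldAdmissible (A n))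
    (hB : ∀ n, FieldAdmissible (B n)) (hfin : hpNormSq H h (fun s ξ => m s ξ - m' s ξ) ≠ ∞)
    (hAm : Tendsto (fun n => hpNormSq H h (fun s ξ => A n s ξ - m s ξ)) atTop (𝓝 0))
    (hBm : Tendsto (fun n => hpNormSq H h (fun s ξ => B n s ξ - m' s ξ)) atTop (𝓝 0)) :
    Tendsto (fun n => hpNormSq H h (fun s ξ => A n s ξ - B n s ξ)) atTop
      (𝓝 (hpNormSq H h (fun s ξ => m s ξ - m' s ξ))) := by
  simp_rw [hpNormSq_eq] at hAm hBm hfin ⊢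
  have h1 := tendsto_zero_of_tendsto_sq hAm
  have h2 := tendsto_zero_of_tendsto_sq hBm
  have hε := h1.add h2
  rw [add_zero] at hε
  set v := hpNorm H h (fun s ξ => m s ξ - m' s ξ) with hv
  have hvfin : v ≠ ∞ := fun h' => hfin (by rw [h']; simp)
  have hup : ∀ n, hpNorm H h (fun s ξ => A n s ξ - B n s ξ) ≤
      v + (hpNorm H h (fun s ξ => A n s ξ - m s ξ) +
        hpNorm H h (fun s ξ => B n s ξ - m' s ξ)) := fun n => by
    have t1 := hpNorm_sub_le hH hH1 hfh (hA n) hm (hB n)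
    have t2 := hpNorm_sub_le hH hH1 hfh hm hm' (hB n)
    rw [hpNorm_sub_comm H h m' (B n)] at t2
    calc _ ≤ _ := t1
      _ ≤ _ := add_le_add_right t2 _
      _ = _ := by ring
  -- The reverse triangle inequality with truncated subtraction; finiteness of `v` enters when this
  -- lower bound is sent to `v`.
  have hlo : ∀ n, v - (hpNorm H h (fun s ξ => A n s ξ - m s ξ) +
        hpNorm H h (fun s ξ => B n s ξ - m' s ξ)) ≤
      hpNorm H h (fun s ξ => A n s ξ - B n s ξ) := fun n => by
    rw [tsub_le_iff_right]
    have t1 := hpNorm_sub_le hH hH1 hfh hm (hA n) hm'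
    have t2 := hpNorm_sub_le hH hH1 hfh (hA n) (hB n) hm'
    rw [hpNorm_sub_comm H h m (A n)] at t1
    calc _ ≤ _ := t1
      _ ≤ _ := add_le_add_right t2 _
      _ = _ := by ring
  refine ENNReal.Tendsto.pow ?_
  refine tendsto_of_tendsto_of_tendsto_of_le_of_le ?_ ?_ hlo hup
  · have := ENNReal.Tendsto.sub (tendsto_const_nhds (x := v)) hε (Or.inl hvfin)
    rwa [tsub_zero] at this
  · have := (tendsto_const_nhds (x := v)).add hε
    rwa [add_zero] at this

/-! ### The law of increments of the solution -/

theorem norm_exp_mul_I_sub_le (a b : ℝ) :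
    ‖Complex.exp ((a : ℂ) * Complex.I) - Complex.exp ((b : ℂ) * Complex.I)‖ ≤ |a - b| := by
  have e : Complex.exp ((a : ℂ) * Complex.I) - Complex.exp ((b : ℂ) * Complex.I) =
      Complex.exp ((b : ℂ) * Complex.I) * (Complex.exp (Complex.I * ((a - b : ℝ) : ℂ)) - 1) := by
    rw [mul_sub, ← Complex.exp_add, mul_one]
    congr 2
    push_cast
    ring
  rw [e, norm_mul, Complex.norm_exp_ofReal_mul_I, one_mul]
  exact Real.norm_exp_I_mul_ofReal_sub_one_le

/-- The map `x ↦ e^{ix}` is 1-Lipschitz, so the difference of characteristic functions is at most `∑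
|θ_j|` times the `L¹` distances of coordinates, themselves bounded by `L²` distances. -/
theorem tendsto_charFun_of_eLpNorm {d : ℕ} {Ω : Type*} [MeasurableSpace Ω] {P : Measure Ω}
    [IsProbabilityMeasure P] {Y : ℕ → Ω → EuclideanSpace ℝ (Fin d)}
    {X : Ω → EuclideanSpace ℝ (Fin d)} (hY : ∀ n, Measurable (Y n)) (hX : Measurable X)
    (h : ∀ j, Tendsto (fun n => eLpNorm (fun ω => Y n ω j - X ω j) 2 P) atTop (𝓝 0))
    (θ : EuclideanSpace ℝ (Fin d)) :
    Tendsto (fun n => charFun (P.map (Y n)) θ) atTop (𝓝 (charFun (P.map X) θ)) := by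
  have hch : ∀ {Z : Ω → EuclideanSpace ℝ (Fin d)}, Measurable Z →
      charFun (P.map Z) θ = ∫ ω, Complex.exp (((inner ℝ (Z ω) θ : ℝ) : ℂ) * Complex.I) ∂P :=
    fun {Z} hZ => by
      rw [charFun_apply, integral_map hZ.aemeasurable (by fun_prop)]
  have hintg : ∀ {Z : Ω → EuclideanSpace ℝ (Fin d)}, Measurable Z →
      Integrable (fun ω => Complex.exp (((inner ℝ (Z ω) θ : ℝ) : ℂ) * Complex.I)) P :=
    fun {Z} hZ => Integrable.of_bound (by fun_prop) 1
      (ae_of_all _ fun ω => by rw [Complex.norm_exp_ofReal_mul_I])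
  have hcoord : ∀ {Z : Ω → EuclideanSpace ℝ (Fin d)}, Measurable Z → ∀ j,
      Measurable (fun ω => Z ω j) := fun {Z} hZ j => by fun_prop
  rw [tendsto_iff_edist_tendsto_0]
  refine tendsto_of_tendsto_of_tendsto_of_le_of_le (tendsto_const_nhds)
    (h := fun n => ∑ j, ENNReal.ofReal |θ j| * eLpNorm (fun ω => Y n ω j - X ω j) 2 P) ?_
    (fun n => zero_le) (fun n => ?_)
  · have : Tendsto (fun n => ∑ j, ENNReal.ofReal |θ j| *
        eLpNorm (fun ω => Y n ω j - X ω j) 2 P) atTop (𝓝 (∑ j : Fin d, ENNReal.ofReal |θ j| * 0)) :=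
      tendsto_finsetSum _ fun j _ => ENNReal.Tendsto.const_mul (h j)
        (Or.inr ENNReal.ofReal_ne_top)
    simpa using this
  · simp only
    rw [hch (hY n), hch hX, edist_eq_enorm_sub, ← integral_sub (hintg (hY n)) (hintg hX)]
    calc _ ≤ ∫⁻ ω, ‖Complex.exp (((inner ℝ (Y n ω) θ : ℝ) : ℂ) * Complex.I) -
          Complex.exp (((inner ℝ (X ω) θ : ℝ) : ℂ) * Complex.I)‖ₑ ∂P :=
          enorm_integral_le_lintegral_enorm _
      _ ≤ ∫⁻ ω, ∑ j, ENNReal.ofReal |θ j| * ‖Y n ω j - X ω j‖ₑ ∂P := by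
          refine lintegral_mono fun ω => ?_
          rw [← ofReal_norm]
          calc _ ≤ ENNReal.ofReal (∑ j, |θ j| * |Y n ω j - X ω j|) := by
                refine ENNReal.ofReal_le_ofReal ((norm_exp_mul_I_sub_le _ _).trans ?_)
                rw [← inner_sub_left, PiLp.inner_apply]
                refine (Finset.abs_sum_le_sum_abs _ _).trans (le_of_eq ?_)
                refine Finset.sum_congr rfl fun j _ => ?_
                simp [abs_mul]
            _ = _ := by
                rw [ENNReal.ofReal_sum_of_nonneg fun j _ => by positivity]
                refine Finset.sum_congr rfl fun j _ => ?_
                rw [ENNReal.ofReal_mul (abs_nonneg _), Real.enorm_eq_ofReal_abs]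
      _ = ∑ j, ENNReal.ofReal |θ j| * eLpNorm (fun ω => Y n ω j - X ω j) 1 P := by
          have hm : ∀ j, Measurable (fun ω => ‖Y n ω j - X ω j‖ₑ) := fun j =>
            ((hcoord (hY n) j).sub (hcoord hX j)).enorm
          rw [lintegral_finsetSum _ fun j _ => (hm j).const_mul _]
          refine Finset.sum_congr rfl fun j _ => ?_
          rw [lintegral_const_mul _ (hm j), eLpNorm_one_eq_lintegral_enorm]
      _ ≤ _ := by
          refine Finset.sum_le_sum fun j _ => ?_
          gcongr
          exact eLpNorm_le_eLpNorm_of_exponent_le (by norm_num)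
            ((hcoord (hY n) j).sub (hcoord hX j)).aestronglyMeasurable

/-- A Gaussian law is fixed by mean and variance; expanding the variance gives four covariances,
which the isometry on test functions sums to the squared norm. -/
theorem noise_sub_map_eq {N d : ℕ} [Nontrivial (Space N)] {H β : ℝ} (hH : 1 / 2 ≤ H)
    (hH1 : H < 1) (hβ : 0 < β) (hβN : β < N) {f h : Space N → ℝ}
    (hfh : IsSpatialCovariance β f h) {Ω : Type*} [MeasurableSpace Ω] {P : Measure Ω}
    [IsProbabilityMeasure P] {W : Fin d → Test N → Ω → ℝ} (hW : IsNoise P H f W) (j : Fin d)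
    (φ ψ : Test N) :
    P.map (fun ω => W j φ ω - W j ψ ω) = gaussianReal 0
      (hpNormSq H h (fun s ξ => spatialFourier φ s ξ - spatialFourier ψ s ξ)).toNNReal := by
  have hG : HasGaussianLaw (fun ω => W j φ ω - W j ψ ω) P := (hW.gaussian j).hasGaussianLaw_fun_sub
  have hL : ∀ φ, MemLp (W j φ) 2 P := fun φ => ((hW.gaussian j).hasGaussianLaw_eval φ).memLp_two
  have hi : ∀ φ, Integrable (W j φ) P := fun φ => (hL φ).integrable (by norm_num)
  have hp : ∀ φ ψ, Integrable (fun ω => W j φ ω * W j ψ ω) P := fun φ ψ =>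
    (hL φ).integrable_mul (hL ψ)
  have hmean : ∫ ω, (W j φ ω - W j ψ ω) ∂P = 0 := by
    rw [integral_sub (hi φ) (hi ψ), hW.mean_zero, hW.mean_zero, sub_zero]
  have hvar : Var[fun ω => W j φ ω - W j ψ ω; P] = noiseCov H f φ φ - noiseCov H f φ ψ -
      noiseCov H f ψ φ + noiseCov H f ψ ψ := by
    rw [variance_of_integral_eq_zero hG.aemeasurable hmean, ← hW.covariance j φ φ,
      ← hW.covariance j φ ψ, ← hW.covariance j ψ φ, ← hW.covariance j ψ ψ,
      ← integral_sub (hp φ φ) (hp φ ψ),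
      ← integral_sub (f := fun ω => W j φ ω * W j φ ω - W j φ ω * W j ψ ω)
        ((hp φ φ).sub (hp φ ψ)) (hp ψ φ),
      ← integral_add (f := fun ω => W j φ ω * W j φ ω - W j φ ω * W j ψ ω - W j ψ ω * W j φ ω)
        (((hp φ φ).sub (hp φ ψ)).sub (hp ψ φ)) (hp ψ ψ)]
    refine integral_congr_ae (ae_of_all _ fun ω => ?_)
    simp only
    ring
  rw [hG.map_eq_gaussianReal, hmean, hvar, hpNormSq_sub_eq_noiseCov hH hH1 hβ hβN hfh,
    ENNReal.ofReal, ENNReal.toNNReal_coe]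

/-- Increments of the solution have i.i.d. centred Gaussian components, with variance the squared
norm of the increment of the kernel. -/
theorem solution_sub_map_eq {N d : ℕ} [Nontrivial (Space N)] {H β : ℝ} (hH : 1 / 2 ≤ H)
    (hH1 : H < 1) (hβ : 0 < β) (hβN : β < N) {f h : Space N → ℝ}
    (hfh : IsSpatialCovariance β f h) {Ω : Type*} [MeasurableSpace Ω] {P : Measure Ω}
    [IsProbabilityMeasure P] {W : Fin d → Test N → Ω → ℝ} (hW : IsNoise P H f W)
    {u : ℝ → Space N → Ω → EuclideanSpace ℝ (Fin d)} (hu : IsSolution P H h W u)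
    {t s : ℝ} (ht : 0 ≤ t) (hs : 0 ≤ s) (x y : Space N)
    (hfin : hpNormSq H h (fun r ξ => gFourier t x r ξ - gFourier s y r ξ) ≠ ∞) :
    P.map (fun ω => u t x ω - u s y ω) =
      (Measure.pi fun _ : Fin d => gaussianReal 0
        (hpNormSq H h (fun r ξ => gFourier t x r ξ - gFourier s y r ξ)).toNNReal).map
          (WithLp.toLp 2) := by
  choose φ hφ1 hφ2 using fun j => hu.wiener t ht x j
  choose ψ hψ1 hψ2 using fun j => hu.wiener s hs y j
  have hum : ∀ t x, Measurable (u t x) := fun t x =>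
    hu.measurable.comp (by fun_prop : Measurable fun ω : Ω => (t, x, ω))
  set V := (hpNormSq H h (fun r ξ => gFourier t x r ξ - gFourier s y r ξ)).toNNReal with hV
  set Y : ℕ → Ω → EuclideanSpace ℝ (Fin d) := fun n ω =>
    WithLp.toLp 2 (fun j => W j (φ j n) ω - W j (ψ j n) ω) with hY
  have hcm : ∀ j n, Measurable (fun ω => W j (φ j n) ω - W j (ψ j n) ω) := fun j n =>
    (hW.measurable j _).sub (hW.measurable j _)
  have hYm : ∀ n, Measurable (Y n) := fun n =>
    (WithLp.measurable_toLp 2 (Fin d → ℝ)).comp (measurable_pi_lambda _ fun j => hcm j n)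
  have : IsProbabilityMeasure (P.map (fun ω => u t x ω - u s y ω)) :=
    Measure.isProbabilityMeasure_map ((hum t x).sub (hum s y)).aemeasurable
  have : IsProbabilityMeasure ((Measure.pi fun _ : Fin d => gaussianReal 0 V).map
      (WithLp.toLp 2 : (Fin d → ℝ) → EuclideanSpace ℝ (Fin d))) :=
    Measure.isProbabilityMeasure_map (WithLp.measurable_toLp 2 (Fin d → ℝ)).aemeasurable
  refine Measure.ext_of_charFun (funext fun θ => ?_)
  have hlim1 : Tendsto (fun n => charFun (P.map (Y n)) θ) atTop
      (𝓝 (charFun (P.map (fun ω => u t x ω - u s y ω)) θ)) := by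
    refine tendsto_charFun_of_eLpNorm hYm ((hum t x).sub (hum s y)) (fun j => ?_) θ
    have h0 := (hφ2 j).add (hψ2 j)
    rw [add_zero] at h0
    refine tendsto_of_tendsto_of_tendsto_of_le_of_le tendsto_const_nhds h0
      (fun n => zero_le) fun n => ?_
    have hc : ∀ t x, Measurable (fun ω => u t x ω j) := fun t x => by
      have := hum t x
      fun_prop
    refine le_trans (le_of_eq ?_) (eLpNorm_sub_le (p := 2)
      ((hW.measurable j (φ j n)).sub (hc t x)).aestronglyMeasurable
      ((hW.measurable j (ψ j n)).sub (hc s y)).aestronglyMeasurable (by norm_num))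
    congr 1
    funext ω
    simp only [hY, Pi.sub_apply, PiLp.sub_apply]
    ring
  -- The approximating test functions depend on the component `j`. Independence of the whole
  -- processes lets each component be evaluated at its own pair.
  have hind : ∀ n, iIndepFun (fun j ω => W j (φ j n) ω - W j (ψ j n) ω) P := fun n => by
    have := hW.indep.comp (fun j (w : Test N → ℝ) => w (φ j n) - w (ψ j n))
      (fun j => (measurable_pi_apply _).sub (measurable_pi_apply _))
    exact this
  have hchar : ∀ n, charFun (P.map (Y n)) θ = ∏ j, Complex.exp (-(((hpNormSq H h
      (fun s ξ => spatialFourier (φ j n) s ξ - spatialFourier (ψ j n) s ξ)).toReal : ℂ) *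
        (θ j : ℂ) ^ 2 / 2)) := fun n => by
    rw [(iIndepFun_iff_charFun_pi (fun j => (hcm j n).aemeasurable)).1 (hind n) θ]
    refine Finset.prod_congr rfl fun j _ => ?_
    rw [noise_sub_map_eq hH hH1 hβ hβN hfh hW j, charFun_gaussianReal]
    congr 1
    simp only [Complex.ofReal_zero, mul_zero, zero_mul, zero_sub]
    rfl
  have hlim2 : Tendsto (fun n => charFun (P.map (Y n)) θ) atTop
      (𝓝 (∏ j, Complex.exp (-(((hpNormSq H h
        (fun r ξ => gFourier t x r ξ - gFourier s y r ξ)).toReal : ℂ) * (θ j : ℂ) ^ 2 / 2)))) := by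
    simp_rw [hchar]
    refine tendsto_finsetProd _ fun j _ => ?_
    have h1 := tendsto_hpNormSq_sub hH hH1 hfh (gFourier_fieldAdmissible t x)
      (gFourier_fieldAdmissible s y) (fun n => spatialFourier_fieldAdmissible (φ j n))
      (fun n => spatialFourier_fieldAdmissible (ψ j n)) hfin (hφ1 j) (hψ1 j)
    have h2 := (ENNReal.tendsto_toReal hfin).comp h1
    have h3 := (Complex.continuous_ofReal.tendsto _).comp h2
    exact (Complex.continuous_exp.tendsto _).comp (((h3.mul_const _).div_const _).neg)
  rw [tendsto_nhds_unique hlim1 hlim2, charFun_pi]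
  refine Finset.prod_congr rfl fun j _ => ?_
  rw [charFun_gaussianReal]
  congr 1
  simp only [Complex.ofReal_zero, mul_zero, zero_mul, zero_sub]
  rfl

/-! ### Energy integrals of powers of the norm -/

section Energy

variable {E : Type*} [NormedAddCommGroup E] [NormedSpace ℝ E] [FiniteDimensional ℝ E]
  [MeasurableSpace E] [BorelSpace E] (μ : Measure E) [μ.IsAddHaarMeasure]

theorem integrableOn_ball_norm_rpow_iff [Nontrivial E] {p r : ℝ} (hr : 0 < r) :
    IntegrableOn (fun x : E => ‖x‖ ^ (-p)) (Metric.ball 0 r) μ ↔ p < Module.finrank ℝ E := by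
  have hE : 1 ≤ Module.finrank ℝ E := Module.finrank_pos
  rw [integrableOn_fun_norm_addHaar μ (f := fun y : ℝ => y ^ (-p)),
    integrableOn_congr_fun (g := fun y : ℝ => y ^ ((Module.finrank ℝ E : ℝ) - 1 - p)) _
      measurableSet_Ioo, intervalIntegral.integrableOn_Ioo_rpow_iff hr]
  · constructor <;> intro h <;> linarith
  · intro y hy
    simp only [smul_eq_mul]
    rw [← Real.rpow_natCast, ← Real.rpow_add hy.1]
    congr 1
    push_cast [hE]
    ring

theorem lintegral_ball_norm_rpow_lt_top_iff [Nontrivial E] {p r : ℝ} (hr : 0 < r) :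
    ∫⁻ x in Metric.ball (0 : E) r, ENNReal.ofReal (‖x‖ ^ (-p)) ∂μ < ∞ ↔
      p < Module.finrank ℝ E := by
  rw [← integrableOn_ball_norm_rpow_iff μ hr, IntegrableOn, lt_top_iff_ne_top]
  exact lintegral_ofReal_ne_top_iff_integrable
    (by fun_prop : Measurable fun x : E => ‖x‖ ^ (-p)).aestronglyMeasurable
    (ae_of_all _ fun x => by positivity)

theorem lintegral_ball_sub (F : E → ℝ≥0∞) (x : E) (r : ℝ) :
    ∫⁻ y in Metric.ball x r, F (x - y) ∂μ = ∫⁻ z in Metric.ball 0 r, F z ∂μ := by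
  rw [← lintegral_indicator measurableSet_ball, ← lintegral_indicator measurableSet_ball,
    ← lintegral_sub_left_eq_self ((Metric.ball 0 r).indicator F) x]
  refine lintegral_congr fun y => ?_
  by_cases h : y ∈ Metric.ball x r
  · rw [indicator_of_mem h, indicator_of_mem (by simpa [dist_eq_norm, norm_sub_rev] using h)]
  · rw [indicator_of_notMem h, indicator_of_notMem (by simpa [dist_eq_norm, norm_sub_rev] using h)]

/-- Seen from any of its points, `T` lies in one ball of fixed radius, so the inner integrals have a
common finite bound. -/
theorem lintegral_norm_sub_rpow_lt_top [Nontrivial E] {p : ℝ} (hp : p < Module.finrank ℝ E) {T : Set E}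
    (hT : Bornology.IsBounded T) :
    ∫⁻ x in T, ∫⁻ y in T, ENNReal.ofReal (‖x - y‖ ^ (-p)) ∂μ ∂μ < ∞ := by
  obtain ⟨R, hR0, hR⟩ := hT.subset_closedBall_lt 0 0
  have hfin := (lintegral_ball_norm_rpow_lt_top_iff μ (p := p) (show 0 < 2 * R + 1 by linarith)).2 hp
  have hTfin : μ T < ∞ := (measure_mono hR).trans_lt measure_closedBall_lt_top
  refine lt_of_le_of_lt ?_ (ENNReal.mul_lt_top hfin hTfin)
  rw [← setLIntegral_const]
  refine setLIntegral_mono measurable_const fun x hx => ?_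
  rw [← lintegral_ball_sub μ (fun z => ENNReal.ofReal (‖z‖ ^ (-p))) x]
  refine lintegral_mono_set fun y hy => ?_
  have h1 := mem_closedBall_zero_iff.1 (hR hx)
  have h2 := mem_closedBall_zero_iff.1 (hR hy)
  rw [Metric.mem_ball, dist_eq_norm]
  linarith [norm_sub_le y x]

/-- For `x` in a ball of half the radius, `T` contains a full ball around `x`, so the inner integral
is infinite on a set of positive measure. -/
theorem lintegral_norm_sub_rpow_eq_top [Nontrivial E] {p : ℝ} (hp : (Module.finrank ℝ E : ℝ) ≤ p) {T : Set E}
    (hT : (interior T).Nonempty) :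
    ∫⁻ x in T, ∫⁻ y in T, ENNReal.ofReal (‖x - y‖ ^ (-p)) ∂μ ∂μ = ∞ := by
  obtain ⟨x₀, hx₀⟩ := hT
  obtain ⟨r, hr, hball⟩ := Metric.isOpen_iff.1 isOpen_interior x₀ hx₀
  replace hball := hball.trans interior_subset
  have hinf : ∫⁻ x in Metric.ball (0 : E) (r / 2), ENNReal.ofReal (‖x‖ ^ (-p)) ∂μ = ∞ := by
    by_contra h
    exact absurd ((lintegral_ball_norm_rpow_lt_top_iff μ (half_pos hr)).1
      (lt_top_iff_ne_top.2 h)) (not_lt.2 hp)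
  rw [eq_top_iff]
  calc ∞ = ∞ * μ (Metric.ball x₀ (r / 2)) :=
        (ENNReal.top_mul (Metric.measure_ball_pos μ x₀ (half_pos hr)).ne').symm
    _ = ∫⁻ x in Metric.ball x₀ (r / 2), ∞ ∂μ := (setLIntegral_const _ _).symm
    _ ≤ ∫⁻ x in Metric.ball x₀ (r / 2), ∫⁻ y in T, ENNReal.ofReal (‖x - y‖ ^ (-p)) ∂μ ∂μ := by
        refine setLIntegral_mono' measurableSet_ball fun x hx => ?_
        rw [← hinf, ← lintegral_ball_sub μ (fun z => ENNReal.ofReal (‖z‖ ^ (-p))) x]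
        refine lintegral_mono_set fun y hy => hball ?_
        rw [Metric.mem_ball] at hx hy ⊢
        linarith [dist_triangle y x x₀]
    _ ≤ _ := lintegral_mono_set ((Metric.ball_subset_ball (by linarith)).trans hball)

end Energy

/-! ### Heat kernels -/

section Heat

open scoped NNReal

theorem lintegral_pi_prod {n : ℕ} (μ : Fin n → Measure ℝ) [∀ i, SigmaFinite (μ i)]
    {f : Fin n → ℝ → ℝ≥0∞} (hf : ∀ i, Measurable (f i)) :
    ∫⁻ x, ∏ i, f i (x i) ∂Measure.pi μ = ∏ i, ∫⁻ x, f i x ∂μ i := by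
  induction n with
  | zero => simp
  | succ n ih =>
    have e : ∫⁻ x, ∏ i, f i (x i) ∂Measure.pi μ = ∫⁻ x : ℝ × (Fin n → ℝ),
        f 0 x.1 * ∏ i : Fin n, f i.succ (x.2 i) ∂((μ 0).prod (Measure.pi fun i => μ i.succ)) := by
      rw [← ((measurePreserving_piFinSuccAbove μ 0).symm).lintegral_comp_emb
        (MeasurableEquiv.measurableEmbedding _)]
      simp_rw [MeasurableEquiv.piFinSuccAbove_symm_apply, Fin.insertNthEquiv,
        Fin.prod_univ_succ, Fin.insertNth_zero, Equiv.coe_fn_mk, Fin.cons_succ,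
        Fin.zero_succAbove, cast_eq, Fin.cons_zero]
    have hm : Measurable fun x : Fin n → ℝ => ∏ i : Fin n, f i.succ (x i) :=
      Finset.measurable_prod _ fun i _ => (hf i.succ).comp (measurable_pi_apply i)
    rw [e, lintegral_prod_mul (hf 0).aemeasurable hm.aemeasurable,
      ih (fun i => μ i.succ) fun i => hf i.succ, Fin.prod_univ_succ]

/-- The product of two Gaussian densities, by completion of the square. -/
theorem gaussianPDFReal_mul_gaussianPDFReal (a b : ℝ) {ε δ : ℝ≥0} (hε : ε ≠ 0) (hδ : δ ≠ 0)
    (x : ℝ) :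
    gaussianPDFReal a ε x * gaussianPDFReal b δ x = gaussianPDFReal a (ε + δ) b *
      gaussianPDFReal ((a * δ + b * ε) / (ε + δ)) (ε * δ / (ε + δ)) x := by
  have hε' : (0 : ℝ) < ε := by positivity
  have hδ' : (0 : ℝ) < δ := by positivity
  simp only [gaussianPDFReal, NNReal.coe_add, NNReal.coe_div, NNReal.coe_mul]
  rw [mul_mul_mul_comm, mul_mul_mul_comm (√(2 * Real.pi * (ε + δ)))⁻¹, ← Real.exp_add,
    ← Real.exp_add, ← mul_inv, ← mul_inv, ← Real.sqrt_mul (by positivity),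
    ← Real.sqrt_mul (by positivity)]
  congr 1
  · congr 2
    field_simp
  · congr 1
    field_simp
    ring

theorem lintegral_gaussianPDF_mul (a b : ℝ) {ε δ : ℝ≥0} (hε : ε ≠ 0) (hδ : δ ≠ 0) :
    ∫⁻ x, gaussianPDF a ε x * gaussianPDF b δ x = gaussianPDF a (ε + δ) b := by
  have e : ∀ x, gaussianPDF a ε x * gaussianPDF b δ x = gaussianPDF a (ε + δ) b *
      gaussianPDF ((a * δ + b * ε) / (ε + δ)) (ε * δ / (ε + δ)) x := fun x => by
    simp only [gaussianPDF]
    rw [← ENNReal.ofReal_mul (gaussianPDFReal_nonneg _ _ _),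
      ← ENNReal.ofReal_mul (gaussianPDFReal_nonneg _ _ _),
      gaussianPDFReal_mul_gaussianPDFReal a b hε hδ]
  simp_rw [e]
  rw [lintegral_const_mul _ (measurable_gaussianPDF _ _), lintegral_gaussianPDF_eq_one _
    (by positivity), mul_one]

/-- The degenerate case `δ = 0`, a Dirac mass, is included because increments of the field vanish on
the diagonal. -/
theorem lintegral_gaussianPDF_gaussianReal {ε : ℝ≥0} (hε : ε ≠ 0) (δ : ℝ≥0) :
    ∫⁻ x, gaussianPDF 0 ε x ∂gaussianReal 0 δ = gaussianPDF 0 (ε + δ) 0 := by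
  by_cases hδ : δ = 0
  · rw [hδ, gaussianReal_zero_var, lintegral_dirac' _ (measurable_gaussianPDF _ _), add_zero]
  · rw [gaussianReal_of_var_ne_zero _ hδ, lintegral_withDensity_eq_lintegral_mul _
      (measurable_gaussianPDF _ _) (measurable_gaussianPDF _ _), ← lintegral_gaussianPDF_mul 0 0 hε hδ]
    simp only [Pi.mul_apply, mul_comm]

variable {d : ℕ}

/-- The density at `v` of the Gaussian law on `ℝ^d` with mean `a` and covariance matrix `ε I`. -/
def heat (ε : ℝ≥0) (a v : Space d) : ℝ≥0∞ := ∏ j, gaussianPDF (a j) ε (v j)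

/-- The Gaussian law on `ℝ^d` with mean `a` and covariance matrix `ε I`. -/
def gaussN (ε : ℝ≥0) (a : Space d) : Measure (Space d) :=
  (Measure.pi fun j => gaussianReal (a j) ε).map (WithLp.toLp 2)

theorem heat_eq_sub (ε : ℝ≥0) (a v : Space d) : heat ε a v = heat ε 0 (v - a) := by
  refine Finset.prod_congr rfl fun j _ => ?_
  simp [gaussianPDF, gaussianPDFReal]

theorem heat_comm (ε : ℝ≥0) (a v : Space d) : heat ε a v = heat ε v a := by
  refine Finset.prod_congr rfl fun j _ => ?_
  simp only [gaussianPDF, gaussianPDFReal]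
  rw [sub_sq_comm]

theorem measurable_heat (ε : ℝ≥0) : Measurable fun p : Space d × Space d => heat ε p.1 p.2 := by
  refine Finset.measurable_prod _ fun j _ => ?_
  have h1 : Measurable fun p : Space d × Space d => (p.1 j, ε, p.2 j) := by fun_prop
  exact measurable_uncurry_gaussianPDF.comp h1

theorem measurable_heat_right (ε : ℝ≥0) (a : Space d) : Measurable (heat ε a) := by
  unfold heat
  exact Finset.measurable_prod _ fun j _ => (measurable_gaussianPDF _ _).comp (by fun_prop)

theorem heat_zero_zero (ε : ℝ≥0) :
    heat ε (0 : Space d) 0 = ENNReal.ofReal ((√(2 * Real.pi * ε))⁻¹ ^ d) := by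
  rw [ENNReal.ofReal_pow (by positivity)]
  simp only [heat, gaussianPDF, gaussianPDFReal]
  simp

theorem heat_le (ε : ℝ≥0) (a v : Space d) : heat ε a v ≤ heat ε (0 : Space d) 0 := by
  refine Finset.prod_le_prod' fun j _ => ENNReal.ofReal_le_ofReal ?_
  simp only [gaussianPDFReal]
  refine mul_le_mul_of_nonneg_left (Real.exp_le_exp.2 ?_) (by positivity)
  simp only [PiLp.zero_apply, sub_self]
  rw [zero_pow (by norm_num), neg_zero, zero_div]
  exact div_nonpos_of_nonpos_of_nonneg (by simp [sq_nonneg]) (by positivity)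

theorem heat_lt_top (ε : ℝ≥0) (a v : Space d) : heat ε a v < ∞ :=
  (heat_le ε a v).trans_lt (by rw [heat_zero_zero]; exact ENNReal.ofReal_lt_top)

theorem heat_zero_zero_anti {ε δ : ℝ≥0} (hε : ε ≠ 0) (h : ε ≤ δ) :
    heat δ (0 : Space d) 0 ≤ heat ε (0 : Space d) 0 := by
  rw [heat_zero_zero, heat_zero_zero]
  have : (0 : ℝ) < ε := by positivity
  gcongr

theorem lintegral_space_prod {f : Fin d → ℝ → ℝ≥0∞} (hf : ∀ j, Measurable (f j)) :
    ∫⁻ v : Space d, ∏ j, f j (v j) = ∏ j, ∫⁻ x, f j x := by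
  rw [← lintegral_pi_prod (fun _ => volume) hf, ← volume_pi,
    ← (PiLp.volume_preserving_toLp (Fin d)).lintegral_comp]
  exact Finset.measurable_prod _ fun j _ => (hf j).comp (by fun_prop)

theorem lintegral_heat_mul_heat {ε δ : ℝ≥0} (hε : ε ≠ 0) (hδ : δ ≠ 0) (a b : Space d) :
    ∫⁻ v, heat ε a v * heat δ b v = heat (ε + δ) a b := by
  simp only [heat, ← Finset.prod_mul_distrib]
  rw [lintegral_space_prod (f := fun j x => gaussianPDF (a j) ε x * gaussianPDF (b j) δ x)
    fun j => (measurable_gaussianPDF _ _).mul (measurable_gaussianPDF _ _)]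
  exact Finset.prod_congr rfl fun j _ => lintegral_gaussianPDF_mul _ _ hε hδ

theorem lintegral_heat {ε : ℝ≥0} (hε : ε ≠ 0) (a : Space d) : ∫⁻ v, heat ε a v = 1 := by
  simp only [heat]
  rw [lintegral_space_prod (f := fun j x => gaussianPDF (a j) ε x)
    fun j => measurable_gaussianPDF _ _]
  exact Finset.prod_eq_one fun j _ => lintegral_gaussianPDF_eq_one _ hε

theorem lintegral_heat_gaussN {ε : ℝ≥0} (hε : ε ≠ 0) (δ : ℝ≥0) :
    ∫⁻ v, heat ε (0 : Space d) v ∂gaussN δ (0 : Space d) = heat (ε + δ) (0 : Space d) 0 := by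
  rw [gaussN, lintegral_map (measurable_heat_right ε 0) (by fun_prop)]
  simp only [heat, PiLp.zero_apply]
  rw [lintegral_pi_prod (f := fun j x => gaussianPDF 0 ε x) _ fun j => measurable_gaussianPDF _ _]
  exact Finset.prod_congr rfl fun j _ => lintegral_gaussianPDF_gaussianReal hε δ

theorem gaussN_eq_withDensity {ε : ℝ≥0} (hε : ε ≠ 0) (a : Space d) :
    gaussN ε a = volume.withDensity (heat ε a) := by
  have h1 : (Measure.pi fun j => gaussianReal (a j) ε) =
      (volume : Measure (Fin d → ℝ)).withDensity fun x => ∏ j, gaussianPDF (a j) ε (x j) := by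
    refine Measure.pi_eq fun s hs => ?_
    rw [withDensity_apply _ (MeasurableSet.univ_pi hs), volume_pi, Measure.restrict_pi_pi,
      lintegral_pi_prod (f := fun j x => gaussianPDF (a j) ε x) _
        fun j => measurable_gaussianPDF _ _]
    refine Finset.prod_congr rfl fun j _ => ?_
    rw [gaussianReal_apply _ hε]
  ext s hs
  have hpre := (WithLp.measurable_toLp 2 (Fin d → ℝ)) hs
  rw [gaussN, Measure.map_apply (by fun_prop) hs, h1, withDensity_apply _ hs,
    withDensity_apply _ hpre,
    ← (PiLp.volume_preserving_toLp (Fin d)).setLIntegral_comp_preimage hs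
      (measurable_heat_right ε a)]
  rfl

instance (ε : ℝ≥0) (a : Space d) : IsProbabilityMeasure (gaussN ε a) :=
  Measure.isProbabilityMeasure_map (by fun_prop)

theorem gaussN_eq_map (ε : ℝ≥0) (a : Space d) :
    gaussN ε a = (gaussN 1 (0 : Space d)).map fun w => a + √(ε : ℝ) • w := by
  have h1 : (Measure.pi fun j => gaussianReal (a j) ε) =
      (Measure.pi fun _ : Fin d => gaussianReal 0 1).map fun x j => a j + √(ε : ℝ) * x j := by
    rw [Measure.pi_map_pi (f := fun j (x : ℝ) => a j + √(ε : ℝ) * x) fun j => by fun_prop]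
    congr 1
    funext j
    have h2 : (fun x => a j + √(ε : ℝ) * x) = (fun x => a j + x) ∘ fun x => √(ε : ℝ) * x := rfl
    rw [h2, ← Measure.map_map (by fun_prop) (by fun_prop), gaussianReal_map_const_mul,
      gaussianReal_map_const_add]
    congr 1
    · simp
    · ext
      simp
  rw [gaussN, gaussN, h1, Measure.map_map (by fun_prop) (by fun_prop),
    Measure.map_map (by fun_prop) (by fun_prop)]
  rfl

/-- Writing every Gaussian as an affine image of the standard one moves `ε` into the integrand,
where dominated convergence applies. -/
theorem tendsto_integral_gaussN {φ : Space d → ℝ} (hφ : Continuous φ) {M : ℝ}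
    (hM : ∀ x, ‖φ x‖ ≤ M) {ε : ℕ → ℝ≥0} (hε : Tendsto ε atTop (𝓝 0)) (a : Space d) :
    Tendsto (fun n => ∫ v, φ v ∂gaussN (ε n) a) atTop (𝓝 (φ a)) := by
  have e : ∀ n, ∫ v, φ v ∂gaussN (ε n) a =
      ∫ w, φ (a + √(ε n : ℝ) • w) ∂gaussN 1 (0 : Space d) := fun n => by
    rw [gaussN_eq_map, integral_map (by fun_prop) hφ.aestronglyMeasurable]
  simp_rw [e]
  have hlim : ∫ _ : Space d, φ a ∂gaussN 1 (0 : Space d) = φ a := by simp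
  rw [← hlim]
  refine tendsto_integral_of_dominated_convergence (fun _ => M) (fun n => ?_)
    (integrable_const _) (fun n => ae_of_all _ fun w => hM _) (ae_of_all _ fun w => ?_)
  · exact (by fun_prop : Continuous fun w : Space d => φ (a + √(ε n : ℝ) • w)).aestronglyMeasurable
  · have h1 : Tendsto (fun n => a + √(ε n : ℝ) • w) atTop (𝓝 (a + √((0 : ℝ≥0) : ℝ) • w)) :=
      tendsto_const_nhds.add (((Real.continuous_sqrt.tendsto _).comp
        ((NNReal.continuous_coe.tendsto 0).comp hε)).smul_const w)
    simp only [NNReal.coe_zero, Real.sqrt_zero, zero_smul, add_zero] at h1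
    exact (hφ.tendsto a).comp h1

end Heat

/-! ### Mollified occupation densities -/

section Occupation

open scoped NNReal

variable {d : ℕ} {Z Ω : Type*} [MeasurableSpace Z] [MeasurableSpace Ω]

/-- The occupation measure of `X` under `μ`, mollified by the heat kernel at time `ε`. -/
def mollifiedOccupation (μ : Measure Z) (X : Z → Ω → Space d) (ε : ℝ≥0) (v : Space d) (ω : Ω) :
    ℝ≥0∞ :=
  ∫⁻ z, heat ε (X z ω) v ∂μ

/-- The expected double integral of the heat kernel at time `η` along the field `X`. -/
def heatEnergy (μ : Measure Z) (P : Measure Ω) (X : Z → Ω → Space d) (η : ℝ≥0) : ℝ≥0∞ :=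
  ∫⁻ ω, ∫⁻ z, ∫⁻ w, heat η (X z ω) (X w ω) ∂μ ∂μ ∂P

variable {μ : Measure Z} [IsFiniteMeasure μ] {P : Measure Ω} [IsProbabilityMeasure P]
  {X : Z → Ω → Space d}

theorem measurable_heat_comp {A : Type*} [MeasurableSpace A] (ε : ℝ≥0) {f g : A → Space d}
    (hf : Measurable f) (hg : Measurable g) : Measurable fun x => heat ε (f x) (g x) := by
  unfold heat
  refine Finset.measurable_prod _ fun j _ => ?_
  have h1 : Measurable fun x => (f x j, ε, g x j) := by fun_prop
  exact measurable_uncurry_gaussianPDF.comp h1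

theorem measurable_section (hX : Measurable (Function.uncurry X)) (ω : Ω) :
    Measurable fun z => X z ω :=
  hX.comp measurable_prodMk_right

theorem measurable_mollifiedOccupation (hX : Measurable (Function.uncurry X)) (ε : ℝ≥0) :
    Measurable fun p : Space d × Ω => mollifiedOccupation μ X ε p.1 p.2 := by
  have h : Measurable fun q : (Space d × Ω) × Z => heat ε (X q.2 q.1.2) q.1.1 :=
    measurable_heat_comp ε (hX.comp (by fun_prop : Measurable fun q : (Space d × Ω) × Z =>
      (q.2, q.1.2))) (by fun_prop)
  exact h.lintegral_prod_right'

theorem mollifiedOccupation_le (ε : ℝ≥0) (v : Space d) (ω : Ω) :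
    mollifiedOccupation μ X ε v ω ≤ heat ε (0 : Space d) 0 * μ univ := by
  rw [← lintegral_const]
  exact lintegral_mono fun z => heat_le ε _ _

theorem mollifiedOccupation_lt_top (ε : ℝ≥0) (v : Space d) (ω : Ω) :
    mollifiedOccupation μ X ε v ω < ∞ :=
  (mollifiedOccupation_le ε v ω).trans_lt
    (ENNReal.mul_lt_top (heat_lt_top ε _ _) (measure_lt_top μ _))

/-- The semigroup law `∫ p_ε(a,v) p_δ(b,v) dv = p_{ε+δ}(a,b)`. All `L²` inner products of mollified
densities are thus values of one function of `ε + δ`. -/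
theorem lintegral_mollifiedOccupation_mul (hX : Measurable (Function.uncurry X)) {ε δ : ℝ≥0}
    (hε : ε ≠ 0) (hδ : δ ≠ 0) :
    ∫⁻ p : Space d × Ω, mollifiedOccupation μ X ε p.1 p.2 * mollifiedOccupation μ X δ p.1 p.2
      ∂(volume.prod P) = heatEnergy μ P X (ε + δ) := by
  have hprod : Measurable fun p : Space d × Ω =>
      mollifiedOccupation μ X ε p.1 p.2 * mollifiedOccupation μ X δ p.1 p.2 :=
    (measurable_mollifiedOccupation hX ε).mul (measurable_mollifiedOccupation hX δ)
  rw [lintegral_prod_symm' _ hprod]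
  refine lintegral_congr fun ω => ?_
  have hXω := measurable_section hX ω
  unfold mollifiedOccupation
  have h1 : ∀ v, (∫⁻ z, heat ε (X z ω) v ∂μ) * (∫⁻ z, heat δ (X z ω) v ∂μ) =
      ∫⁻ z, ∫⁻ w, heat ε (X z ω) v * heat δ (X w ω) v ∂μ ∂μ := fun v => by
    rw [lintegral_lintegral_mul
      (measurable_heat_comp ε hXω measurable_const).aemeasurable
      (measurable_heat_comp δ hXω measurable_const).aemeasurable]
  simp_rw [h1]
  have hm : Measurable fun q : (Space d × Z) × Z =>
      heat ε (X q.1.2 ω) q.1.1 * heat δ (X q.2 ω) q.1.1 :=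
    (measurable_heat_comp ε (hXω.comp (by fun_prop)) (by fun_prop)).mul
      (measurable_heat_comp δ (hXω.comp (by fun_prop)) (by fun_prop))
  rw [lintegral_lintegral_swap hm.lintegral_prod_right'.aemeasurable]
  refine lintegral_congr fun z => ?_
  rw [lintegral_lintegral_swap]
  · exact lintegral_congr fun w => lintegral_heat_mul_heat hε hδ _ _
  · exact (hm.comp (by fun_prop : Measurable fun q : Space d × Z => ((q.1, z), q.2))).aemeasurable

theorem heatEnergy_eq (hX : Measurable (Function.uncurry X)) (η : ℝ≥0) :
    heatEnergy μ P X η = ∫⁻ z, ∫⁻ w, ∫⁻ ω, heat η (X z ω) (X w ω) ∂P ∂μ ∂μ := by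
  unfold heatEnergy
  have hm : Measurable fun q : (Ω × Z) × Z => heat η (X q.1.2 q.1.1) (X q.2 q.1.1) :=
    measurable_heat_comp η
      (hX.comp (by fun_prop : Measurable fun q : (Ω × Z) × Z => (q.1.2, q.1.1)))
      (hX.comp (by fun_prop : Measurable fun q : (Ω × Z) × Z => (q.2, q.1.1)))
  rw [lintegral_lintegral_swap hm.lintegral_prod_right'.aemeasurable]
  refine lintegral_congr fun z => ?_
  rw [lintegral_lintegral_swap]
  exact (hm.comp (by fun_prop : Measurable fun q : Ω × Z => ((q.1, z), q.2))).aemeasurable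

/-- Adding an independent Gaussian of variance `η` adds variances, and the expected heat kernel is
the density of the sum at the origin. -/
theorem lintegral_heat_of_map_eq (hX : Measurable (Function.uncurry X)) {z w : Z} {V : ℝ≥0}
    (h : P.map (fun ω => X z ω - X w ω) = gaussN V 0) {η : ℝ≥0} (hη : η ≠ 0) :
    ∫⁻ ω, heat η (X z ω) (X w ω) ∂P = heat (η + V) (0 : Space d) 0 := by
  have hz : ∀ z, Measurable (X z) := fun z => hX.comp measurable_prodMk_left
  have hzw : Measurable fun ω => X z ω - X w ω := (hz z).sub (hz w)
  rw [← lintegral_heat_gaussN hη V, ← h, lintegral_map (measurable_heat_right η 0) hzw]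
  exact lintegral_congr fun ω => by rw [heat_comm, heat_eq_sub]

/-- The energy of an absolutely continuous measure is at most the squared norm of its density. -/
theorem lintegral_heat_withDensity_le {ℓ : Space d → ℝ≥0∞} (hℓ : Measurable ℓ) {η : ℝ≥0}
    (hη : η ≠ 0) :
    ∫⁻ a, ∫⁻ b, heat η a b ∂volume.withDensity ℓ ∂volume.withDensity ℓ ≤ ∫⁻ a, ℓ a ^ 2 := by
  have hh := measurable_heat (d := d) η
  have h1 : ∀ a, ∫⁻ b, heat η a b ∂volume.withDensity ℓ = ∫⁻ b, ℓ b * heat η a b := fun a => by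
    rw [lintegral_withDensity_eq_lintegral_mul _ hℓ (measurable_heat_right η a)]
    rfl
  have hm : Measurable fun p : Space d × Space d => ℓ p.2 * heat η p.1 p.2 :=
    (hℓ.comp measurable_snd).mul hh
  simp_rw [h1]
  rw [lintegral_withDensity_eq_lintegral_mul _ hℓ hm.lintegral_prod_right']
  -- The Schur test: after this inequality each half involves only one value of `ℓ`, and the
  -- symmetric kernel has total mass 1 in either variable.
  have hsum : ∀ x y : ℝ≥0∞, x * y ≤ 2⁻¹ * x ^ 2 + 2⁻¹ * y ^ 2 := fun x y => by
    rcases eq_or_ne x ∞ with rfl | hx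
    · simp
    rcases eq_or_ne y ∞ with rfl | hy
    · simp
    lift x to ℝ≥0 using hx
    lift y to ℝ≥0 using hy
    have : x * y ≤ 2⁻¹ * x ^ 2 + 2⁻¹ * y ^ 2 := by
      rw [← NNReal.coe_le_coe]
      push_cast
      nlinarith [sq_nonneg ((x : ℝ) - y)]
    have h2 : ((2 : ℝ≥0∞)⁻¹) = (((2 : ℝ≥0)⁻¹ : ℝ≥0) : ℝ≥0∞) := by simp
    rw [h2]
    exact_mod_cast this
  calc ∫⁻ a, ℓ a * ∫⁻ b, ℓ b * heat η a b = ∫⁻ a, ∫⁻ b, ℓ a * ℓ b * heat η a b := by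
        refine lintegral_congr fun a => ?_
        have hma : Measurable fun b => ℓ b * heat η a b := hℓ.mul (measurable_heat_right η a)
        rw [← lintegral_const_mul _ hma]
        simp only [mul_assoc]
    _ ≤ ∫⁻ a, ∫⁻ b, (2⁻¹ * ℓ a ^ 2 * heat η a b + 2⁻¹ * ℓ b ^ 2 * heat η a b) := by
        refine lintegral_mono fun a => lintegral_mono fun b => ?_
        simp only
        rw [← add_mul]
        gcongr
        exact hsum _ _
    _ = (∫⁻ a, ∫⁻ b, 2⁻¹ * ℓ a ^ 2 * heat η a b) + ∫⁻ a, ∫⁻ b, 2⁻¹ * ℓ b ^ 2 * heat η a b := by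
        have hm1 : Measurable fun p : Space d × Space d => 2⁻¹ * ℓ p.1 ^ 2 * heat η p.1 p.2 :=
          (((hℓ.comp measurable_fst).pow_const 2).const_mul _).mul hh
        rw [← lintegral_add_left hm1.lintegral_prod_right']
        refine lintegral_congr fun a => ?_
        have hma : Measurable fun b => 2⁻¹ * ℓ a ^ 2 * heat η a b :=
          (measurable_heat_right η a).const_mul _
        rw [lintegral_add_left hma]
    _ = 2⁻¹ * (∫⁻ a, ℓ a ^ 2) + 2⁻¹ * ∫⁻ a, ℓ a ^ 2 := by
        have hm2 : Measurable fun p : Space d × Space d => 2⁻¹ * ℓ p.2 ^ 2 * heat η p.1 p.2 :=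
          (((hℓ.comp measurable_snd).pow_const 2).const_mul _).mul hh
        have key : ∀ a, ∫⁻ b, 2⁻¹ * ℓ a ^ 2 * heat η a b = 2⁻¹ * ℓ a ^ 2 := fun a => by
          rw [lintegral_const_mul _ (measurable_heat_right η a), lintegral_heat hη, mul_one]
        congr 1
        · simp_rw [key]
          rw [lintegral_const_mul _ (hℓ.pow_const 2)]
        · rw [lintegral_lintegral_swap hm2.aemeasurable]
          simp_rw [fun a b => heat_comm η a b, key]
          rw [lintegral_const_mul _ (hℓ.pow_const 2)]
    _ = ∫⁻ a, ℓ a ^ 2 := by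
        rw [← add_mul, ENNReal.inv_two_add_inv_two, one_mul]

end Occupation

/-! ### From bounded heat energies to local times and back. -/

section LocalTime

open scoped NNReal

theorem exists_subseq_tendsto_ae_zero {A : Type*} [MeasurableSpace A] {μ : Measure A}
    {f : ℕ → A → ℝ≥0∞} (hf : ∀ n, Measurable (f n))
    (h : Tendsto (fun n => ∫⁻ x, f n x ∂μ) atTop (𝓝 0)) :
    ∃ ns : ℕ → ℕ, StrictMono ns ∧ ∀ᵐ x ∂μ, Tendsto (fun n => f (ns n) x) atTop (𝓝 0) := by
  obtain ⟨ns, hns, hle⟩ := extraction_forall_of_eventually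
    (P := fun n k => ∫⁻ x, f k x ∂μ ≤ 2⁻¹ ^ n)
    fun n => h.eventually_le_const (ENNReal.pow_pos (by simp) n)
  refine ⟨ns, hns, ?_⟩
  have hsum : ∫⁻ x, ∑' n, f (ns n) x ∂μ ≠ ∞ := by
    rw [lintegral_tsum fun n => (hf _).aemeasurable]
    refine ne_top_of_le_ne_top ?_ (ENNReal.tsum_le_tsum hle)
    rw [ENNReal.tsum_geometric]
    simp
  filter_upwards [ae_lt_top (Measurable.tsum fun n => hf _) hsum] with x hx
  exact ENNReal.tendsto_atTop_zero_of_tsum_ne_top hx.ne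

variable {d : ℕ}

/-- If the mollified occupation densities of `x` converge in `L²`, the occupation measure is
absolutely continuous, with the limit as its density. -/
theorem map_eq_withDensity_of_tendsto {Z : Type*} [MeasurableSpace Z] {μ : Measure Z}
    [IsFiniteMeasure μ] {x : Z → Space d} (hx : Measurable x) {ℓ : Space d → ℝ}
    (hℓ : Measurable ℓ) (hℓ0 : ∀ v, 0 ≤ ℓ v) (hℓ2 : MemLp ℓ 2 volume) {ε : ℕ → ℝ≥0}
    (hε : ∀ n, ε n ≠ 0) (hε0 : Tendsto ε atTop (𝓝 0))
    (hlim : Tendsto (fun n => ∫⁻ v, ‖(∫⁻ z, heat (ε n) (x z) v ∂μ).toReal - ℓ v‖ₑ ^ 2)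
      atTop (𝓝 0)) :
    μ.map x = volume.withDensity fun v => ENNReal.ofReal (ℓ v) := by
  -- Comparing the measures on compactly supported functions requires finiteness on compacts; here
  -- it comes from `L² ⊂ L¹` on sets of finite measure.
  have hloc : IsLocallyFiniteMeasure
      ((volume : Measure (Space d)).withDensity fun v => ENNReal.ofReal (ℓ v)) := by
    have hc : IsFiniteMeasureOnCompacts
        ((volume : Measure (Space d)).withDensity fun v => ENNReal.ofReal (ℓ v)) := by
      refine ⟨fun K hK => ?_⟩
      rw [withDensity_apply _ hK.measurableSet]
      have : IsFiniteMeasure ((volume : Measure (Space d)).restrict K) :=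
        ⟨by simpa using hK.measure_lt_top⟩
      have hi : Integrable ℓ ((volume : Measure (Space d)).restrict K) :=
        (hℓ2.restrict K).integrable (by norm_num)
      exact hi.lintegral_lt_top
    infer_instance
  have hfin : IsFiniteMeasure (μ.map x) := Measure.isFiniteMeasure_map μ x
  refine Measure.ext_of_integral_eq_on_compactlySupported fun φ => ?_
  have hφc : Continuous φ := φ.continuous
  obtain ⟨M, hM⟩ : ∃ M, ∀ v, ‖φ v‖ ≤ M :=
    φ.hasCompactSupport.exists_bound_of_continuous hφc
  have hGi : ∀ n, Integrable (fun p : Space d × Z => (heat (ε n) (x p.2) p.1).toReal)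
      (volume.prod μ) := fun n => by
    have hm : Measurable fun p : Space d × Z => heat (ε n) (x p.2) p.1 :=
      measurable_heat_comp _ (hx.comp measurable_snd) measurable_fst
    refine integrable_toReal_of_lintegral_ne_top hm.aemeasurable ?_
    rw [lintegral_prod_symm' _ hm]
    simp only [lintegral_heat (hε n)]
    simp
  have hφG : ∀ n, Integrable (fun p : Space d × Z => φ p.1 * (heat (ε n) (x p.2) p.1).toReal)
      (volume.prod μ) := fun n =>
    (hGi n).bdd_mul (c := M) (hφc.measurable.comp measurable_fst).aestronglyMeasurable
      (ae_of_all _ fun p => hM _)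
  have hGeq : ∀ n v, (∫⁻ z, heat (ε n) (x z) v ∂μ).toReal =
      ∫ z, (heat (ε n) (x z) v).toReal ∂μ := fun n v =>
    (integral_toReal (measurable_heat_comp _ hx measurable_const).aemeasurable
      (ae_of_all _ fun z => heat_lt_top _ _ _)).symm
  have hinner : ∀ n z, ∫ v, φ v * (heat (ε n) (x z) v).toReal = ∫ v, φ v ∂gaussN (ε n) (x z) :=
    fun n z => by
      rw [gaussN_eq_withDensity (hε n), integral_withDensity_eq_integral_toReal_smul
        (measurable_heat_right _ _) (ae_of_all _ fun v => heat_lt_top _ _ _)]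
      simp only [smul_eq_mul, mul_comm]
  have hswap : ∀ n, ∫ v, φ v * (∫⁻ z, heat (ε n) (x z) v ∂μ).toReal =
      ∫ z, ∫ v, φ v ∂gaussN (ε n) (x z) ∂μ := fun n => by
    simp_rw [hGeq, ← integral_const_mul]
    rw [integral_integral_swap (hφG n)]
    simp_rw [hinner]
  have hlim1 : Tendsto (fun n => ∫ v, φ v * (∫⁻ z, heat (ε n) (x z) v ∂μ).toReal) atTop
      (𝓝 (∫ v, φ v ∂μ.map x)) := by
    rw [integral_map hx.aemeasurable hφc.aestronglyMeasurable]
    simp_rw [hswap]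
    refine tendsto_integral_of_dominated_convergence (fun _ => M) (fun n => ?_)
      (integrable_const M) (fun n => ae_of_all _ fun z => ?_)
      (ae_of_all _ fun z => tendsto_integral_gaussN hφc hM hε0 (x z))
    · simp_rw [← hinner]
      exact (hφG n).swap.integral_prod_left.aestronglyMeasurable
    · refine (norm_integral_le_of_norm_le_const (ae_of_all _ hM)).trans (le_of_eq ?_)
      simp
  have hφ2 : MemLp φ 2 volume := hφc.memLp_of_hasCompactSupport φ.hasCompactSupport
  have hlim2 : Tendsto (fun n => ∫ v, φ v * (∫⁻ z, heat (ε n) (x z) v ∂μ).toReal) atTop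
      (𝓝 (∫ v, φ v * ℓ v)) := by
    refine tendsto_integral_of_L1' _ (hφ2.integrable_mul hℓ2).aestronglyMeasurable
      (Eventually.of_forall fun n => ?_) ?_
    · simp_rw [hGeq, ← integral_const_mul]
      exact (hφG n).integral_prod_left
    · have h2 : Tendsto (fun n => eLpNorm
          (fun v => (∫⁻ z, heat (ε n) (x z) v ∂μ).toReal - ℓ v) 2 volume) atTop (𝓝 0) :=
        tendsto_zero_of_tendsto_sq (by simpa only [eLpNorm_two_sq] using hlim)
      have h3 := ENNReal.Tendsto.const_mul h2 (Or.inr hφ2.eLpNorm_ne_top)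
      rw [mul_zero] at h3
      refine tendsto_of_tendsto_of_tendsto_of_le_of_le tendsto_const_nhds h3
        (fun n => zero_le) fun n => ?_
      have hGm : Measurable fun v => (∫⁻ z, heat (ε n) (x z) v ∂μ).toReal := by
        have hm : Measurable fun p : Space d × Z => heat (ε n) (x p.2) p.1 :=
          measurable_heat_comp _ (hx.comp measurable_snd) measurable_fst
        exact hm.lintegral_prod_right'.ennreal_toReal
      have h4 := eLpNorm_smul_le_mul_eLpNorm (p := 2) (q := 2) (r := 1)
        (hGm.sub hℓ).aestronglyMeasurable hφc.aestronglyMeasurable (μ := volume)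
      refine le_trans (le_of_eq ?_) h4
      rw [eLpNorm_one_eq_lintegral_enorm, eLpNorm_one_eq_lintegral_enorm]
      refine lintegral_congr fun v => ?_
      simp only [Pi.smul_apply', Pi.sub_apply, Pi.mul_apply, smul_eq_mul, mul_sub]
  rw [tendsto_nhds_unique hlim1 hlim2, integral_withDensity_eq_integral_toReal_smul
    hℓ.ennreal_ofReal (ae_of_all _ fun v => ENNReal.ofReal_lt_top)]
  refine integral_congr_ae (ae_of_all _ fun v => ?_)
  simp only [ENNReal.toReal_ofReal (hℓ0 v), smul_eq_mul, mul_comm]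

variable {Z Ω : Type*} [MeasureSpace Z] [MeasurableSpace Ω] {P : Measure Ω}
  [IsProbabilityMeasure P] {X : Z → Ω → Space d} {T : Set Z}

theorem map_restrict_eq_withDensity_iff {x : Z → Space d} (hx : Measurable x)
    {ℓ : Space d → ℝ≥0∞} :
    ((volume : Measure Z).restrict T).map x = volume.withDensity ℓ ↔
      ∀ B, MeasurableSet B → volume {z | z ∈ T ∧ x z ∈ B} = ∫⁻ v in B, ℓ v := by
  rw [Measure.ext_iff]
  refine forall₂_congr fun B hB => ?_
  rw [Measure.map_apply hx hB, Measure.restrict_apply (hx hB), withDensity_apply _ hB,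
    inter_comm]
  rfl

variable [IsFiniteMeasure ((volume : Measure Z).restrict T)]

/-- The existence of a local time bounds the energies of the heat kernels. -/
theorem heatEnergy_le_of_isLocalTime (hX : Measurable (Function.uncurry X)) {L : Space d → Ω → ℝ}
    (hL : IsLocalTime P X T L)
    (hL2 : MemLp (fun p : Space d × Ω => L p.1 p.2) 2 (volume.prod P)) {η : ℝ≥0} (hη : η ≠ 0) :
    heatEnergy (volume.restrict T) P X η ≤
      eLpNorm (fun p : Space d × Ω => L p.1 p.2) 2 (volume.prod P) ^ 2 := by
  -- `L` is measurable only up to a product-null set. By Fubini, for almost every `ω` its section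
  -- agrees almost everywhere with that of `L'`, which defines the same measure.
  obtain ⟨L', hL'm, hL'⟩ := hL2.aestronglyMeasurable
  have hswap : ∀ᵐ q ∂P.prod (volume : Measure (Space d)), L q.2 q.1 = L' (q.2, q.1) :=
    (Measure.measurePreserving_swap (μ := P)
      (ν := (volume : Measure (Space d)))).quasiMeasurePreserving.ae hL'
  rw [eLpNorm_congr_ae hL', eLpNorm_two_sq,
    lintegral_prod_symm' _ (hL'm.measurable.enorm.pow_const 2)]
  refine lintegral_mono_ae ?_
  filter_upwards [hL.2, Measure.ae_ae_of_ae_prod hswap] with ω hω hae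
  have hXω := measurable_section hX ω
  have hm : Measurable fun v => ENNReal.ofReal (L' (v, ω)) :=
    (hL'm.measurable.comp measurable_prodMk_right).ennreal_ofReal
  have hκ : ((volume : Measure Z).restrict T).map (fun z => X z ω) =
      volume.withDensity fun v => ENNReal.ofReal (L' (v, ω)) := by
    rw [(map_restrict_eq_withDensity_iff hXω).2 hω]
    refine withDensity_congr_ae ?_
    filter_upwards [hae] with v hv
    rw [hv]
  calc ∫⁻ z in T, ∫⁻ w in T, heat η (X z ω) (X w ω)
      = ∫⁻ a, ∫⁻ b, heat η a b ∂((volume : Measure Z).restrict T).map (fun z => X z ω)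
          ∂((volume : Measure Z).restrict T).map (fun z => X z ω) := by
        have hm2 := (measurable_heat (d := d) η).lintegral_prod_right'
          (ν := ((volume : Measure Z).restrict T).map (fun z => X z ω))
        rw [lintegral_map hm2 hXω]
        refine lintegral_congr fun z => ?_
        rw [lintegral_map (measurable_heat_right η _) hXω]
    _ ≤ ∫⁻ v, ENNReal.ofReal (L' (v, ω)) ^ 2 := by
        rw [hκ]
        exact lintegral_heat_withDensity_le hm hη
    _ ≤ ∫⁻ v, ‖L' (v, ω)‖ₑ ^ 2 := by
        refine lintegral_mono fun v => ?_
        gcongr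
        exact Real.ofReal_le_enorm _

/-- If the energies of the heat kernels are monotone and bounded, there is a local time. -/
theorem hasSquareIntegrableLocalTime_of_heatEnergy_le (hX : Measurable (Function.uncurry X))
    (hanti : ∀ η η' : ℝ≥0, η ≠ 0 → η ≤ η' →
      heatEnergy (volume.restrict T) P X η' ≤ heatEnergy (volume.restrict T) P X η)
    {C : ℝ≥0∞} (hC : C ≠ ∞) (hbdd : ∀ η, η ≠ 0 → heatEnergy (volume.restrict T) P X η ≤ C) :
    HasSquareIntegrableLocalTime P X T := by
  set ε : ℕ → ℝ≥0 := fun n => 1 / (n + 1) with hεdef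
  have hε : ∀ n, ε n ≠ 0 := fun n => by positivity
  have hε2 : ∀ n m, ε n + ε m ≠ 0 := fun n m => by positivity
  have hεanti : Antitone ε := fun n m h => by
    simp only [hεdef]
    gcongr
  have hε0 : Tendsto ε atTop (𝓝 0) := tendsto_one_div_add_atTop_nhds_zero_nat
  set J := heatEnergy (volume.restrict T) P X with hJ
  set g : ℕ → Space d × Ω → ℝ≥0∞ := fun n p =>
    mollifiedOccupation (volume.restrict T) X (ε n) p.1 p.2 with hg
  have hgm : ∀ n, Measurable (g n) := fun n => measurable_mollifiedOccupation hX _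
  have hgt : ∀ n p, g n p < ∞ := fun n p => mollifiedOccupation_lt_top _ _ _
  set G : ℕ → Space d × Ω → ℝ := fun n p => (g n p).toReal with hG
  have hGm : ∀ n, Measurable (G n) := fun n => (hgm n).ennreal_toReal
  have hgg : ∀ n m, ∫⁻ p, g n p * g m p ∂(volume.prod P) = J (ε n + ε m) := fun n m =>
    lintegral_mollifiedOccupation_mul hX (hε n) (hε m)
  have hJt : ∀ n m, J (ε n + ε m) ≠ ∞ := fun n m =>
    ne_top_of_le_ne_top hC (hbdd _ (hε2 n m))
  have hGG : ∀ n m, ∫ p, G n p * G m p ∂(volume.prod P) = (J (ε n + ε m)).toReal := fun n m => by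
    have hm : Measurable fun p => g n p * g m p := (hgm n).mul (hgm m)
    rw [← hgg n m, ← integral_toReal hm.aemeasurable
      (ae_of_all _ fun p => ENNReal.mul_lt_top (hgt n p) (hgt m p))]
    simp only [hG, ENNReal.toReal_mul]
  have hmem : ∀ n, MemLp (G n) 2 (volume.prod P) := fun n => by
    rw [memLp_two_iff_integrable_sq (hGm n).aestronglyMeasurable]
    have h1 := integrable_toReal_of_lintegral_ne_top ((hgm n).mul (hgm n)).aemeasurable
      (μ := volume.prod P) (by
        simp only [Pi.mul_apply]
        rw [hgg]
        exact hJt n n)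
    simpa only [Pi.mul_apply, hG, sq, ENNReal.toReal_mul] using h1
  set a : ℕ → Lp ℝ 2 ((volume : Measure (Space d)).prod P) := fun n => (hmem n).toLp (G n) with ha
  have hinner : ∀ n m, inner ℝ (a n) (a m) = (J (ε n + ε m)).toReal := fun n m => by
    rw [← hGG, L2.inner_def]
    refine integral_congr_ae ?_
    filter_upwards [(hmem n).coeFn_toLp, (hmem m).coeFn_toLp] with p h1 h2
    simp only [ha]
    rw [h1, h2]
    simp [mul_comm]
  set q : ℕ → ℝ := fun n => (J (ε n + ε n)).toReal with hq
  -- The square expands to `J(2ε_m) - 2J(ε_m+ε_n) + J(2ε_n)`, and `J(ε_m+ε_n) ≥ J(2ε_n)` because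
  -- `ε_m ≤ ε_n`. So `q` is monotone, and its boundedness makes `a` Cauchy.
  have hdist : ∀ n m, n ≤ m → ‖a m - a n‖ ^ 2 ≤ q m - q n := fun n m h => by
    rw [norm_sub_sq_real, ← real_inner_self_eq_norm_sq, ← real_inner_self_eq_norm_sq, hinner,
      hinner, hinner]
    have h1 : q n ≤ (J (ε m + ε n)).toReal :=
      ENNReal.toReal_mono (hJt m n) (hanti _ _ (hε2 m n) (by gcongr; exact hεanti h))
    simp only [hq] at h1 ⊢
    linarith
  have hqmono : Monotone q := fun n m h => by
    have := (sq_nonneg _).trans (hdist n m h)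
    linarith
  have hqbdd : BddAbove (range q) := ⟨C.toReal, by
    rintro _ ⟨n, rfl⟩
    exact ENNReal.toReal_mono hC (hbdd _ (hε2 n n))⟩
  have hqc : CauchySeq q := (tendsto_atTop_ciSup hqmono hqbdd).cauchySeq
  have hac : CauchySeq a := by
    rw [Metric.cauchySeq_iff'] at hqc ⊢
    intro r hr
    obtain ⟨n, hn⟩ := hqc (r ^ 2) (by positivity)
    refine ⟨n, fun m hm => ?_⟩
    have h1 := hn m hm
    rw [Real.dist_eq] at h1
    rw [dist_eq_norm]
    exact lt_of_pow_lt_pow_left₀ 2 hr.le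
      ((hdist n m hm).trans_lt ((le_abs_self _).trans_lt h1))
  obtain ⟨A, hA⟩ := cauchySeq_tendsto_of_complete hac
  have hAm : Measurable A := (Lp.stronglyMeasurable A).measurable
  rw [← Lp.toLp_coeFn A (Lp.memLp A), ha, Lp.tendsto_Lp_iff_tendsto_eLpNorm''] at hA
  -- A local time must be nonnegative everywhere, so `|A|` replaces `A`; since `G n ≥ 0`, this does
  -- not increase the distance.
  have hY : Tendsto (fun n => ∫⁻ ω, (∫⁻ v, ‖G n (v, ω) - |A (v, ω)|‖ₑ ^ 2) ∂P) atTop (𝓝 0) := by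
    have h1 : Tendsto (fun n => eLpNorm (G n - ⇑A) 2 (volume.prod P) ^ 2) atTop (𝓝 0) := by
      simpa using ENNReal.Tendsto.pow (n := 2) hA
    refine tendsto_of_tendsto_of_tendsto_of_le_of_le tendsto_const_nhds h1
      (fun n => zero_le) fun n => ?_
    have hm : Measurable fun p => ‖G n p - |A p|‖ₑ ^ 2 :=
      (((hGm n).sub hAm.abs).enorm).pow_const 2
    simp only
    rw [← lintegral_prod_symm' (fun p => ‖G n p - |A p|‖ₑ ^ 2) hm, eLpNorm_two_sq]
    refine lintegral_mono fun p => ?_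
    have h0 : 0 ≤ G n p := ENNReal.toReal_nonneg
    have h2 : ‖G n p - |A p|‖ ≤ ‖G n p - A p‖ := by
      have := abs_abs_sub_abs_le_abs_sub (G n p) (A p)
      rwa [abs_of_nonneg h0] at this
    gcongr
    exact enorm_le_iff_norm_le.2 h2
  have hAsq : ∀ᵐ ω ∂P, ∫⁻ v, ‖|A (v, ω)|‖ₑ ^ 2 < ∞ := by
    have hm : Measurable fun p => ‖|A p|‖ₑ ^ 2 := hAm.abs.enorm.pow_const 2
    refine ae_lt_top (hm.lintegral_prod_left' (μ := volume)) ?_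
    rw [← lintegral_prod_symm' _ hm, ← eLpNorm_two_sq]
    exact ENNReal.pow_ne_top (Lp.memLp A).abs.eLpNorm_ne_top
  -- Along a subsequence the sections converge in `L²(dv)` for almost every `ω`, which allows the
  -- density to be identified path by path.
  obtain ⟨ns, hns, hae⟩ := exists_subseq_tendsto_ae_zero (fun n => by
    have hm : Measurable fun p => ‖G n p - |A p|‖ₑ ^ 2 :=
      (((hGm n).sub hAm.abs).enorm).pow_const 2
    exact hm.lintegral_prod_left' (μ := volume)) hY
  refine ⟨fun v ω => |A (v, ω)|, ⟨fun _ _ => abs_nonneg _, ?_⟩, (Lp.memLp A).abs⟩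
  filter_upwards [hAsq, hae] with ω hω hlim
  have hXω := measurable_section hX ω
  have hℓ : Measurable fun v => |A (v, ω)| := (hAm.comp measurable_prodMk_right).abs
  rw [← map_restrict_eq_withDensity_iff hXω]
  refine map_eq_withDensity_of_tendsto hXω hℓ (fun _ => abs_nonneg _)
    ⟨hℓ.aestronglyMeasurable, ?_⟩ (fun n => hε (ns n)) (hε0.comp hns.tendsto_atTop) hlim
  rw [← eLpNorm_two_sq] at hω
  exact (ENNReal.pow_lt_top_iff.1 hω).resolve_right (by norm_num)

end LocalTime

/-! ### The integral criterion for Gaussian fields. -/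

section Criterion

open scoped NNReal

theorem inv_sqrt_pow_eq {c ρ : ℝ} (hc : 0 < c) (hρ : 0 < ρ) (α : ℝ) (d : ℕ) :
    (√(2 * Real.pi * (c * ρ ^ (2 * α))))⁻¹ ^ d =
      (√(2 * Real.pi * c))⁻¹ ^ d * ρ ^ (-(α * d)) := by
  have h1 : ρ ^ (2 * α) = (ρ ^ α) ^ 2 := by
    rw [← Real.rpow_natCast, ← Real.rpow_mul hρ.le]
    norm_num [mul_comm]
  rw [← mul_assoc, Real.sqrt_mul (by positivity), h1, Real.sqrt_sq (by positivity), mul_inv,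
    mul_pow, Real.rpow_neg hρ.le, Real.rpow_mul hρ.le, Real.rpow_natCast, inv_pow (ρ ^ α)]

variable {d : ℕ} {Z Ω : Type*} [NormedAddCommGroup Z] [NormedSpace ℝ Z] [FiniteDimensional ℝ Z]
  [MeasureSpace Z] [BorelSpace Z] [(volume : Measure Z).IsAddHaarMeasure]
  [MeasurableSpace Ω] {P : Measure Ω} [IsProbabilityMeasure P] {X : Z → Ω → Space d} {T : Set Z}
  {V : Z → Z → ℝ≥0} {α c C : ℝ}

theorem setLIntegral_const_mul_norm_rpow (K : ℝ) (hK : 0 ≤ K) (p : ℝ) (T : Set Z) :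
    ∫⁻ z in T, ∫⁻ w in T, ENNReal.ofReal (K * ‖z - w‖ ^ (-p)) =
      ENNReal.ofReal K * ∫⁻ z in T, ∫⁻ w in T, ENNReal.ofReal (‖z - w‖ ^ (-p)) := by
  have hm : Measurable fun q : Z × Z => ENNReal.ofReal (‖q.1 - q.2‖ ^ (-p)) := by fun_prop
  rw [← lintegral_const_mul _ hm.lintegral_prod_right']
  refine lintegral_congr fun z => ?_
  have hmz : Measurable fun w : Z => ENNReal.ofReal (‖z - w‖ ^ (-p)) := by fun_prop
  rw [← lintegral_const_mul _ hmz]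
  simp_rw [ENNReal.ofReal_mul hK]

/-- A Gaussian field whose increments have variance of order `‖z - w‖ ^ (2 α)` has a
square-integrable local time if and only if `α d` is less than the dimension of the parameter space. -/
theorem hasSquareIntegrableLocalTime_iff [Nontrivial Z] (hd : 1 ≤ d) (hX : Measurable (Function.uncurry X))
    (hT : MeasurableSet T) (hTb : Bornology.IsBounded T) (hTi : (interior T).Nonempty)
    (hα : 0 < α) (hc : 0 < c) (hC : 0 < C)
    (hlaw : ∀ z ∈ T, ∀ w ∈ T, P.map (fun ω => X z ω - X w ω) = gaussN (V z w) 0)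
    (hlow : ∀ z ∈ T, ∀ w ∈ T, c * ‖z - w‖ ^ (2 * α) ≤ V z w)
    (hup : ∀ z ∈ T, ∀ w ∈ T, V z w ≤ C * ‖z - w‖ ^ (2 * α)) :
    HasSquareIntegrableLocalTime P X T ↔ α * d < Module.finrank ℝ Z := by
  have hfin : IsFiniteMeasure ((volume : Measure Z).restrict T) :=
    ⟨by simpa using hTb.measure_lt_top⟩
  have hαd : 0 < α * d := by positivity
  have hE : ∀ η : ℝ≥0, η ≠ 0 → heatEnergy (volume.restrict T) P X η =
      ∫⁻ z in T, ∫⁻ w in T, heat (η + V z w) (0 : Space d) 0 := fun η hη => by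
    rw [heatEnergy_eq hX]
    refine setLIntegral_congr_fun hT fun z hz => setLIntegral_congr_fun hT fun w hw => ?_
    exact lintegral_heat_of_map_eq hX (hlaw z hz w hw) hη
  constructor
  · rintro ⟨L, hL, hL2⟩
    by_contra! hcon
    set F : ℕ → Z × Z → ℝ≥0∞ := fun n p =>
      ENNReal.ofReal ((√(2 * Real.pi * (1 / ((n : ℝ) + 1) + C * ‖p.1 - p.2‖ ^ (2 * α))))⁻¹ ^ d)
      with hF
    have hFm : ∀ n, Measurable (F n) := fun n => by
      simp only [hF]
      fun_prop
    set M := eLpNorm (fun p : Space d × Ω => L p.1 p.2) 2 (volume.prod P) ^ 2 with hM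
    have hMt : M ≠ ∞ := ENNReal.pow_ne_top hL2.eLpNorm_ne_top
    have hFM : ∀ n, ∫⁻ p, F n p ∂((volume : Measure Z).restrict T).prod (volume.restrict T) ≤ M :=
      fun n => by
        have hη : ((1 : ℝ≥0) / (n + 1)) ≠ 0 := by positivity
        refine le_trans ?_ (heatEnergy_le_of_isLocalTime hX hL hL2 hη)
        rw [hE _ hη, lintegral_prod _ (hFm n).aemeasurable]
        refine setLIntegral_mono' hT fun z hz => setLIntegral_mono' hT fun w hw => ?_
        rw [heat_zero_zero]
        simp only [hF]
        push_cast
        gcongr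
        exact hup z hz w hw
    have hlim : ∀ p : Z × Z, ENNReal.ofReal ((√(2 * Real.pi * C))⁻¹ ^ d *
        ‖p.1 - p.2‖ ^ (-(α * d))) ≤ liminf (fun n => F n p) atTop := fun p => by
      -- On the diagonal the left side is `0`, since `0` to a nonzero real power is `0` in
      -- `Real.rpow`; the divergence comes from the points off the diagonal.
      rcases (norm_nonneg (p.1 - p.2)).eq_or_lt with h0 | h0
      · rw [← h0, Real.zero_rpow (by linarith), mul_zero, ENNReal.ofReal_zero]
        exact zero_le
      · rw [← inv_sqrt_pow_eq hC h0]
        have hpos : √(2 * Real.pi * (0 + C * ‖p.1 - p.2‖ ^ (2 * α))) ≠ 0 := by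
          rw [zero_add]
          positivity
        have h1 : Tendsto (fun n : ℕ => (√(2 * Real.pi * (1 / ((n : ℝ) + 1) +
            C * ‖p.1 - p.2‖ ^ (2 * α))))⁻¹ ^ d) atTop
            (𝓝 ((√(2 * Real.pi * (0 + C * ‖p.1 - p.2‖ ^ (2 * α))))⁻¹ ^ d)) :=
          ((((tendsto_one_div_add_atTop_nhds_zero_nat.add_const _).const_mul _).sqrt).inv₀
            hpos).pow d
        have h2 := (ENNReal.continuous_ofReal.tendsto _).comp h1
        rw [zero_add] at h2
        exact h2.liminf_eq.ge
    have hle : ∫⁻ p : Z × Z, ENNReal.ofReal ((√(2 * Real.pi * C))⁻¹ ^ d *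
        ‖p.1 - p.2‖ ^ (-(α * d))) ∂((volume : Measure Z).restrict T).prod (volume.restrict T) ≤ M :=
      calc _ ≤ _ := lintegral_mono hlim
        _ ≤ _ := lintegral_liminf_le hFm
        _ ≤ M := liminf_le_of_le (by isBoundedDefault) fun b hb => by
          obtain ⟨n, hn⟩ := hb.exists
          exact hn.trans (hFM n)
    rw [lintegral_prod _ (by fun_prop), setLIntegral_const_mul_norm_rpow _ (by positivity),
      lintegral_norm_sub_rpow_eq_top volume hcon hTi, ENNReal.mul_top] at hle
    · exact hMt (top_le_iff.1 hle)
    · rw [ne_eq, ENNReal.ofReal_eq_zero, not_le]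
      positivity
  · intro h
    refine hasSquareIntegrableLocalTime_of_heatEnergy_le hX (fun η η' hη hle => ?_)
      (C := ENNReal.ofReal ((√(2 * Real.pi * c))⁻¹ ^ d) *
        ∫⁻ z in T, ∫⁻ w in T, ENNReal.ofReal (‖z - w‖ ^ (-(α * d))))
      (ENNReal.mul_lt_top ENNReal.ofReal_lt_top
        (lintegral_norm_sub_rpow_lt_top volume h hTb)).ne fun η hη => ?_
    · rw [hE η hη, hE η' (fun h0 => hη (le_antisymm (h0 ▸ hle) zero_le))]
      refine lintegral_mono fun z => lintegral_mono fun w => ?_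
      exact heat_zero_zero_anti (fun h0 => hη (add_eq_zero.1 h0).1) (by gcongr)
    · rw [hE η hη, ← setLIntegral_const_mul_norm_rpow _ (by positivity)]
      refine setLIntegral_mono' hT fun z hz => setLIntegral_mono_ae' hT ?_
      -- The diagonal must be excluded: there the junk value `0` of the negative power would make
      -- the bound false.
      filter_upwards [Measure.ae_ne volume z] with w hwz hw
      have hpos : 0 < ‖z - w‖ := norm_pos_iff.2 (sub_ne_zero.2 hwz.symm)
      rw [heat_zero_zero, ← inv_sqrt_pow_eq hc hpos]
      have h1 := hlow z hz w hw
      have h2 : (0 : ℝ) ≤ η := η.2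
      push_cast
      gcongr
      linarith

end Criterion

/-! ### Local times of the solution -/

theorem hpNormSq_sub_self {N : ℕ} (H : ℝ) (h : Space N → ℝ) (m : ℝ → Space N → ℂ) :
    hpNormSq H h (fun r ξ => m r ξ - m r ξ) = 0 := by
  simp [hpNormSq, timeForm]

/-- The local time criterion for the solution restricted to the image of an isometric
parametrization `z ↦ (τ z, χ z)` of a part of space-time, for the norm `max |t| ‖x‖`. -/
theorem solution_hasSquareIntegrableLocalTime_iff {N d : ℕ} [Nontrivial (Space N)] (hd : 1 ≤ d)
    {H β : ℝ} (hH : 1 / 2 ≤ H) (hH1 : H < 1) (hβ : 0 < β) (hβN : β < N)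
    (hβlow : (N : ℝ) - 2 * H - 1 < β) (hβup : β < (N : ℝ) - 2 * H + 1) {f h : Space N → ℝ}
    (hfh : IsSpatialCovariance β f h) {Ω : Type*} [MeasurableSpace Ω] {P : Measure Ω}
    [IsProbabilityMeasure P] {W : Fin d → Test N → Ω → ℝ} (hW : IsNoise P H f W)
    {u : ℝ → Space N → Ω → EuclideanSpace ℝ (Fin d)} (hu : IsSolution P H h W u) {α : ℝ}
    (hα : α = (2 * H + 1 - N + β) / 2) {a b : ℝ} (ha : 0 < a) {Z : Type*}
    [NormedAddCommGroup Z] [NormedSpace ℝ Z] [FiniteDimensional ℝ Z] [Nontrivial Z]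
    [MeasureSpace Z] [BorelSpace Z] [(volume : Measure Z).IsAddHaarMeasure] {τ : Z → ℝ}
    {χ : Z → Space N} (hτ : Measurable τ) (hχ : Measurable χ)
    (hiso : ∀ z w, max |τ z - τ w| ‖χ z - χ w‖ = ‖z - w‖) {T : Set Z} (hT : IsCompact T)
    (hTi : (interior T).Nonempty) (hab : ∀ z ∈ T, τ z ∈ Icc a b) :
    HasSquareIntegrableLocalTime P (fun z => u (τ z) (χ z)) T ↔
      α * d < Module.finrank ℝ Z := by
  obtain ⟨z₀, hz₀⟩ := hTi.mono interior_subset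
  have hb : 0 < b := ha.trans_le ((hab z₀ hz₀).1.trans (hab z₀ hz₀).2)
  -- A bound for the diameter of `T`; the variance lower bound is uniform only over increments of
  -- bounded size.
  obtain ⟨D, hD⟩ := Metric.isBounded_iff.1 hT.isBounded
  obtain ⟨C, hC, hCle⟩ := exists_hpNormSq_le hH hH1 hβlow hβup hfh hb
  obtain ⟨c, hc, hcle⟩ := exists_le_hpNormSq hH hH1 hβ hfh D ha
  have h2α : 2 * α = 2 * H + 1 - N + β := by rw [hα]; ring
  have hα0 : 0 < α := by linarith
  set v : Z → Z → ℝ≥0∞ := fun z w =>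
    hpNormSq H h (fun r ξ => gFourier (τ z) (χ z) r ξ - gFourier (τ w) (χ w) r ξ) with hv
  have hvup : ∀ z ∈ T, ∀ w ∈ T, v z w ≤ ENNReal.ofReal (C * ‖z - w‖ ^ (2 * α)) :=
    fun z hz w hw => by
      rcases eq_or_ne z w with rfl | hne
      · simp only [hv, hpNormSq_sub_self]
        exact zero_le
      · rw [h2α]
        exact hCle _ _ _ _ _ ⟨ha.le.trans (hab z hz).1, (hab z hz).2⟩
          ⟨ha.le.trans (hab w hw).1, (hab w hw).2⟩ (norm_pos_iff.2 (sub_ne_zero.2 hne))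
          ((le_max_left _ _).trans (hiso z w).le) ((le_max_right _ _).trans (hiso z w).le)
  have hvfin : ∀ z ∈ T, ∀ w ∈ T, v z w ≠ ∞ := fun z hz w hw =>
    ne_top_of_le_ne_top ENNReal.ofReal_ne_top (hvup z hz w hw)
  have hvlow : ∀ z ∈ T, ∀ w ∈ T, ENNReal.ofReal (c * ‖z - w‖ ^ (2 * α)) ≤ v z w :=
    fun z hz w hw => by
      rcases eq_or_ne z w with rfl | hne
      · rw [sub_self, norm_zero, Real.zero_rpow (by linarith), mul_zero, ENNReal.ofReal_zero]
        exact zero_le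
      · rw [h2α]
        refine hcle _ _ _ _ _ (hab z hz).1 (hab w hw).1 (norm_pos_iff.2 (sub_ne_zero.2 hne)) ?_
          (hiso z w).symm
        rw [← dist_eq_norm]
        exact hD hz hw
  refine hasSquareIntegrableLocalTime_iff (V := fun z w => (v z w).toNNReal) hd ?_
    hT.measurableSet hT.isBounded hTi hα0 hc hC (fun z hz w hw => ?_) (fun z hz w hw => ?_)
    fun z hz w hw => ?_
  · exact hu.measurable.comp (by fun_prop : Measurable fun p : Z × Ω => (τ p.1, χ p.1, p.2))
  · exact solution_sub_map_eq hH hH1 hβ hβN hfh hW hu (ha.le.trans (hab z hz).1)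
      (ha.le.trans (hab w hw).1) _ _ (hvfin z hz w hw)
  · exact (ENNReal.ofReal_le_iff_le_toReal (hvfin z hz w hw)).1 (hvlow z hz w hw)
  · exact ENNReal.toReal_le_of_le_ofReal (by positivity) (hvup z hz w hw)

/-! ### Compact boxes in Euclidean space. -/

theorem box_eq_preimage {N : ℕ} (c e : Space N) :
    box c e = EuclideanSpace.equiv (Fin N) ℝ ⁻¹' (Set.pi univ fun i => Icc (c i) (e i)) := by
  ext x
  simp only [box, mem_ofPred_eq, mem_preimage, Set.mem_pi, mem_univ, forall_true_left, mem_Icc]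
  rfl

theorem isCompact_box {N : ℕ} (c e : Space N) : IsCompact (box c e) := by
  rw [box_eq_preimage]
  exact (EuclideanSpace.equiv (Fin N) ℝ).toHomeomorph.isCompact_preimage.2
    (isCompact_univ_pi fun i => isCompact_Icc)

theorem interior_box_nonempty {N : ℕ} {c e : Space N} (hce : ∀ i, c i < e i) :
    (interior (box c e)).Nonempty := by
  rw [box_eq_preimage]
  have hsub : EuclideanSpace.equiv (Fin N) ℝ ⁻¹' (Set.pi univ fun i => Ioo (c i) (e i)) ⊆
      interior (EuclideanSpace.equiv (Fin N) ℝ ⁻¹' (Set.pi univ fun i => Icc (c i) (e i))) :=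
    interior_maximal (preimage_mono (pi_mono fun i _ => Ioo_subset_Icc_self))
      ((isOpen_set_pi finite_univ fun i _ => isOpen_Ioo).preimage
        (EuclideanSpace.equiv (Fin N) ℝ).continuous)
  refine Nonempty.mono hsub ⟨WithLp.toLp 2 fun i => (c i + e i) / 2, fun i _ => ?_⟩
  have := hce i
  constructor <;> simp <;> linarith

end FractionalWave

end

/-! ### The three parameter sets: time, space, space-time. -/

theorem theorem4p1 {N d : ℕ} (hd : 1 ≤ d) {H β : ℝ}
    (hH : 1 / 2 ≤ H) (hH1 : H < 1) (hβ : 0 < β) (hβN : β < N)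
    (hβlow : (N : ℝ) - 2 * H - 1 < β) (hβup : β < (N : ℝ) - 2 * H + 1)
    {f h : FractionalWave.Space N → ℝ} (hfh : FractionalWave.IsSpatialCovariance β f h)
    {Ω : Type*} [MeasurableSpace Ω] (P : Measure Ω) [IsProbabilityMeasure P]
    {W : Fin d → FractionalWave.Test N → Ω → ℝ} (hW : FractionalWave.IsNoise P H f W)
    {u : ℝ → FractionalWave.Space N → Ω → EuclideanSpace ℝ (Fin d)}
    (hu : FractionalWave.IsSolution P H h W u)
    {α : ℝ} (hα : α = (2 * H + 1 - N + β) / 2)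
    {a b : ℝ} (ha : 0 < a) (hab : a < b)
    {c e : FractionalWave.Space N} (hce : ∀ i, c i < e i) :
    (∀ x₀ : FractionalWave.Space N,
      FractionalWave.HasSquareIntegrableLocalTime P (fun t : ℝ => u t x₀) (Icc a b)
        ↔ α * d < 1) ∧
    (∀ t₀ : ℝ, 0 < t₀ →
      (FractionalWave.HasSquareIntegrableLocalTime P (fun x : FractionalWave.Space N => u t₀ x)
        (FractionalWave.box c e) ↔ α * d < N)) ∧
    (FractionalWave.HasSquareIntegrableLocalTime P
        (fun z : ℝ × FractionalWave.Space N => u z.1 z.2)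
        (Icc a b ×ˢ FractionalWave.box c e) ↔ α * d < 1 + N) := by
  have hN : 0 < N := by
    have : (0 : ℝ) < N := hβ.trans hβN
    exact_mod_cast this
  have hne : Nonempty (Fin N) := ⟨⟨0, hN⟩⟩
  have hnt : Nontrivial (FractionalWave.Space N) := inferInstance
  have hIcc : (interior (Icc a b)).Nonempty := by
    rw [interior_Icc]
    exact nonempty_Ioo.2 hab
  have hhaar : (volume : Measure (ℝ × FractionalWave.Space N)).IsAddHaarMeasure :=
    inferInstanceAs ((volume : Measure ℝ).prod
      (volume : Measure (FractionalWave.Space N))).IsAddHaarMeasure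
  have hbox := FractionalWave.isCompact_box c e
  have hboxi := FractionalWave.interior_box_nonempty hce
  refine ⟨fun x₀ => ?_, fun t₀ ht₀ => ?_, ?_⟩
  · have h1 := FractionalWave.solution_hasSquareIntegrableLocalTime_iff hd hH hH1 hβ hβN hβlow
      hβup hfh hW hu hα ha (τ := fun t : ℝ => t) (χ := fun _ => x₀) measurable_id
      measurable_const (fun z w => by simp) isCompact_Icc hIcc fun z hz => hz
    simpa using h1
  -- At a fixed time the time interval degenerates to `[t₀, t₀]`.
  · have h1 := FractionalWave.solution_hasSquareIntegrableLocalTime_iff hd hH hH1 hβ hβN hβlow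
      hβup hfh hW hu hα ht₀ (τ := fun _ : FractionalWave.Space N => t₀) (χ := fun x => x)
      measurable_const measurable_id (fun z w => by simp) hbox hboxi
      fun z _ => ⟨le_rfl, le_rfl⟩
    simpa using h1
  -- The norm of `ℝ × Space N` is by definition the maximum of the two norms, so the isometry
  -- condition is `rfl`.
  · have h1 := FractionalWave.solution_hasSquareIntegrableLocalTime_iff hd hH hH1 hβ hβN hβlow
      hβup hfh hW hu hα ha (τ := fun z : ℝ × FractionalWave.Space N => z.1) (χ := fun z => z.2)
      measurable_fst measurable_snd (fun z w => rfl) (isCompact_Icc.prod hbox)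
      (by rw [interior_prod_eq]; exact hIcc.prod hboxi) fun z hz => hz.1
    simpa using h1
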